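/- Let $D$ be a finite-dimensional division $\mathbb{Q}$-algebra and let $\mathcal{O}$ be an order in $D$, i.e. a (unital) subring of $D$ that is finitely generated as a $\mathbb{Z}$-module and contains a $\mathbb{Q}$-basis of $D$. Assume that the unit group $\mathcal{U}(\mathcal{O})$ is finite. Let $\mathrm{E}_2(\mathcal{O})\le \mathrm{GL}_2(\mathcal{O})$ be the subgroup generated by the elementary matrices $\begin{pmatrix}1&x\\0&1\end{pmatrix}$ and $\begin{pmatrix}1&0\\x&1\end{pmatrix}$ with $x\in\mathcal{O}$, let $\mathrm{E}_2(\mathcal{O})^{ab}$ be its abelianization, and put $$\mathrm{inv}_{\mathcal{O}}=\max\{\,|B\cap\mathcal{U}(\mathcal{O})| \;:\; B \text{ a } \mathbb{Z}\text{-module basis of } \mathcal{O}\,\}.$$ Then $$\operatorname{rank}_{\mathbb{Z}}\mathrm{E}_2(\mathcal{O})^{ab}=\operatorname{rank}_{\mathbb{Z}}\mathcal{O}-\mathrm{inv}_{\mathcal{O}}.$$ Moreover, the following are equivalent: (a) $\mathrm{E}_2(\mathcal{O})^{ab}$ is finite; (b) $\mathcal{O}$ is isomorphic, as a ring, to one of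 $\mathbb{Z}$, $\mathcal{I}_1$, $\mathcal{I}_3$, $\mathcal{L}$, $\mathcal{O}_2$, $\mathcal{O}_3$; (c) $\mathcal{O}$ has a $\mathbb{Z}$-basis consisting of units of $\mathcal{O}$; (d) $\mathcal{O}$ is generated as a ring by $\mathcal{U}(\mathcal{O})$; (e) $\mathcal{O}$ is generated as a $\mathbb{Z}$-module by $\mathcal{U}(\mathcal{O})$. Here $\mathcal{I}_d$ is the ring of algebraic integers of $\mathbb{Q}(\sqrt{-d})$. For nonzero $u,v\in\mathbb{Q}$, $\left(\frac{u,v}{\mathbb{Q}}\right)$ is the quaternion algebra with $\mathbb{Q}$-basis $1,i,j,k$ and $i^2=u$, $j^2=v$, $ij=k=-ji$. The Lipschitz order $\mathcal{L}$ is the $\mathbb{Z}$-span of $1,i,j,k$ in $\mathbb{H}_2=\left(\frac{-1,-1}{\mathbb{Q}}\right)$; the maximal order $\mathcal{O}_2$ of $\mathbb{H}_2$ is the $\mathbb{Z}$-span of $1,i,j,\frac{1+i+j+k}{2}$; and the maximal order $\mathcal{O}_3$ of $\mathbb{H}_3=\left(\frac{-1,-3}{\mathbb{Q}}\right)$ is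 the $\mathbb{Z}$-span of $1,i,\frac{1+j}{2},\frac{i+k}{2}$. -/

import Mathlib

namespace OrderElem

section ElementaryGroup

variable (n : Type*) [Fintype n] [DecidableEq n] (R : Type*) [Ring R]

variable {n R} in
/-- The elementary matrix `e_ij(r)` (with `i ≠ j`): ones on the diagonal, `r` in position `(i, j)`
and zeros elsewhere, as an element of `GL_n(R)`, over a ring that need not be commutative. -/
def elementaryMatrix (i j : n) (hij : i ≠ j) (r : R) : GL n R where
  val := 1 + Matrix.single i j r
  inv := 1 + Matrix.single i j (-r)
  val_inv := by
    rw [mul_add, mul_one, add_mul, one_mul, Matrix.single_mul_single_of_ne _ _ _ _ hij.symm,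
      add_zero, add_assoc, ← Matrix.single_add, add_neg_cancel, Matrix.single_zero, add_zero]
  inv_val := by
    rw [mul_add, mul_one, add_mul, one_mul, Matrix.single_mul_single_of_ne _ _ _ _ hij.symm,
      add_zero, add_assoc, ← Matrix.single_add, neg_add_cancel, Matrix.single_zero, add_zero]

/-- The group `E_n(R)`: the subgroup of `GL_n(R)` generated by all elementary matrices. -/
def elementaryGroup : Subgroup (GL n R) :=
  Subgroup.closure {g | ∃ (i j : n) (hij : i ≠ j) (r : R), g = elementaryMatrix i j hij r}

end ElementaryGroup

/-- A `ℤ`-order in a finite-dimensional `ℚ`-algebra `A`: a subring that is finitely generated as a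
`ℤ`-module and contains a `ℚ`-basis of `A`. -/
structure IsZOrder {A : Type*} [Ring A] [Algebra ℚ A] (O : Subring A) : Prop where
  finite : Module.Finite ℤ O
  contains_basis : ∃ (B : Set A), B ⊆ O ∧ LinearIndepOn ℚ id B ∧ Submodule.span ℚ B = ⊤

/-- `B` is a `ℤ`-module basis of the ring `R`. -/
def IsZBasis {R : Type*} [Ring R] (B : Set R) : Prop :=
  LinearIndepOn ℤ id B ∧ Submodule.span ℤ B = ⊤

/-- The set of all numbers `|B ∩ U(R)|`, where `B` runs through the `ℤ`-module bases of `R`. -/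
def unitCounts (R : Type*) [Ring R] : Set ℕ :=
  {m | ∃ B : Set R, IsZBasis B ∧ m = (B ∩ {x | IsUnit x}).ncard}

/-- `inv_R`, the maximal number of units in a `ℤ`-module basis of `R`. -/
noncomputable def invNumber (R : Type*) [Ring R] : ℕ := sSup (unitCounts R)

/-- If `R` is free of finite rank over `ℤ`, then `invNumber R` is a genuine maximum. -/
theorem isGreatest_invNumber (R : Type*) [Ring R] [Module.Finite ℤ R] [Module.Free ℤ R] :
    IsGreatest (unitCounts R) (invNumber R) := by
  have hne : (unitCounts R).Nonempty := by
    let b := Module.Free.chooseBasis ℤ R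
    refine ⟨_, Set.range b, ⟨?_, b.span_eq⟩, rfl⟩
    exact b.linearIndependent.linearIndepOn_id
  have hbdd : BddAbove (unitCounts R) := by
    refine ⟨Module.finrank ℤ R, ?_⟩
    rintro m ⟨B, ⟨hB, -⟩, rfl⟩
    have hfin : B.Finite := LinearIndependent.setFinite hB
    refine (Set.ncard_le_ncard Set.inter_subset_left hfin).trans ?_
    have := hfin.fintype
    rw [← Nat.card_coe_set_eq, Nat.card_eq_fintype_card]
    exact LinearIndependent.fintype_card_le_finrank hB
  exact ⟨Nat.sSup_mem hne hbdd, fun m hm => le_csSup hbdd hm⟩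

/-- The ring `I_d` of algebraic integers in `ℚ(√-d)`. -/
abbrev imagQuadIntegers (d : ℕ) : Type :=
  integralClosure ℤ (QuadraticAlgebra ℚ (-(d : ℚ)) 0)

/-- The rational quaternion algebra `(u, v / ℚ)`, with `i² = u`, `j² = v`, `ij = k = -ji`. -/
abbrev RatQuaternion (u v : ℚ) : Type := QuaternionAlgebra ℚ u 0 v

/-- The Lipschitz quaternions: the `ℤ`-span of `1, i, j, k` in `(-1, -1 / ℚ)`. -/
def lipschitz : Subring (RatQuaternion (-1) (-1)) where
  carrier := {x | ∃ a b c d : ℤ, x = a • (⟨1, 0, 0, 0⟩ : RatQuaternion (-1) (-1))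
    + b • (⟨0, 1, 0, 0⟩ : RatQuaternion (-1) (-1)) + c • (⟨0, 0, 1, 0⟩ : RatQuaternion (-1) (-1))
    + d • (⟨0, 0, 0, 1⟩ : RatQuaternion (-1) (-1))}
  zero_mem' := ⟨0, 0, 0, 0, by simp⟩
  one_mem' := ⟨1, 0, 0, 0, by ext <;> simp⟩
  add_mem' := by
    rintro _ _ ⟨a, b, c, d, rfl⟩ ⟨a', b', c', d', rfl⟩
    exact ⟨a + a', b + b', c + c', d + d', by module⟩
  neg_mem' := by
    rintro _ ⟨a, b, c, d, rfl⟩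
    exact ⟨-a, -b, -c, -d, by module⟩
  mul_mem' := by
    rintro _ _ ⟨a, b, c, d, rfl⟩ ⟨a', b', c', d', rfl⟩
    refine ⟨a * a' - b * b' - c * c' - d * d', a * b' + b * a' + c * d' - d * c',
      a * c' + c * a' + d * b' - b * d', a * d' + d * a' + b * c' - c * b', ?_⟩
    ext <;> simp <;> ring

/-- The maximal order `O_2` of `(-1, -1 / ℚ)`: the `ℤ`-span of `1, i, j, (1 + i + j + k)/2`. -/
def hurwitz : Subring (RatQuaternion (-1) (-1)) where
  carrier := {x | ∃ a b c d : ℤ, x = a • (⟨1, 0, 0, 0⟩ : RatQuaternion (-1) (-1))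
    + b • (⟨0, 1, 0, 0⟩ : RatQuaternion (-1) (-1)) + c • (⟨0, 0, 1, 0⟩ : RatQuaternion (-1) (-1))
    + d • (⟨1 / 2, 1 / 2, 1 / 2, 1 / 2⟩ : RatQuaternion (-1) (-1))}
  zero_mem' := ⟨0, 0, 0, 0, by simp⟩
  one_mem' := ⟨1, 0, 0, 0, by ext <;> simp⟩
  add_mem' := by
    rintro _ _ ⟨a, b, c, d, rfl⟩ ⟨a', b', c', d', rfl⟩
    exact ⟨a + a', b + b', c + c', d + d', by module⟩
  neg_mem' := by
    rintro _ ⟨a, b, c, d, rfl⟩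
    exact ⟨-a, -b, -c, -d, by module⟩
  mul_mem' := by
    rintro _ _ ⟨a, b, c, d, rfl⟩ ⟨a', b', c', d', rfl⟩
    refine ⟨a * a' - b * b' - c * c' - b * c' + c * b' - b * d' - d * c' - d * d',
      a * b' + b * a' - b * c' + c * b' + d * b' + c * d' - d * c',
      a * c' + c * a' - b * c' + c * b' + c * d' - b * d' + d * b',
      a * d' + d * a' + b * d' + d * c' - c * d' - d * b' + d * d' + 2 * (b * c') - 2 * (c * b'),
      ?_⟩
    ext <;> simp <;> ring

/-- The maximal order `O_3` of `(-1, -3 / ℚ)`: the `ℤ`-span of `1, i, (1 + j)/2, (i + k)/2`. -/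
def orderThree : Subring (RatQuaternion (-1) (-3)) where
  carrier := {x | ∃ a b c d : ℤ, x = a • (⟨1, 0, 0, 0⟩ : RatQuaternion (-1) (-3))
    + b • (⟨0, 1, 0, 0⟩ : RatQuaternion (-1) (-3))
    + c • (⟨1 / 2, 0, 1 / 2, 0⟩ : RatQuaternion (-1) (-3))
    + d • (⟨0, 1 / 2, 0, 1 / 2⟩ : RatQuaternion (-1) (-3))}
  zero_mem' := ⟨0, 0, 0, 0, by simp⟩
  one_mem' := ⟨1, 0, 0, 0, by ext <;> simp⟩
  add_mem' := by
    rintro _ _ ⟨a, b, c, d, rfl⟩ ⟨a', b', c', d', rfl⟩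
    exact ⟨a + a', b + b', c + c', d + d', by module⟩
  neg_mem' := by
    rintro _ ⟨a, b, c, d, rfl⟩
    exact ⟨-a, -b, -c, -d, by module⟩
  mul_mem' := by
    rintro _ _ ⟨a, b, c, d, rfl⟩ ⟨a', b', c', d', rfl⟩
    refine ⟨a * a' - c * c' - b * b' - d * b' - d * d',
      a * b' + c * b' + c * d' + b * a' - d * c',
      a * c' + c * a' + c * c' - b * d' + d * b',
      a * d' + d * a' + d * c' + b * c' - c * b', ?_⟩
    ext <;> simp <;> ring

end OrderElem

/-! A subfield K of D inherits finiteness: some power of every unit of its ring of integers lies in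
O, so all units of K are torsion and Dirichlet's theorem leaves one infinite place. Hence every
element of D is rational or imaginary quadratic, and a Frobenius-type argument embeds D in
Hamilton's quaternions. The order O acquires integral traces and norms from a positive definite
form; this is `IsDefinite`, and everything else is deduced from it.

For the rank, x ↦ [upper elementary matrix of x] is a surjection from O onto the abelianization
(`upperClass`). It suffices that its kernel and the span of the units have the same saturation. The
squares of the Weyl elements attached to units give 12[u] = 0 (`twelve_zsmul_upperClass`), which is
one half. The other half is `ker_upperClass_le`. If two units do not commute, O is already spanned
by units. If all units commute, matrices are marked with a class modulo the saturated unit span; a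
peak reduction on words in elementary matrices, in the style of Cohn and resting on the bound N(a) <
4, shows that the mark of an upper triangular product is determined by its matrix
(`Reach.isTriangular`). So the rank of the abelianization is the corank of the unit span.

For the invariant and the equivalences, units other than ±1 have trace -1, 0 or 1. A short case
analysis on traces shows that a ring spanned by its units up to finite index is one of the six in
the list, each of which has a basis of units. Applied to the saturation of the unit span, whose
quotient is torsion-free, this yields a basis of O containing as many units as the rank of that
span, so `invNumber` equals that rank. -/

section

open scoped Quaternion

/-! ### Rings with a positive definite integral norm. -/

/-- A ring homomorphism to Hamilton's quaternions exhibiting its source as a ring with integral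
reduced traces and norms. -/
structure IsDefinite {R : Type*} [Ring R] (φ : R →+* ℍ[ℝ]) : Prop where
  injective : Function.Injective φ
  exists_trace : ∀ x, ∃ t : ℤ, φ x + star (φ x) = t
  exists_norm : ∀ x, ∃ n : ℤ, φ x * star (φ x) = n

namespace IsDefinite

variable {R : Type*} [Ring R] {φ : R →+* ℍ[ℝ]} (h : IsDefinite φ)

/-- The reduced trace. -/
noncomputable def tr (x : R) : ℤ := (h.exists_trace x).choose

/-- The reduced norm. -/
noncomputable def nrm (x : R) : ℤ := (h.exists_norm x).choose

/-- The canonical involution. -/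
noncomputable def conj (x : R) : R := h.tr x - x

theorem map_conj (x : R) : φ (h.conj x) = star (φ x) := by
  have := (h.exists_trace x).choose_spec
  rw [conj, map_sub, map_intCast, tr, ← this, add_sub_cancel_left]

theorem add_conj (x : R) : x + h.conj x = h.tr x := by simp [conj]

theorem mul_conj (x : R) : x * h.conj x = h.nrm x := by
  apply h.injective
  rw [map_mul, map_conj, map_intCast]
  exact (h.exists_norm x).choose_spec

theorem normSq_map (x : R) : Quaternion.normSq (φ x) = h.nrm x := by
  have := congrArg φ (h.mul_conj x)
  rw [map_mul, map_conj, map_intCast, Quaternion.self_mul_star] at this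
  have := congrArg QuaternionAlgebra.re this
  simpa using this

theorem conj_mul_self (x : R) : h.conj x * x = h.nrm x := by
  rw [← mul_conj, conj, sub_mul, mul_sub, Int.cast_comm]

theorem conj_sub (x y : R) : h.conj (x - y) = h.conj x - h.conj y :=
  h.injective (by simp [map_conj])

theorem conj_neg (x : R) : h.conj (-x) = -h.conj x :=
  h.injective (by simp [map_conj])

theorem conj_mul (x y : R) : h.conj (x * y) = h.conj y * h.conj x :=
  h.injective (by simp [map_conj])

theorem conj_conj (x : R) : h.conj (h.conj x) = x :=
  h.injective (by simp [map_conj])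

theorem conj_intCast (n : ℤ) : h.conj n = n :=
  h.injective (by simp [map_conj])

theorem conj_one : h.conj 1 = 1 :=
  h.injective (by simp [map_conj])

theorem two_mul_re (x : R) : 2 * (φ x).re = h.tr x := by
  have := congrArg φ (h.add_conj x)
  rw [map_add, map_conj, map_intCast] at this
  have := congrArg QuaternionAlgebra.re this
  simp at this
  linarith

theorem tr_add (x y : R) : h.tr (x + y) = h.tr x + h.tr y := by
  have h1 := h.two_mul_re (x + y)
  rw [map_add, Quaternion.re_add, mul_add, two_mul_re, two_mul_re] at h1
  exact_mod_cast h1.symm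

theorem tr_neg (x : R) : h.tr (-x) = -h.tr x := by
  have h1 := h.two_mul_re (-x)
  rw [map_neg, Quaternion.re_neg, mul_neg, two_mul_re] at h1
  exact_mod_cast h1.symm

theorem tr_sub (x y : R) : h.tr (x - y) = h.tr x - h.tr y := by
  rw [sub_eq_add_neg, tr_add, tr_neg, sub_eq_add_neg]

theorem tr_mul_comm (x y : R) : h.tr (x * y) = h.tr (y * x) := by
  have h1 := h.two_mul_re (x * y)
  have h2 := h.two_mul_re (y * x)
  have : (φ (x * y)).re = (φ (y * x)).re := by
    simp only [map_mul, Quaternion.re_mul]; ring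
  rw [this, h2] at h1
  exact_mod_cast h1.symm

theorem tr_conj (x : R) : h.tr (h.conj x) = h.tr x := by
  have h1 := h.two_mul_re (h.conj x)
  rw [map_conj, Quaternion.re_star, two_mul_re] at h1
  exact_mod_cast h1.symm

theorem nrm_conj (x : R) : h.nrm (h.conj x) = h.nrm x := by
  have h1 := h.normSq_map (h.conj x)
  rw [map_conj, Quaternion.normSq_star, normSq_map] at h1
  exact_mod_cast h1.symm

theorem tr_intCast (n : ℤ) : h.tr n = 2 * n := by
  have h1 := h.two_mul_re n
  simp at h1
  exact_mod_cast h1.symm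

include h in
theorem intCast_injective : Function.Injective ((↑) : ℤ → R) := fun m n hmn => by
  have := congrArg h.tr hmn
  rw [tr_intCast, tr_intCast] at this
  omega

theorem tr_one : h.tr 1 = 2 := by
  have := h.tr_intCast 1
  simpa using this

theorem tr_intCast_mul (n : ℤ) (x : R) : h.tr (n * x) = n * h.tr x := by
  have h1 := h.two_mul_re (n * x)
  have h2 := h.two_mul_re x
  have h3 : (φ (n * x)).re = n * (φ x).re := by
    rw [map_mul, map_intCast, Quaternion.re_mul]; simp
  rw [h3] at h1
  have : (n : ℝ) * h.tr x = h.tr (n * x) := by rw [← h1, ← h2]; ring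
  exact_mod_cast this.symm

theorem nrm_mul (x y : R) : h.nrm (x * y) = h.nrm x * h.nrm y := by
  have h1 := h.normSq_map (x * y)
  rw [map_mul, map_mul, normSq_map, normSq_map] at h1
  exact_mod_cast h1.symm

theorem nrm_one : h.nrm 1 = 1 := by
  have h1 := h.normSq_map 1
  rw [map_one, map_one] at h1
  exact_mod_cast h1.symm

theorem nrm_neg (x : R) : h.nrm (-x) = h.nrm x := by
  have h1 := h.normSq_map (-x)
  rw [map_neg, Quaternion.normSq_neg, normSq_map] at h1
  exact_mod_cast h1.symm

theorem nrm_nonneg (x : R) : 0 ≤ h.nrm x := by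
  have h1 : (0 : ℝ) ≤ h.nrm x := by rw [← h.normSq_map]; exact Quaternion.normSq_nonneg
  exact_mod_cast h1

theorem nrm_eq_zero {x : R} : h.nrm x = 0 ↔ x = 0 := by
  rw [← (injective_iff_map_eq_zero' φ).1 h.injective x, ← Quaternion.normSq_eq_zero, h.normSq_map]
  exact_mod_cast Iff.rfl

theorem nrm_sub (x y : R) : h.nrm (x - y) = h.nrm x + h.nrm y - h.tr (x * h.conj y) := by
  have h1 := h.normSq_map (x - y)
  have h2 := h.two_mul_re (x * h.conj y)
  rw [map_sub, sub_eq_add_neg, Quaternion.normSq_add, Quaternion.normSq_neg,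
    h.normSq_map, h.normSq_map, star_neg, mul_neg, Quaternion.re_neg] at h1
  rw [map_mul, map_conj] at h2
  have : (h.nrm (x - y) : ℝ) = h.nrm x + h.nrm y - h.tr (x * h.conj y) := by
    rw [← h1, ← h2]; ring
  exact_mod_cast this

theorem sq_tr_le (x : R) : h.tr x ^ 2 ≤ 4 * h.nrm x := by
  have h1 := h.normSq_map x
  have h2 := h.two_mul_re x
  rw [Quaternion.normSq_def'] at h1
  have : (h.tr x : ℝ) ^ 2 ≤ 4 * h.nrm x := by
    rw [← h1, ← h2]; nlinarith [sq_nonneg (φ x).imI, sq_nonneg (φ x).imJ, sq_nonneg (φ x).imK]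
  exact_mod_cast this

/-- Norms are multiplicative and nonnegative, so a unit cannot have norm -1; conversely the
conjugate serves as inverse. -/
theorem isUnit_iff {x : R} : IsUnit x ↔ h.nrm x = 1 := by
  constructor
  · rintro ⟨u, rfl⟩
    have h1 : h.nrm u * h.nrm ↑u⁻¹ = 1 := by rw [← nrm_mul, Units.mul_inv, nrm_one]
    exact Int.eq_one_of_mul_eq_one_right (h.nrm_nonneg _) h1
  · intro hx
    exact ⟨⟨x, h.conj x, by rw [mul_conj, hx, Int.cast_one], by rw [conj_mul_self, hx, Int.cast_one]⟩,
      rfl⟩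

theorem conj_mul_of_isUnit {x : R} (hx : IsUnit x) : h.conj x * x = 1 := by
  rw [conj_mul_self, h.isUnit_iff.1 hx, Int.cast_one]

theorem mul_conj_of_isUnit {x : R} (hx : IsUnit x) : x * h.conj x = 1 := by
  rw [mul_conj, h.isUnit_iff.1 hx, Int.cast_one]

theorem isUnit_conj {x : R} (hx : IsUnit x) : IsUnit (h.conj x) := by
  rw [h.isUnit_iff, nrm_conj, ← h.isUnit_iff]; exact hx

theorem sq_eq (x : R) : x * x = h.tr x * x - h.nrm x := by
  rw [← mul_conj, conj, mul_sub, Int.cast_comm]; abel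

include h in
theorem mul_eq_zero_imp {x y : R} (hxy : x * y = 0) : x = 0 ∨ y = 0 := by
  have : φ x * φ y = 0 := by rw [← map_mul, hxy, map_zero]
  rcases mul_eq_zero.1 this with h1 | h1
  · exact Or.inl ((injective_iff_map_eq_zero φ).1 h.injective _ h1)
  · exact Or.inr ((injective_iff_map_eq_zero φ).1 h.injective _ h1)

/-- The sandwich `u x u` of an arbitrary element by a unit. -/
theorem unit_mul_mul_unit {u : R} (hu : IsUnit u) (x : R) :
    u * x * u - x = h.tr (u * x) * u - h.tr x := by
  -- The term conj(x) conj(u) of the trace becomes conj(x) after right multiplication by u, so both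
  -- sides reduce to uxu - x.
  have h1 : (h.tr (u * x) : R) = u * x + h.conj x * h.conj u := by
    rw [← add_conj, conj_mul]
  have h2 : (h.tr x : R) = x + h.conj x := (h.add_conj x).symm
  rw [h1, h2, add_mul, mul_assoc (h.conj x), h.conj_mul_of_isUnit hu]
  noncomm_ring

include h in
theorem restrict (S : Subring R) : IsDefinite (φ.comp S.subtype) where
  injective := h.injective.comp Subtype.val_injective
  exists_trace x := h.exists_trace x
  exists_norm x := h.exists_norm x

end IsDefinite

/-! ### The span of the units and its saturation. -/

/-- The `ℤ`-span of the units of a ring, as a subring. -/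
def unitSpan (R : Type*) [Ring R] : Subring R where
  carrier := Submodule.span ℤ {x : R | IsUnit x}
  zero_mem' := zero_mem _
  one_mem' := Submodule.subset_span isUnit_one
  add_mem' := add_mem
  neg_mem' := neg_mem
  mul_mem' := by
    intro a b ha hb
    have := Submodule.mul_mem_mul (M := Submodule.span ℤ {x : R | IsUnit x})
      (N := Submodule.span ℤ {x : R | IsUnit x}) ha hb
    rw [Submodule.span_mul_span] at this
    refine Submodule.span_mono ?_ this
    rintro _ ⟨x, hx, y, hy, rfl⟩
    exact hx.mul hy

theorem IsUnit.mem_unitSpan {R : Type*} [Ring R] {x : R} (hx : IsUnit x) : x ∈ unitSpan R :=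
  Submodule.subset_span hx

/-- The elements of a ring with a nonzero multiple in the `ℤ`-span of the units. -/
def unitSaturation (R : Type*) [Ring R] : Subring R where
  carrier := {x | ∃ n : ℤ, n ≠ 0 ∧ n • x ∈ unitSpan R}
  zero_mem' := ⟨1, one_ne_zero, by simp⟩
  one_mem' := ⟨1, one_ne_zero, by simp⟩
  add_mem' := by
    rintro a b ⟨n, hn, ha⟩ ⟨m, hm, hb⟩
    refine ⟨n * m, mul_ne_zero hn hm, ?_⟩
    have : (n * m) • (a + b) = m • n • a + n • m • b := by module
    rw [this]
    exact add_mem (zsmul_mem ha _) (zsmul_mem hb _)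
  neg_mem' := by
    rintro a ⟨n, hn, ha⟩
    exact ⟨n, hn, by rw [smul_neg]; exact neg_mem ha⟩
  mul_mem' := by
    rintro a b ⟨n, hn, ha⟩ ⟨m, hm, hb⟩
    refine ⟨n * m, mul_ne_zero hn hm, ?_⟩
    have : (n * m) • (a * b) = (n • a) * (m • b) := by rw [smul_mul_smul_comm]
    rw [this]
    exact mul_mem ha hb

theorem unitSpan_le_unitSaturation (R : Type*) [Ring R] : unitSpan R ≤ unitSaturation R :=
  fun x hx => ⟨1, one_ne_zero, by simpa using hx⟩

theorem IsUnit.mem_unitSaturation {R : Type*} [Ring R] {x : R} (hx : IsUnit x) :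
    x ∈ unitSaturation R := unitSpan_le_unitSaturation R hx.mem_unitSpan

theorem mem_unitSaturation_of_zsmul_mem {R : Type*} [Ring R] {x : R} {n : ℤ} (hn : n ≠ 0)
    (hx : n • x ∈ unitSaturation R) : x ∈ unitSaturation R := by
  obtain ⟨m, hm, hx⟩ := hx
  exact ⟨m * n, mul_ne_zero hm hn, by rwa [mul_smul]⟩

end

/-! ### Marked matrices and peak reduction. -/

section

open scoped Quaternion

/-- The quotient of a ring by the saturated span of its units. -/
abbrev UnitQuotient (R : Type*) [Ring R] : Type _ := R ⧸ (unitSaturation R).toAddSubgroup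

/-- Pairs of a matrix and a class modulo the saturated span of the units. -/
abbrev MarkedMatrix (R : Type*) [Ring R] : Type _ :=
  Matrix (Fin 2) (Fin 2) R × Multiplicative (UnitQuotient R)

namespace MarkedMatrix

variable {R : Type*} [Ring R]

/-- The class of a ring element, written multiplicatively. -/
def mark (x : R) : Multiplicative (UnitQuotient R) := Multiplicative.ofAdd (x : UnitQuotient R)

theorem mark_add (x y : R) : mark (x + y) = mark x * mark y := rfl

theorem mark_eq_mark {x y : R} (hxy : x - y ∈ unitSaturation R) : mark x = mark y := by
  refine congrArg Multiplicative.ofAdd ((QuotientAddGroup.eq_iff_sub_mem).2 hxy)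

theorem mark_eq_one {x : R} : mark x = 1 ↔ x ∈ unitSaturation R :=
  QuotientAddGroup.eq_zero_iff (N := (unitSaturation R).toAddSubgroup) x

/-- The marked upper elementary matrix. -/
def upper (x : R) : MarkedMatrix R := (!![1, x; 0, 1], mark x)

/-- The marked Weyl element. -/
def weyl : MarkedMatrix R := (!![0, 1; -1, 0], 1)

theorem upper_mul_upper (x y : R) : upper x * upper y = upper (x + y) := by
  refine Prod.ext ?_ (mark_add x y).symm
  simp [upper, add_comm]

theorem upper_zero : upper (0 : R) = 1 := by
  refine Prod.ext ?_ rfl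
  simp [upper, Matrix.one_fin_two]

variable {φ : R →+* ℍ[ℝ]} (h : IsDefinite φ)

/-- The marked diagonal matrix with entries `u` and its conjugate. -/
noncomputable def diag (u : R) : MarkedMatrix R := (!![u, 0; 0, h.conj u], 1)

theorem diag_mul_weyl (u : R) : diag h u * weyl = weyl * diag h (h.conj u) := by
  refine Prod.ext ?_ rfl
  simp [diag, weyl, h.conj_conj]

/-- The mark survives because uxu - x is an integral combination of u and 1. This is the reason for
dividing by the span of the units. -/
theorem diag_mul_upper {u : R} (hu : IsUnit u) (x : R) :
    diag h u * upper x = upper (u * x * u) * diag h u := by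
  refine Prod.ext ?_ ?_
  · simp [diag, upper, mul_assoc, h.mul_conj_of_isUnit hu]
  · simp only [diag, upper, Prod.snd_mul, one_mul, mul_one]
    refine (mark_eq_mark ?_).symm
    rw [h.unit_mul_mul_unit hu]
    exact sub_mem (mul_mem (intCast_mem _ _) hu.mem_unitSaturation) (intCast_mem _ _)

/-- Commutativity of the units enters the reduction here: the lower entry is conj(u) conj(v), while
conj(uv) has the factors in the other order. -/
theorem diag_mul_diag (hcomm : ∀ x y : R, IsUnit x → IsUnit y → x * y = y * x) {u v : R}
    (hu : IsUnit u) (hv : IsUnit v) : diag h u * diag h v = diag h (u * v) := by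
  refine Prod.ext ?_ (mul_one _)
  simp [diag, h.conj_mul, hcomm _ _ (h.isUnit_conj hu) (h.isUnit_conj hv)]

theorem diag_one : diag h (1 : R) = 1 := by
  refine Prod.ext ?_ rfl
  simp [diag, h.conj_one, Matrix.one_fin_two]

theorem weyl_mul_weyl : (weyl : MarkedMatrix R) * weyl = diag h (-1) := by
  refine Prod.ext ?_ (mul_one _)
  simp [diag, weyl, h.conj_neg, h.conj_one]

theorem conj_eq (a : R) : h.conj a = h.tr a - a := rfl

/-- In norms 1, 2, 3 the number √N(a) is 2cos(π/n) with n = 3, 4, 6, and the alternating product of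
the elementary matrices of a and conj(a), separated by Weyl elements, is diagonal after n factors.
The marks agree since they differ by units or by integer multiples of the trace. -/
theorem weyl_upper_weyl_of_nrm_eq_one {a : R} (ha : h.nrm a = 1) :
    weyl * upper a * weyl = upper (-h.conj a) * weyl * upper (-a) * diag h (-a) := by
  have hu := h.isUnit_iff.2 ha
  refine Prod.ext ?_ ?_
  · simp [diag, weyl, upper, h.conj_neg, h.conj_mul_of_isUnit hu, h.mul_conj_of_isUnit hu]
  · simp only [diag, weyl, upper, Prod.snd_mul, one_mul, mul_one, ← mark_add]
    rw [mark_eq_one.2 hu.mem_unitSaturation, eq_comm, mark_eq_one]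
    exact add_mem (neg_mem (h.isUnit_conj hu).mem_unitSaturation) (neg_mem hu.mem_unitSaturation)

theorem weyl_upper_weyl_of_nrm_eq_two {a : R} (ha : h.nrm a = 2) :
    weyl * upper a * weyl = upper (-h.conj a) * weyl * upper (-a) * weyl *
      upper (-h.conj a) * diag h (-1) := by
  have h1 : a * h.conj a = 2 := by rw [h.mul_conj, ha]; norm_num
  have h2 : h.conj a * a = 2 := by rw [h.conj_mul_self, ha]; norm_num
  refine Prod.ext ?_ ?_
  · simp [diag, weyl, upper, h.conj_neg, h.conj_one]
    simp only [h1, h2]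
    exact ⟨⟨by norm_num, by noncomm_ring⟩, by norm_num⟩
  · simp only [diag, weyl, upper, Prod.snd_mul, one_mul, mul_one, ← mark_add]
    refine mark_eq_mark ?_
    have : a - (-h.conj a + -a + -h.conj a) = ((2 * h.tr a : ℤ) : R) := by
      rw [conj_eq]; push_cast; noncomm_ring
    rw [this]
    exact intCast_mem _ _

theorem weyl_upper_weyl_of_nrm_eq_three {a : R} (ha : h.nrm a = 3) :
    weyl * upper a * weyl = upper (-h.conj a) * weyl * upper (-a) * weyl *
      upper (-h.conj a) * weyl * upper (-a) * weyl * upper (-h.conj a) * diag h (-1) := by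
  have h1 : a * h.conj a = 3 := by rw [h.mul_conj, ha]; norm_num
  have h2 : h.conj a * a = 3 := by rw [h.conj_mul_self, ha]; norm_num
  refine Prod.ext ?_ ?_
  · simp [diag, weyl, upper, h.conj_neg, h.conj_one]
    refine ⟨⟨?_, ?_⟩, ?_, ?_⟩ <;>
      simp only [add_mul, neg_mul, mul_assoc, one_mul, h1, h2] <;> noncomm_ring
  · simp only [diag, weyl, upper, Prod.snd_mul, one_mul, mul_one, ← mark_add]
    refine mark_eq_mark ?_
    have : a - (-h.conj a + -a + -h.conj a + -a + -h.conj a) = ((3 * h.tr a : ℤ) : R) := by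
      rw [conj_eq]; push_cast; noncomm_ring
    rw [this]
    exact intCast_mem _ _

/-- The norm of the lower left entry. -/
noncomputable def height (g : MarkedMatrix R) : ℤ := h.nrm (g.1 1 0)

theorem mul_upper_lower_left (g : MarkedMatrix R) (x : R) : (g * upper x).1 1 0 = g.1 1 0 := by
  simp [upper, Matrix.mul_apply, Fin.sum_univ_two]

theorem mul_upper_lower_right (g : MarkedMatrix R) (x : R) :
    (g * upper x).1 1 1 = g.1 1 0 * x + g.1 1 1 := by
  simp [upper, Matrix.mul_apply, Fin.sum_univ_two]

theorem mul_weyl_lower_left (g : MarkedMatrix R) : (g * weyl).1 1 0 = -g.1 1 1 := by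
  simp [weyl, Matrix.mul_apply, Fin.sum_univ_two]

theorem mul_weyl_lower_right (g : MarkedMatrix R) : (g * weyl).1 1 1 = g.1 1 0 := by
  simp [weyl, Matrix.mul_apply, Fin.sum_univ_two]

theorem mul_diag_lower_left (g : MarkedMatrix R) (u : R) :
    (g * diag h u).1 1 0 = g.1 1 0 * u := by
  simp [diag, Matrix.mul_apply, Fin.sum_univ_two]

theorem height_mul_upper (g : MarkedMatrix R) (x : R) : height h (g * upper x) = height h g := by
  rw [height, mul_upper_lower_left, height]

theorem height_mul_diag (g : MarkedMatrix R) {u : R} (hu : IsUnit u) :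
    height h (g * diag h u) = height h g := by
  rw [height, mul_diag_lower_left, h.nrm_mul, h.isUnit_iff.1 hu, mul_one, height]

/-- The marked upper triangular matrices of determinant one. -/
def IsTriangular (g : MarkedMatrix R) : Prop := ∃ x u : R, IsUnit u ∧ g = upper x * diag h u

theorem isTriangular_upper (x : R) : IsTriangular h (upper x) :=
  ⟨x, 1, isUnit_one, by rw [diag_one, mul_one]⟩

theorem isTriangular_diag {u : R} (hu : IsUnit u) : IsTriangular h (diag h u) :=
  ⟨0, u, hu, by rw [upper_zero, one_mul]⟩

theorem IsTriangular.mul (hcomm : ∀ x y : R, IsUnit x → IsUnit y → x * y = y * x)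
    {g g' : MarkedMatrix R} (hg : IsTriangular h g) (hg' : IsTriangular h g') :
    IsTriangular h (g * g') := by
  obtain ⟨x, u, hu, rfl⟩ := hg
  obtain ⟨y, v, hv, rfl⟩ := hg'
  refine ⟨x + u * y * u, u * v, hu.mul hv, ?_⟩
  rw [← upper_mul_upper, ← diag_mul_diag h hcomm hu hv, mul_assoc, ← mul_assoc (diag h u),
    diag_mul_upper h hu]
  simp only [mul_assoc]

variable {h} in
theorem IsTriangular.height_mul {t : MarkedMatrix R} (ht : IsTriangular h t) (g : MarkedMatrix R) :
    height h (g * t) = height h g := by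
  obtain ⟨x, u, hu, rfl⟩ := ht
  rw [← mul_assoc, height_mul_diag h _ hu, height_mul_upper]

/-- Marked matrices reached by a path of heights less than `m`. -/
inductive Reach (m : ℤ) : MarkedMatrix R → Prop
  | base {g} (hg : IsTriangular h g) : Reach m g
  | step {g t} (hg : Reach m g) (ht : IsTriangular h t) (hlt : height h (g * weyl * t) < m) :
      Reach m (g * weyl * t)

variable {h}

theorem Reach.mul (hcomm : ∀ x y : R, IsUnit x → IsUnit y → x * y = y * x) {m : ℤ}
    {g t : MarkedMatrix R} (hg : Reach h m g) (ht : IsTriangular h t) : Reach h m (g * t) := by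
  cases hg with
  | base hg => exact .base (hg.mul h hcomm ht)
  | step hg ht' hlt =>
    rw [mul_assoc _ _ t]
    refine .step hg (ht'.mul h hcomm ht) ?_
    rwa [← mul_assoc, ht.height_mul]

theorem Reach.mono {m m' : ℤ} (hm : m ≤ m') {g : MarkedMatrix R} (hg : Reach h m g) :
    Reach h m' g := by
  induction hg with
  | base hg => exact .base hg
  | step _ ht hlt ih => exact .step ih ht (hlt.trans_le hm)

theorem IsTriangular.lower_left {t : MarkedMatrix R} (ht : IsTriangular h t) : t.1 1 0 = 0 := by
  obtain ⟨x, u, hu, rfl⟩ := ht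
  rw [mul_diag_lower_left]
  simp [upper]

theorem IsTriangular.height_eq_zero {t : MarkedMatrix R} (ht : IsTriangular h t) :
    height h t = 0 := by
  rw [height, ht.lower_left, h.nrm_eq_zero]

theorem Reach.height_lt {m : ℤ} (hm : 0 < m) {g : MarkedMatrix R} (hg : Reach h m g) :
    height h g < m := by
  cases hg with
  | base hg => rwa [hg.height_eq_zero]
  | step _ _ hlt => exact hlt

/-- One step away from the marked matrices reached below height `m`. -/
def Adjacent (h : IsDefinite φ) (m : ℤ) (g : MarkedMatrix R) : Prop :=
  Reach h m g ∨ ∃ v t, Reach h m v ∧ IsTriangular h t ∧ g = v * weyl * t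

theorem Adjacent.mul (hcomm : ∀ x y : R, IsUnit x → IsUnit y → x * y = y * x) {m : ℤ}
    {g t : MarkedMatrix R} (hg : Adjacent h m g) (ht : IsTriangular h t) :
    Adjacent h m (g * t) := by
  rcases hg with hg | ⟨v, t', hv, ht', rfl⟩
  · exact .inl (hg.mul hcomm ht)
  · exact .inr ⟨v, t' * t, hv, ht'.mul h hcomm ht, by rw [mul_assoc]⟩

/-- This is the triangle inequality |da| ≤ |da - c| + |c| < 2|d| with ν = N(a), P = N(d), U = N(c).
The hypothesis on T is Cauchy–Schwarz for the cross term. -/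
theorem nrm_bound {ν P U T : ℤ} (hU : 0 ≤ U) (hUP : U < P) (hle : ν * P + U - T ≤ P)
    (hT : T ^ 2 ≤ 4 * (ν * P * U)) : ν < 4 := by
  by_contra! hν
  have h1 : (ν - 1) * P + U ≤ T := by linarith
  have h0 : 0 ≤ (ν - 1) * P + U := by nlinarith
  have h2 : ((ν - 1) * P + U) ^ 2 ≤ 4 * (ν * P * U) := by nlinarith
  nlinarith [mul_nonneg (sub_nonneg.2 hν) (mul_nonneg hU hU), mul_pos (sub_pos.2 hUP) (sub_pos.2 hUP),
    mul_nonneg hU (sub_nonneg.2 hUP.le), mul_nonneg (sub_nonneg.2 hν) (mul_nonneg hU (sub_nonneg.2 hUP.le)),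
    mul_nonneg (sub_nonneg.2 hν) (sq_nonneg (P-U)), mul_nonneg (sub_nonneg.2 hν) (mul_nonneg (sub_nonneg.2 hν) (sq_nonneg P))]


theorem height_weyl_upper_weyl (g : MarkedMatrix R) (a : R) :
    height h (g * weyl * upper a * weyl) = h.nrm (g.1 1 1 * a - g.1 1 0) := by
  rw [height, mul_weyl_lower_left, mul_upper_lower_right, mul_weyl_lower_left,
    mul_weyl_lower_right]
  congr 1
  noncomm_ring

theorem height_upper_weyl (g : MarkedMatrix R) (a : R) :
    height h (g * upper (-a) * weyl) = h.nrm (g.1 1 1 - g.1 1 0 * a) := by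
  rw [height, mul_weyl_lower_left, mul_upper_lower_right, ← h.nrm_neg]
  congr 1
  noncomm_ring

-- The heights along a detour are quadratic forms in (c, d) sharing the cross term tr(d a conj(c)),
-- so comparing them becomes linear arithmetic in N(c), N(d) and that trace.
variable (h) in
theorem nrm_mul_sub (a c d : R) : h.nrm (d * a - c) =
    h.nrm a * h.nrm d + h.nrm c - h.tr (d * a * h.conj c) := by
  rw [h.nrm_sub, h.nrm_mul, mul_comm (h.nrm d)]

variable (h) in
theorem nrm_sub_mul_conj (a c d : R) : h.nrm (d - c * h.conj a) =
    h.nrm d + h.nrm a * h.nrm c - h.tr (d * a * h.conj c) := by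
  rw [h.nrm_sub, h.nrm_mul, h.nrm_conj, h.conj_mul, h.conj_conj, mul_assoc, mul_comm (h.nrm c)]

variable (h) in
theorem nrm_mul_sub_add (a c d : R) : h.nrm (d * a - (c + c)) =
    h.nrm a * h.nrm d + 4 * h.nrm c - 2 * h.tr (d * a * h.conj c) := by
  rw [← sub_sub, h.nrm_sub, nrm_mul_sub, sub_mul, h.tr_sub, h.mul_conj, h.tr_intCast]
  ring

variable (h) in
theorem nrm_add_sub_mul_conj (a c d : R) : h.nrm (d + d - c * h.conj a) =
    4 * h.nrm d + h.nrm a * h.nrm c - 2 * h.tr (d * a * h.conj c) := by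
  have h1 : d + d - c * h.conj a = d - c * h.conj a - -d := by abel
  have h2 : h.tr (c * h.conj a * h.conj d) = h.tr (d * a * h.conj c) := by
    rw [← h.tr_conj, h.conj_mul, h.conj_mul, h.conj_conj, h.conj_conj, mul_assoc]
  rw [h1, h.nrm_sub, nrm_sub_mul_conj, h.nrm_neg, h.conj_neg, mul_neg, h.tr_neg, sub_mul, h.tr_sub,
    h2, h.mul_conj, h.tr_intCast]
  ring

/-- A path through a highest vertex can be replaced by a path below it. -/
theorem Reach.adjacent_weyl_upper_weyl
    (hcomm : ∀ x y : R, IsUnit x → IsUnit y → x * y = y * x) {m : ℤ} {g : MarkedMatrix R}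
    (hg : Reach h m g) (hlt : height h g < m) (hm : h.nrm (g.1 1 1) = m) (a : R)
    (hle : height h (g * weyl * upper a * weyl) ≤ m) :
    Adjacent h m (g * weyl * upper a * weyl) := by
  have hneg : IsTriangular h (diag h (-1)) := isTriangular_diag h isUnit_one.neg
  have hup : ∀ x, IsTriangular h (upper x) := isTriangular_upper h
  have hone : IsTriangular h 1 := by rw [← upper_zero]; exact hup 0
  have hstep : ∀ {g'}, Reach h m g' → height h (g' * weyl) < m → Reach h m (g' * weyl) :=
    fun hg' hlt' => by simpa using Reach.step hg' hone (by simpa using hlt')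
  rw [height_weyl_upper_weyl, nrm_mul_sub, hm] at hle
  rw [height] at hlt
  have hT := h.sq_tr_le (g.1 1 1 * a * h.conj (g.1 1 0))
  rw [h.nrm_mul, h.nrm_mul, h.nrm_conj, hm, mul_comm m] at hT
  have hν := nrm_bound (h.nrm_nonneg _) hlt hle hT
  have hν0 := h.nrm_nonneg a
  have hq1 := nrm_sub_mul_conj h a (g.1 1 0) (g.1 1 1)
  have hq2 := nrm_mul_sub_add h a (g.1 1 0) (g.1 1 1)
  have hq3 := nrm_add_sub_mul_conj h a (g.1 1 0) (g.1 1 1)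
  generalize h.tr (g.1 1 1 * a * h.conj (g.1 1 0)) = T at *
  have hcases : h.nrm a = 0 ∨ h.nrm a = 1 ∨ h.nrm a = 2 ∨ h.nrm a = 3 := by omega
  rw [mul_assoc, mul_assoc g, ← mul_assoc weyl]
  rcases hcases with ha | ha | ha | ha
  · rw [h.nrm_eq_zero.1 ha, upper_zero, mul_one, weyl_mul_weyl h]
    exact .inl (hg.mul hcomm hneg)
  · rw [weyl_upper_weyl_of_nrm_eq_one h ha]
    refine .inr ⟨g * upper (-h.conj a), upper (-a) * diag h (-a), hg.mul hcomm (hup _),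
      (hup _).mul h hcomm (isTriangular_diag h (h.isUnit_iff.2 ha).neg), ?_⟩
    simp only [mul_assoc]
  · rw [weyl_upper_weyl_of_nrm_eq_two h ha]
    -- For N(a) = 2, `hle` says T ≥ m + N(c), so the new height m + 2N(c) - T is at most N(c) < m.
    have h1 : Reach h m (g * upper (-h.conj a) * weyl) := by
      refine hstep (hg.mul hcomm (hup _)) ?_
      rw [height_upper_weyl, hq1]
      rw [ha] at hle ⊢
      omega
    refine .inr ⟨_, upper (-h.conj a) * diag h (-1), h1.mul hcomm (hup (-a)),
      (hup _).mul h hcomm hneg, ?_⟩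
    simp only [mul_assoc]
  · rw [weyl_upper_weyl_of_nrm_eq_three h ha]
    have hca : h.conj a * a = 3 := by rw [h.conj_mul_self, ha]; norm_num
    have hac : a * h.conj a = 3 := by rw [h.mul_conj, ha]; norm_num
    set g₁ := g * upper (-h.conj a) * weyl with hg₁
    have e10 : g₁.1 1 0 = -(g.1 1 1 - g.1 1 0 * h.conj a) := by
      rw [hg₁, mul_weyl_lower_left, mul_upper_lower_right]; noncomm_ring
    have e11 : g₁.1 1 1 = g.1 1 0 := by
      rw [hg₁, mul_weyl_lower_right, mul_upper_lower_left]
    -- For N(a) = 3, `hle` says T ≥ 2m + N(c). The three inner heights of the detour are then at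
    -- most 2N(c) - m, 2N(c) - m and N(c), all below m.
    have h1 : Reach h m g₁ := by
      refine hstep (hg.mul hcomm (hup _)) ?_
      rw [height_upper_weyl, hq1]
      rw [ha] at hle ⊢
      omega
    set g₂ := g₁ * upper (-a) * weyl with hg₂
    have f10 : g₂.1 1 0 = -(g.1 1 1 * a - (g.1 1 0 + g.1 1 0)) := by
      rw [hg₂, mul_weyl_lower_left, mul_upper_lower_right, e10, e11, neg_mul_neg, sub_mul,
        mul_assoc _ (h.conj a), hca]
      noncomm_ring
    have f11 : g₂.1 1 1 = -(g.1 1 1 - g.1 1 0 * h.conj a) := by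
      rw [hg₂, mul_weyl_lower_right, mul_upper_lower_left, e10]
    have h2 : Reach h m g₂ := by
      refine hstep (h1.mul hcomm (hup _)) ?_
      rw [height, f10, h.nrm_neg, hq2]
      rw [ha] at hle ⊢
      omega
    have h3 : Reach h m (g₂ * upper (-h.conj a) * weyl) := by
      refine hstep (h2.mul hcomm (hup _)) ?_
      have : (g₂ * upper (-h.conj a) * weyl).1 1 0 =
          -(g.1 1 1 + g.1 1 1 - g.1 1 0 * h.conj a) := by
        rw [mul_weyl_lower_left, mul_upper_lower_right, f10, f11, neg_mul_neg, sub_mul,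
          mul_assoc _ a, hac]
        noncomm_ring
      rw [height, this, h.nrm_neg, hq3]
      rw [ha] at hle ⊢
      omega
    refine .inr ⟨_, upper (-h.conj a) * diag h (-1), h3.mul hcomm (hup (-a)),
      (hup _).mul h hcomm hneg, ?_⟩
    simp only [hg₁, hg₂, mul_assoc]

/-- Induction along the path: if the last vertex but one cannot be reached below m, it has height
exactly m and a predecessor below m. It is a peak, and the detour around it leaves the endpoint one
step away from the lower region. -/
theorem Reach.adjacent (hcomm : ∀ x y : R, IsUnit x → IsUnit y → x * y = y * x) {m : ℤ}
    (hm : 0 < m) {g : MarkedMatrix R} (hg : Reach h (m + 1) g) : Adjacent h m g := by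
  induction hg with
  | base hg => exact .inl (.base hg)
  | @step g t hg ht hlt ih =>
    refine Adjacent.mul hcomm ?_ ht
    rw [ht.height_mul] at hlt
    by_cases hr : Reach h m g
    · refine .inr ⟨g, 1, hr, ?_, (mul_one _).symm⟩
      rw [← upper_zero]; exact isTriangular_upper h 0
    obtain ⟨v, t', hv, ht', rfl⟩ := ih.resolve_left hr
    have hvm := hv.height_lt hm
    have hge : m ≤ height h (v * weyl * t') := by
      by_contra! hlt'
      exact hr (.step hv ht' hlt')
    have hle := hg.height_lt (by omega)
    obtain ⟨x, u, hu, rfl⟩ := ht'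
    have hd : h.nrm (v.1 1 1) = m := by
      rw [← mul_assoc, height_mul_diag h _ hu, height_mul_upper, height, mul_weyl_lower_left,
        h.nrm_neg] at hge hle
      omega
    -- The diagonal part is moved past the Weyl element so that only an upper elementary factor
    -- remains between the two Weyl elements.
    have key : v * weyl * (upper x * diag h u) * weyl =
        v * weyl * upper x * weyl * diag h (h.conj u) := by
      simp only [mul_assoc, diag_mul_weyl]
    rw [key] at hlt ⊢
    rw [height_mul_diag h _ (h.isUnit_conj hu)] at hlt
    exact (hv.adjacent_weyl_upper_weyl hcomm hvm hd x (by omega)).mul hcomm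
      (isTriangular_diag h (h.isUnit_conj hu))

/-- Since the endpoint has height 0, a final step into it respects any positive bound, so the bound
can be lowered one unit at a time. At bound 1 no Weyl step is possible: from a triangular matrix it
leads to the norm of a unit, which is 1. -/
theorem Reach.isTriangular (hcomm : ∀ x y : R, IsUnit x → IsUnit y → x * y = y * x) (n : ℕ)
    {g : MarkedMatrix R} (hg : Reach h (n + 1) g) (h0 : g.1 1 0 = 0) : IsTriangular h g := by
  induction n with
  | zero =>
    suffices ∀ g, Reach h 1 g → IsTriangular h g from this g (by simpa using hg)
    intro g hg
    induction hg with
    | base hg => exact hg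
    | @step g t hg ht hlt ih =>
      exfalso
      rw [ht.height_mul, height, mul_weyl_lower_left, h.nrm_neg] at hlt
      obtain ⟨x, u, hu, rfl⟩ := ih
      have : (upper x * diag h u).1 1 1 = h.conj u := by
        simp [upper, diag]
      rw [this, h.isUnit_iff.1 (h.isUnit_conj hu)] at hlt
      exact lt_irrefl _ hlt
  | succ n ih =>
    apply ih
    push_cast at hg
    rcases hg.adjacent (m := n + 1) hcomm (by omega) with hg | ⟨v, t, hv, ht, rfl⟩
    · exact hg
    · refine .step hv ht ?_
      rw [height, h0, h.nrm_eq_zero.2 rfl]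
      omega

theorem Reach.mul_weyl {m : ℤ} {g : MarkedMatrix R} (hg : Reach h m g) :
    ∃ m', Reach h m' (g * weyl) := by
  have hone : IsTriangular h 1 := by rw [← upper_zero]; exact isTriangular_upper h 0
  refine ⟨max m (height h (g * weyl) + 1), ?_⟩
  simpa using Reach.step (hg.mono (le_max_left _ _)) hone
    (by rw [mul_one]; exact (lt_add_one _).trans_le (le_max_right _ _))

end MarkedMatrix

end

/-! ### The marked elementary group and the kernel of abelianization. -/

section

open scoped Quaternion MatrixGroups
open OrderElem

namespace MarkedMatrix

variable {R : Type*} [Ring R]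

theorem fin_zero_ne_one : (0 : Fin 2) ≠ 1 := by decide

/-- The subgroup of marked invertible matrices generated by the marked elementary matrices. -/
def markedGroup (R : Type*) [Ring R] : Subgroup (GL (Fin 2) R × Multiplicative (UnitQuotient R)) :=
  Subgroup.closure {g | ∃ x : R, g = (elementaryMatrix 0 1 fin_zero_ne_one x, mark x) ∨
    g = (elementaryMatrix 1 0 fin_zero_ne_one.symm x, mark (-x))}

/-- Forgetting that the matrix part is invertible. -/
def toMarked : GL (Fin 2) R × Multiplicative (UnitQuotient R) →* MarkedMatrix R :=
  (Units.coeHom _).prodMap (MonoidHom.id _)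

theorem toMarked_upper (x : R) :
    toMarked (elementaryMatrix 0 1 fin_zero_ne_one x, mark x) = upper x := by
  refine Prod.ext ?_ rfl
  ext i j
  fin_cases i <;> fin_cases j <;> simp [toMarked, elementaryMatrix, upper]

variable {φ : R →+* ℍ[ℝ]} (h : IsDefinite φ)

theorem toMarked_lower (x : R) :
    toMarked (elementaryMatrix 1 0 fin_zero_ne_one.symm x, mark (-x)) =
      weyl * upper (-x) * weyl * diag h (-1) := by
  refine Prod.ext ?_ ?_
  · ext i j
    fin_cases i <;> fin_cases j <;>
      simp [toMarked, elementaryMatrix, upper, weyl, diag, h.conj_neg, h.conj_one]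
  · simp [toMarked, upper, weyl, diag]

theorem elementaryMatrix_inv {n : Type*} [Fintype n] [DecidableEq n] (i j : n) (hij : i ≠ j)
    (x : R) : (elementaryMatrix i j hij x)⁻¹ = elementaryMatrix i j hij (-x) := by
  ext1
  rfl

theorem elementaryMatrix_add {n : Type*} [Fintype n] [DecidableEq n] (i j : n) (hij : i ≠ j)
    (x y : R) : elementaryMatrix i j hij (x + y) =
      elementaryMatrix i j hij x * elementaryMatrix i j hij y := by
  ext1
  simp [elementaryMatrix, mul_add, add_mul, Matrix.single_mul_single_of_ne _ _ _ _ hij.symm,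
    Matrix.single_add, add_assoc]

theorem mark_neg (x : R) : mark (-x) = (mark x)⁻¹ := rfl

-- A lower generator contributes two Weyl steps. Heights are uncontrolled here, so the bound m is
-- existential; lowering it is the task of the peak reduction.
variable {h} in
theorem exists_reach_of_mem_markedGroup
    (hcomm : ∀ x y : R, IsUnit x → IsUnit y → x * y = y * x)
    {g : GL (Fin 2) R × Multiplicative (UnitQuotient R)} (hg : g ∈ markedGroup R) :
    ∃ m, Reach h m (toMarked g) := by
  have hneg : IsTriangular h (diag h (-1)) := isTriangular_diag h isUnit_one.neg
  have hmul : ∀ (g : MarkedMatrix R) (t : MarkedMatrix R), IsTriangular h t →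
      (∃ m, Reach h m g) → ∃ m, Reach h m (g * t) := by
    rintro g t ht ⟨m, hm⟩
    exact ⟨m, hm.mul hcomm ht⟩
  have hlow : ∀ (g : MarkedMatrix R) (x : R), (∃ m, Reach h m g) →
      ∃ m, Reach h m (g * toMarked (elementaryMatrix 1 0 fin_zero_ne_one.symm x, mark (-x))) := by
    rintro g x ⟨m, hm⟩
    rw [toMarked_lower h, ← mul_assoc, ← mul_assoc, ← mul_assoc]
    refine hmul _ _ hneg ?_
    obtain ⟨m₁, h₁⟩ := hm.mul_weyl
    exact (h₁.mul hcomm (isTriangular_upper h (-x))).mul_weyl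
  induction hg using Subgroup.closure_induction_right with
  | one => exact ⟨0, .base (by rw [map_one, ← upper_zero]; exact isTriangular_upper h 0)⟩
  | mul_right g _ y hy ih =>
    rw [map_mul]
    obtain ⟨x, rfl | rfl⟩ := hy
    · rw [toMarked_upper]
      exact hmul _ _ (isTriangular_upper h x) ih
    · exact hlow _ x ih
  | mul_inv_cancel g _ y hy ih =>
    rw [map_mul]
    obtain ⟨x, rfl | rfl⟩ := hy
    · rw [Prod.inv_mk, elementaryMatrix_inv, ← mark_neg, toMarked_upper]
      exact hmul _ _ (isTriangular_upper h (-x)) ih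
    · rw [Prod.inv_mk, elementaryMatrix_inv, ← mark_neg]
      exact hlow _ (-x) ih

theorem elementaryMatrix_mem (i j : Fin 2) (hij : i ≠ j) (x : R) :
    elementaryMatrix i j hij x ∈ elementaryGroup (Fin 2) R :=
  Subgroup.subset_closure ⟨i, j, hij, x, rfl⟩

theorem elementaryGroup_eq_closure : elementaryGroup (Fin 2) R = Subgroup.closure
    {g | ∃ x : R, g = elementaryMatrix 0 1 fin_zero_ne_one x ∨
      g = elementaryMatrix 1 0 fin_zero_ne_one.symm x} := by
  refine congrArg Subgroup.closure (Set.ext fun g => ⟨?_, ?_⟩)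
  · rintro ⟨i, j, hij, x, rfl⟩
    fin_cases i <;> fin_cases j
    · exact absurd rfl hij
    · exact ⟨x, .inl rfl⟩
    · exact ⟨x, .inr rfl⟩
    · exact absurd rfl hij
  · rintro ⟨x, rfl | rfl⟩
    · exact ⟨_, _, _, x, rfl⟩
    · exact ⟨_, _, _, x, rfl⟩

theorem elementaryGroup_eq_map :
    elementaryGroup (Fin 2) R = (markedGroup R).map (MonoidHom.fst _ _) := by
  rw [elementaryGroup_eq_closure, markedGroup, MonoidHom.map_closure]
  congr 1
  ext g
  constructor
  · rintro ⟨x, rfl | rfl⟩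
    · exact ⟨_, ⟨x, .inl rfl⟩, rfl⟩
    · exact ⟨_, ⟨x, .inr rfl⟩, rfl⟩
  · rintro ⟨_, ⟨x, rfl | rfl⟩, rfl⟩
    · exact ⟨x, .inl rfl⟩
    · exact ⟨x, .inr rfl⟩

theorem snd_eq_one_of_mem_commutator {G A : Type*} [Group G] [CommGroup A] (H : Subgroup (G × A))
    {g : G × A} (hg : g ∈ ⁅H, H⁆) : g.2 = 1 := by
  have hle : ⁅H, H⁆ ≤ (MonoidHom.snd G A).ker := Subgroup.commutator_le.2 fun a _ b _ => by
    rw [MonoidHom.mem_ker, map_commutatorElement, commutatorElement_eq_one_iff_mul_comm, mul_comm]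
  exact hle hg

include h in
/-- If the units commute, an upper elementary matrix that is trivial in the abelianization has its
entry in the saturated span of the units. -/
theorem mem_unitSaturation_of_abelianization
    (hcomm : ∀ x y : R, IsUnit x → IsUnit y → x * y = y * x) {x : R}
    (hx : Abelianization.of (⟨elementaryMatrix 0 1 fin_zero_ne_one x,
      elementaryMatrix_mem _ _ _ x⟩ : elementaryGroup (Fin 2) R) = 1) :
    x ∈ unitSaturation R := by
  have h1 := (QuotientGroup.eq_one_iff _).1 hx
  have h2 : elementaryMatrix 0 1 fin_zero_ne_one x ∈
      ⁅elementaryGroup (Fin 2) R, elementaryGroup (Fin 2) R⁆ := by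
    have := Subgroup.mem_map_of_mem (elementaryGroup (Fin 2) R).subtype h1
    rw [commutator_def, Subgroup.map_commutator, ← MonoidHom.range_eq_map,
      Subgroup.range_subtype] at this
    exact this
  -- The commutator is lifted to the commutator subgroup of the marked group, where the mark is
  -- trivial because marks form an abelian group.
  rw [elementaryGroup_eq_map, ← Subgroup.map_commutator] at h2
  obtain ⟨⟨y, w⟩, hy, hyx⟩ := h2
  have h3 : w = 1 := by
    exact snd_eq_one_of_mem_commutator _ hy
  obtain rfl : y = _ := hyx
  subst h3
  obtain ⟨m, hm⟩ := exists_reach_of_mem_markedGroup (h := h) hcomm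
    (Subgroup.commutator_le_self (markedGroup R) hy)
  have hval : (toMarked (elementaryMatrix 0 1 fin_zero_ne_one x, 1) : MarkedMatrix R) =
      (!![1, x; 0, 1], 1) := by
    have : (elementaryMatrix 0 1 fin_zero_ne_one x : GL (Fin 2) R).val = !![1, x; 0, 1] :=
      congrArg Prod.fst (toMarked_upper x)
    exact Prod.ext this rfl
  rw [hval] at hm
  -- The bound m may be negative, so it is first enlarged to a successor of a natural number.
  -- Comparing entries of the resulting factorization gives u = 1 and z = x, so the trivial mark is
  -- the mark of x.
  obtain ⟨z, u, hu, hzu⟩ := (hm.mono (m' := (m.toNat : ℤ) + 1) (by omega)).isTriangular hcomm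
    m.toNat (by simp)
  have hmat := congrArg Prod.fst hzu
  have hmark := congrArg Prod.snd hzu
  simp only [upper, diag, Prod.fst_mul, Prod.snd_mul, mul_one] at hmat hmark
  have e00 := congrFun (congrFun hmat 0) 0
  have e01 := congrFun (congrFun hmat 0) 1
  simp at e00 e01
  rw [← e00, h.conj_one, mul_one] at e01
  rw [e01]
  exact mark_eq_one.1 hmark.symm

end MarkedMatrix

end

/-! ### Generators of the abelianization and torsion of unit classes. -/

section

open scoped Quaternion MatrixGroups
open OrderElem

namespace ElementaryAbelianization

open MarkedMatrix

variable {R : Type*} [Ring R]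

/-- The upper elementary matrices as elements of the elementary group. -/
def upperElem (x : R) : elementaryGroup (Fin 2) R :=
  ⟨elementaryMatrix 0 1 fin_zero_ne_one x, elementaryMatrix_mem _ _ _ x⟩

/-- The lower elementary matrices as elements of the elementary group. -/
def lowerElem (x : R) : elementaryGroup (Fin 2) R :=
  ⟨elementaryMatrix 1 0 fin_zero_ne_one.symm x, elementaryMatrix_mem _ _ _ x⟩

theorem coe_upperElem (x : R) :
    ((upperElem x : GL (Fin 2) R) : Matrix (Fin 2) (Fin 2) R) = !![1, x; 0, 1] := by
  ext i j
  fin_cases i <;> fin_cases j <;> simp [upperElem, elementaryMatrix]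

theorem coe_lowerElem (x : R) :
    ((lowerElem x : GL (Fin 2) R) : Matrix (Fin 2) (Fin 2) R) = !![1, 0; x, 1] := by
  ext i j
  fin_cases i <;> fin_cases j <;> simp [lowerElem, elementaryMatrix]

theorem ext_coe {g g' : elementaryGroup (Fin 2) R}
    (hg : ((g : GL (Fin 2) R) : Matrix (Fin 2) (Fin 2) R) = (g' : GL (Fin 2) R)) : g = g' :=
  Subtype.ext (Units.ext hg)

variable (R) in
/-- The class of an upper elementary matrix in the abelianization. -/
def upperClass :
    R →+ Additive (Abelianization (elementaryGroup (Fin 2) R)) where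
  toFun x := Additive.ofMul (Abelianization.of (upperElem x))
  map_zero' := by
    have : upperElem (0 : R) = 1 := ext_coe (by rw [coe_upperElem]; exact Matrix.one_fin_two.symm)
    rw [this, map_one, ofMul_one]
  map_add' x y := by
    have : upperElem (x + y) = upperElem x * upperElem y :=
      Subtype.ext (elementaryMatrix_add _ _ fin_zero_ne_one x y)
    rw [this, map_mul, ofMul_mul]

/-- Conjugation by the Weyl element carries the upper matrix of -x to the lower matrix of x. -/
theorem of_lowerElem (x : R) :
    Additive.ofMul (Abelianization.of (lowerElem x)) = upperClass R (-x) := by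
  have hw : upperElem 1 * lowerElem (-1) * upperElem 1 * upperElem (-x) =
      lowerElem x * (upperElem 1 * lowerElem (-1) * upperElem 1) := by
    refine ext_coe ?_
    simp [coe_upperElem, coe_lowerElem]
  have := congrArg Abelianization.of hw
  rw [map_mul, map_mul Abelianization.of (lowerElem x), mul_comm] at this
  exact congrArg Additive.ofMul (mul_right_cancel this).symm

theorem upperClass_surjective : Function.Surjective (upperClass R) := by
  rw [← AddMonoidHom.range_eq_top, eq_top_iff]
  rintro a -
  induction a using Additive.rec with | _ a
  induction a using QuotientGroup.induction_on with | _ g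
  obtain ⟨g, hg⟩ := g
  have key : ∀ g (hg : g ∈ elementaryGroup (Fin 2) R),
      Additive.ofMul (Abelianization.of ⟨g, hg⟩) ∈ (upperClass R).range := by
    intro g hg
    have hg' := hg
    rw [elementaryGroup_eq_closure] at hg'
    induction hg' using Subgroup.closure_induction with
    | mem g hg1 =>
      obtain ⟨x, rfl | rfl⟩ := hg1
      · exact ⟨x, rfl⟩
      · exact ⟨-x, (of_lowerElem x).symm⟩
    | one => exact ⟨0, (map_zero _).trans (congrArg Additive.ofMul (map_one Abelianization.of)).symm⟩
    | mul a b ha hb iha ihb =>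
      rw [← elementaryGroup_eq_closure] at ha hb
      have : (⟨a * b, hg⟩ : elementaryGroup (Fin 2) R) = ⟨a, ha⟩ * ⟨b, hb⟩ := rfl
      rw [this, map_mul, ofMul_mul]
      exact add_mem (iha ha) (ihb hb)
    | inv a ha iha =>
      rw [← elementaryGroup_eq_closure] at ha
      have : (⟨a⁻¹, hg⟩ : elementaryGroup (Fin 2) R) = ⟨a, ha⟩⁻¹ := rfl
      rw [this, map_inv, ofMul_inv]
      exact neg_mem (iha ha)
  exact key g hg

/-- The Weyl element of each unit v squares to -1, so 4[v] + 2[v⁻¹] = 6[1]. Twice this relation for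
u minus the one for u⁻¹ gives 6[u] = 6[1], and 12[1] = 0 because the Weyl element of 1 has fourth
power 1. -/
theorem twelve_zsmul_upperClass (u : Rˣ) : (12 : ℤ) • upperClass R u = 0 := by
  have hW : ∀ v : Rˣ,
      ((((upperElem (v : R) * lowerElem (-((v⁻¹ : Rˣ) : R)) * upperElem (v : R)) *
        (upperElem (v : R) * lowerElem (-((v⁻¹ : Rˣ) : R)) * upperElem (v : R)) :
        elementaryGroup (Fin 2) R) : GL (Fin 2) R) : Matrix (Fin 2) (Fin 2) R) = -1 := by
    intro v
    rw [Matrix.one_fin_two]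
    simp [coe_upperElem, coe_lowerElem]
  have hrel : ∀ v : Rˣ, upperClass R ((4 : ℤ) • (v : R) + (2 : ℤ) • ((v⁻¹ : Rˣ) : R)) =
      upperClass R ((6 : ℤ) • (1 : R)) := by
    intro v
    have h1 := congrArg (fun g => Additive.ofMul (Abelianization.of g))
      (ext_coe ((hW v).trans (hW 1).symm))
    simp only [map_mul, ofMul_mul, of_lowerElem, inv_one, Units.val_one] at h1
    simp only [neg_neg] at h1
    change upperClass R _ + upperClass R _ + upperClass R _ +
      (upperClass R _ + upperClass R _ + upperClass R _) =
      upperClass R _ + upperClass R _ + upperClass R _ +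
      (upperClass R _ + upperClass R _ + upperClass R _) at h1
    rw [map_add, map_zsmul, map_zsmul, map_zsmul]
    convert h1 using 1 <;> abel
  have h1 := hrel u
  have h2 := hrel u⁻¹
  have h3 : (12 : ℤ) • upperClass R 1 = 0 := by
    have hsq : (upperElem (1 : R) * lowerElem (-1) * upperElem 1 *
        (upperElem 1 * lowerElem (-1) * upperElem 1)) *
        (upperElem 1 * lowerElem (-1) * upperElem 1 *
          (upperElem 1 * lowerElem (-1) * upperElem 1)) = 1 := by
      have h4 := hW 1
      rw [inv_one, Units.val_one] at h4
      refine ext_coe ?_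
      rw [Subgroup.coe_mul, Units.val_mul, h4, neg_mul_neg, one_mul]
      rfl
    have h4 := congrArg (fun g => Additive.ofMul (Abelianization.of g)) hsq
    simp only [map_mul, ofMul_mul, of_lowerElem, neg_neg, map_one, ofMul_one] at h4
    change (upperClass R _ + upperClass R _ + upperClass R _ +
      (upperClass R _ + upperClass R _ + upperClass R _)) +
      (upperClass R _ + upperClass R _ + upperClass R _ +
      (upperClass R _ + upperClass R _ + upperClass R _)) = 0 at h4
    rw [← h4]
    abel
  rw [inv_inv] at h2
  simp only [map_add, map_zsmul] at h1 h2
  have h4 : (12 : ℤ) • upperClass R u =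
      (2 : ℤ) • ((4 : ℤ) • upperClass R u + (2 : ℤ) • upperClass R ((u⁻¹ : Rˣ) : R)) -
      ((4 : ℤ) • upperClass R ((u⁻¹ : Rˣ) : R) + (2 : ℤ) • upperClass R u) +
      ((2 : ℤ) • ((4 : ℤ) • upperClass R u + (2 : ℤ) • upperClass R ((u⁻¹ : Rˣ) : R)) -
      ((4 : ℤ) • upperClass R ((u⁻¹ : Rˣ) : R) + (2 : ℤ) • upperClass R u)) := by abel
  rw [h4, h1, h2, ← h3]
  abel

end ElementaryAbelianization

end

/-! ### Quaternion pairs and coordinates by traces. -/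

section

open scoped Quaternion

/-- The elements `i`, `j` anticommute, with `i² = -1` and `j² = -q`. -/
structure IsQuaternionPair {R : Type*} [Ring R] (q : ℤ) (i j : R) : Prop where
  i_mul_i : i * i = -1
  j_mul_j : j * j = -(q : R)
  j_mul_i : j * i = -(i * j)

theorem IsQuaternionPair.k_mul_k {R : Type*} [Ring R] {q : ℤ} {i j : R}
    (hp : IsQuaternionPair q i j) : i * j * (i * j) = -(q : R) := by
  have : i * j * (i * j) = i * (j * i) * j := by noncomm_ring
  rw [this, hp.j_mul_i]
  have : i * -(i * j) * j = -((i * i) * (j * j)) := by noncomm_ring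
  rw [this, hp.i_mul_i, hp.j_mul_j]
  noncomm_ring

/-- The ring is the `ℤ`-span of `1, i, j, ij` for anticommuting square roots `i, j` of `-1`. -/
def IsLipschitzForm (R : Type*) [Ring R] : Prop :=
  ∃ i j : R, IsQuaternionPair 1 i j ∧ ∀ x : R, ∃ a b c d : ℤ, x = a + b * i + c * j + d * (i * j)

/-- The ring is the `ℤ`-span of `1, i, j, (1 + i + j + ij)/2` for anticommuting square roots
`i, j` of `-1`. -/
def IsHurwitzForm (R : Type*) [Ring R] : Prop :=
  ∃ i j w : R, IsQuaternionPair 1 i j ∧ 2 * w = 1 + i + j + i * j ∧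
    ∀ x : R, ∃ a b c d : ℤ, x = a + b * i + c * j + d * w

/-- The ring is the `ℤ`-span of `1, i, (1 + j)/2, i(1 + j)/2` for anticommuting square roots
`i` of `-1` and `j` of `-3`. -/
def IsOrderThreeForm (R : Type*) [Ring R] : Prop :=
  ∃ i j w : R, IsQuaternionPair 3 i j ∧ 2 * w = 1 + j ∧
    ∀ x : R, ∃ a b c d : ℤ, x = a + b * i + c * w + d * (i * w)

/-- The ring is the `ℤ`-span of `1, i` for a square root `i` of `-1`. -/
def IsGaussForm (R : Type*) [Ring R] : Prop :=
  ∃ i : R, i * i = -1 ∧ ∀ x : R, ∃ a b : ℤ, x = a + b * i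

/-- The ring is the `ℤ`-span of `1, (1 + j)/2` for a square root `j` of `-3`. -/
def IsEisensteinForm (R : Type*) [Ring R] : Prop :=
  ∃ j w : R, j * j = -3 ∧ 2 * w = 1 + j ∧ ∀ x : R, ∃ a b : ℤ, x = a + b * w

namespace IsDefinite

variable {R : Type*} [Ring R] {φ : R →+* ℍ[ℝ]} (h : IsDefinite φ)

include h

theorem intCast_mul_cancel {n : ℤ} (hn : n ≠ 0) {x y : R} (hxy : (n : R) * x = n * y) : x = y := by
  have h1 : (n : R) * (x - y) = 0 := by rw [mul_sub, hxy, sub_self]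
  rcases h.mul_eq_zero_imp h1 with h2 | h2
  · exact absurd (h.intCast_injective (by rw [h2, Int.cast_zero])) hn
  · exact sub_eq_zero.1 h2

theorem two_mul_cancel {x y : R} (hxy : 2 * x = 2 * y) : x = y :=
  h.intCast_mul_cancel two_ne_zero (by exact_mod_cast hxy)

theorem tr_sq (x : R) : h.tr (x * x) = h.tr x ^ 2 - 2 * h.nrm x := by
  rw [h.sq_eq, h.tr_sub, h.tr_intCast_mul, h.tr_intCast]; ring

theorem tr_eq_zero_of_sq {x : R} {n : ℤ} (hn : 0 < n) (hx : x * x = -(n : R)) : h.tr x = 0 := by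
  by_contra ht
  have h1 := h.tr_sq x
  have h2 : h.tr (x * x) = 2 * -n := by rw [hx, ← Int.cast_neg, h.tr_intCast]
  have h3 := h.nrm_mul x x
  rw [hx, ← Int.cast_neg] at h3
  have h4 : h.nrm ((-n : ℤ) : R) = n ^ 2 := by
    have := h.normSq_map ((-n : ℤ) : R)
    rw [map_intCast, Quaternion.normSq_intCast] at this
    have : (h.nrm ((-n : ℤ) : R) : ℝ) = ((n ^ 2 : ℤ) : ℝ) := by rw [← this]; push_cast; ring
    exact_mod_cast this
  rw [h4] at h3
  have h5 : h.nrm x = n := by nlinarith [h.nrm_nonneg x]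
  have : 0 < h.tr x ^ 2 := by positivity
  nlinarith

theorem conj_intCast_mul (n : ℤ) (x : R) : h.conj (n * x) = n * h.conj x := by
  rw [h.conj_mul, h.conj_intCast, Int.cast_comm]

theorem tr_mul_intCast_mul (n : ℤ) (x y : R) : h.tr (x * (n * y)) = n * h.tr (x * y) := by
  rw [← mul_assoc, ← Int.cast_comm, mul_assoc, h.tr_intCast_mul]

theorem conj_eq_neg {x : R} (hx : h.tr x = 0) : h.conj x = -x := by
  rw [conj, hx, Int.cast_zero, zero_sub]

theorem anticomm_of_tr {x y : R} (hx : h.tr x = 0) (hy : h.tr y = 0) (hxy : h.tr (x * y) = 0) :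
    y * x = -(x * y) := by
  have := h.add_conj (x * y)
  rw [hxy, Int.cast_zero, h.conj_mul, h.conj_eq_neg hx, h.conj_eq_neg hy, neg_mul_neg] at this
  exact eq_neg_of_add_eq_zero_right this

section Pair

variable {q : ℤ} {i j : R} (hq : 0 < q) (hp : IsQuaternionPair q i j)
include hq hp

omit hq in
theorem tr_i : h.tr i = 0 := h.tr_eq_zero_of_sq one_pos (by rw [hp.i_mul_i, Int.cast_one])

theorem tr_j : h.tr j = 0 := h.tr_eq_zero_of_sq hq hp.j_mul_j

theorem tr_k : h.tr (i * j) = 0 := h.tr_eq_zero_of_sq hq (hp.k_mul_k)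

/-- Vanishing traces make y anticommute with i, j and ij. Anticommuting with i and j forces
commuting with ij, so 2y(ij) = 0. -/
theorem eq_zero_of_tr {y : R} (h0 : h.tr y = 0) (h1 : h.tr (y * i) = 0) (h2 : h.tr (y * j) = 0)
    (h3 : h.tr (y * (i * j)) = 0) : y = 0 := by
  have e1 := h.anticomm_of_tr h0 (h.tr_i hp) h1
  have e2 := h.anticomm_of_tr h0 (h.tr_j hq hp) h2
  have e3 := h.anticomm_of_tr h0 (h.tr_k hq hp) h3
  have e4 : i * j * y = y * (i * j) := by
    rw [mul_assoc, e2, mul_neg, ← mul_assoc, e1, neg_mul, neg_neg, mul_assoc]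
  have e5 : 2 * (y * (i * j)) = 0 := by
    rw [two_mul]; nth_rewrite 1 [← e4]; rw [e3, neg_add_cancel]
  have e6 : y * (i * j) = 0 := h.two_mul_cancel (by rw [e5, mul_zero])
  rcases h.mul_eq_zero_imp e6 with hy | hk
  · exact hy
  · have := hp.k_mul_k
    rw [hk, zero_mul, eq_comm, neg_eq_zero] at this
    exact absurd (h.intCast_injective (by rw [this, Int.cast_zero])) hq.ne'

theorem tr_table : h.tr (i * i) = -2 ∧ h.tr (j * j) = -2 * q ∧ h.tr (i * j * (i * j)) = -2 * q ∧
    h.tr (j * i) = 0 ∧ h.tr (i * (i * j)) = 0 ∧ h.tr (j * (i * j)) = 0 ∧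
    h.tr (i * j * i) = 0 ∧ h.tr (i * j * j) = 0 := by
  have hi := h.tr_i hp
  have hj := h.tr_j hq hp
  have hk := h.tr_k hq hp
  have e1 : h.tr (i * (i * j)) = 0 := by
    rw [← mul_assoc, hp.i_mul_i, neg_one_mul, h.tr_neg, hj, neg_zero]
  have e2 : h.tr (i * j * j) = 0 := by
    rw [mul_assoc, hp.j_mul_j, mul_neg, ← Int.cast_comm, h.tr_neg, h.tr_intCast_mul, hi, mul_zero,
      neg_zero]
  refine ⟨?_, ?_, ?_, ?_, e1, ?_, ?_, e2⟩
  · rw [hp.i_mul_i, h.tr_neg, h.tr_one]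
  · rw [hp.j_mul_j, h.tr_neg, h.tr_intCast]; ring
  · rw [hp.k_mul_k, h.tr_neg, h.tr_intCast]; ring
  · rw [h.tr_mul_comm, hk]
  · rw [h.tr_mul_comm, e2]
  · rw [h.tr_mul_comm, e1]

/-- The basis 1, i, j, ij is orthogonal for the trace form; the factor 2q clears the denominators of
the dual basis. -/
theorem expand (x : R) : ((2 * q : ℤ) : R) * x = (q * h.tr x : ℤ) - (q * h.tr (x * i) : ℤ) * i -
    (h.tr (x * j) : ℤ) * j - (h.tr (x * (i * j)) : ℤ) * (i * j) := by
  obtain ⟨t1, t2, t3, t4, t5, t6, t7, t8⟩ := h.tr_table hq hp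
  have hi := h.tr_i hp
  have hj := h.tr_j hq hp
  have hk := h.tr_k hq hp
  refine sub_eq_zero.1 (h.eq_zero_of_tr hq hp ?_ ?_ ?_ ?_) <;>
  simp only [sub_mul, mul_assoc (Int.cast _), h.tr_sub, h.tr_intCast_mul, h.tr_intCast, t1, t2, t3,
    t4, t5, t6, t7, t8, hi, hj, hk] <;> ring

/-- Conjugating the expansion and pairing with x expresses the norm in the same trace coordinates;
integrality of the norm then yields congruences between them. -/
theorem four_mul_nrm (x : R) : 4 * q * h.nrm x =
    q * h.tr x ^ 2 + q * h.tr (x * i) ^ 2 + h.tr (x * j) ^ 2 + h.tr (x * (i * j)) ^ 2 := by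
  have hi := h.conj_eq_neg (h.tr_i hp)
  have hj := h.conj_eq_neg (h.tr_j hq hp)
  have hk := h.conj_eq_neg (h.tr_k hq hp)
  have h1 := congrArg h.conj (h.expand hq hp x)
  rw [h.conj_sub, h.conj_sub, h.conj_sub, h.conj_intCast, h.conj_intCast_mul, h.conj_intCast_mul,
    h.conj_intCast_mul, h.conj_intCast_mul, hi, hj, hk] at h1
  have h2 := congrArg (fun y => h.tr (x * y)) h1
  simp only [mul_sub, mul_neg, h.tr_sub, h.tr_neg, h.tr_mul_intCast_mul, h.mul_conj,
    ← Int.cast_comm, h.tr_intCast_mul, h.tr_intCast] at h2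
  linarith

theorem coeff_eq_zero {a b c d : ℤ} (hx : (a : R) + b * i + c * j + d * (i * j) = 0) :
    a = 0 ∧ b = 0 ∧ c = 0 ∧ d = 0 := by
  obtain ⟨t1, t2, t3, t4, t5, t6, t7, t8⟩ := h.tr_table hq hp
  have hi := h.tr_i hp
  have hj := h.tr_j hq hp
  have hk := h.tr_k hq hp
  have key : ∀ y : R, h.tr (((a : R) + b * i + c * j + d * (i * j)) * y) = 0 := fun y => by
    rw [hx, zero_mul, ← Int.cast_zero, h.tr_intCast, mul_zero]
  have k0 := key 1
  have k1 := key i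
  have k2 := key j
  have k3 := key (i * j)
  simp only [mul_one, add_mul, mul_assoc (Int.cast _), h.tr_add, h.tr_intCast_mul, h.tr_intCast, t1,
    t2, t3, t4, t5, t6, t7, t8, hi, hj, hk] at k0 k1 k2 k3
  have hq0 := hq.ne'
  refine ⟨by omega, by omega, ?_, ?_⟩
  · have : c * q = 0 := by linarith
    exact (mul_eq_zero.1 this).resolve_right hq0
  · have : d * q = 0 := by linarith
    exact (mul_eq_zero.1 this).resolve_right hq0

end Pair

end IsDefinite

end

/-! ### Overrings of a quaternion pair or of a central square root. -/

section

open scoped Quaternion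

/-- Squares are 0 or 1 modulo 4, so the number of odd terms is 0 or 4. -/
theorem four_squares_parity {a b c d n : ℤ} (hn : 4 * n = a ^ 2 + b ^ 2 + c ^ 2 + d ^ 2) :
    b % 2 = a % 2 ∧ c % 2 = a % 2 ∧ d % 2 = a % 2 := by
  rcases Int.even_or_odd' a with ⟨a, rfl | rfl⟩ <;> rcases Int.even_or_odd' b with ⟨b, rfl | rfl⟩ <;>
  rcases Int.even_or_odd' c with ⟨c, rfl | rfl⟩ <;> rcases Int.even_or_odd' d with ⟨d, rfl | rfl⟩ <;>
  ring_nf at hn <;> omega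

/-- -1 is not a square modulo 3. -/
theorem three_dvd_of_sq_add_sq {c d n : ℤ} (hn : c ^ 2 + d ^ 2 = 3 * n) : 3 ∣ c ∧ 3 ∣ d := by
  have hc : c = 3 * (c / 3) + c % 3 := by omega
  have hd : d = 3 * (d / 3) + d % 3 := by omega
  have hc' : c % 3 = 0 ∨ c % 3 = 1 ∨ c % 3 = 2 := by omega
  have hd' : d % 3 = 0 ∨ d % 3 = 1 ∨ d % 3 = 2 := by omega
  generalize c / 3 = x at *
  generalize d / 3 = y at *
  rcases hc' with e | e | e <;> rcases hd' with f | f | f <;> rw [e] at hc <;> rw [f] at hd <;>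
  subst hc <;> subst hd <;> ring_nf at hn <;> omega

namespace IsDefinite

variable {R : Type*} [Ring R] {φ : R →+* ℍ[ℝ]} (h : IsDefinite φ)

include h

/-- Integrality of the norm forces the doubled coordinates of each element to have equal parity. So
R lies between the Lipschitz and Hurwitz orders, an inclusion of index two. -/
theorem isLipschitzForm_or_isHurwitzForm {i j : R} (hp : IsQuaternionPair 1 i j) :
    IsLipschitzForm R ∨ IsHurwitzForm R := by
  have hx2 : ∀ x : R, ∃ a b c d : ℤ, 2 * x = a + b * i + c * j + d * (i * j) ∧
      b % 2 = a % 2 ∧ c % 2 = a % 2 ∧ d % 2 = a % 2 := by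
    intro x
    have h1 := h.expand one_pos hp x
    have h2 := h.four_mul_nrm one_pos hp x
    simp only [one_mul, mul_one] at h1 h2
    obtain ⟨p1, p2, p3⟩ := four_squares_parity h2
    refine ⟨h.tr x, -h.tr (x * i), -h.tr (x * j), -h.tr (x * (i * j)), ?_, by omega, by omega,
      by omega⟩
    have h3 : ((2 : ℤ) : R) = 2 := by norm_num
    rw [h3] at h1
    rw [h1]
    push_cast
    noncomm_ring
  have heven : ∀ (x : R) (a b c d : ℤ), 2 * x = a + b * i + c * j + d * (i * j) → a % 2 = 0 →
      b % 2 = a % 2 → c % 2 = a % 2 → d % 2 = a % 2 →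
      ∃ a b c d : ℤ, x = a + b * i + c * j + d * (i * j) := by
    intro x a b c d hx ha hb hc hd
    obtain ⟨a, rfl⟩ : ∃ a', a = 2 * a' := ⟨a / 2, by omega⟩
    obtain ⟨b, rfl⟩ : ∃ a', b = 2 * a' := ⟨b / 2, by omega⟩
    obtain ⟨c, rfl⟩ : ∃ a', c = 2 * a' := ⟨c / 2, by omega⟩
    obtain ⟨d, rfl⟩ : ∃ a', d = 2 * a' := ⟨d / 2, by omega⟩
    refine ⟨a, b, c, d, h.two_mul_cancel (hx.trans ?_)⟩
    push_cast
    noncomm_ring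
  by_cases hodd : ∃ w : R, 2 * w = 1 + i + j + i * j
  · right
    obtain ⟨w, hw⟩ := hodd
    refine ⟨i, j, w, hp, hw, fun x => ?_⟩
    obtain ⟨a, b, c, d, hx, hb, hc, hd⟩ := hx2 x
    refine ⟨(a - d) / 2, (b - d) / 2, (c - d) / 2, d, h.two_mul_cancel ?_⟩
    have e : ∀ n : ℤ, 2 * (n : R) = ((2 * n : ℤ) : R) := fun n => by push_cast; rfl
    have e1 : 2 * ((a - d) / 2) = a - d := by omega
    have e2 : 2 * ((b - d) / 2) = b - d := by omega
    have e3 : 2 * ((c - d) / 2) = c - d := by omega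
    have e4 : 2 * ((d : R) * w) = d * (1 + i + j + i * j) := by
      rw [← hw, ← mul_assoc, ← mul_assoc, (Commute.ofNat_left 2 (d : R)).eq]
    rw [mul_add, mul_add, mul_add, ← mul_assoc 2 _ i, ← mul_assoc 2 _ j, e, e, e, e1, e2, e3, e4, hx]
    push_cast
    noncomm_ring
  · left
    refine ⟨i, j, hp, fun x => ?_⟩
    obtain ⟨a, b, c, d, hx, hb, hc, hd⟩ := hx2 x
    rcases Int.emod_two_eq_zero_or_one a with ha | ha
    · exact heven x a b c d hx ha hb hc hd
    -- All doubled coordinates are odd, so removing the integral part leaves (1 + i + j + ij)/2 in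
    -- R.
    · refine absurd ⟨x - (((a - 1) / 2 : ℤ) + ((b - 1) / 2 : ℤ) * i + ((c - 1) / 2 : ℤ) * j +
        ((d - 1) / 2 : ℤ) * (i * j)), ?_⟩ hodd
      have e : ∀ n : ℤ, 2 * (n : R) = ((2 * n : ℤ) : R) := fun n => by push_cast; rfl
      have e1 : 2 * ((a - 1) / 2) = a - 1 := by omega
      have e2 : 2 * ((b - 1) / 2) = b - 1 := by omega
      have e3 : 2 * ((c - 1) / 2) = c - 1 := by omega
      have e4 : 2 * ((d - 1) / 2) = d - 1 := by omega
      rw [mul_sub, mul_add, mul_add, mul_add, ← mul_assoc 2 _ i, ← mul_assoc 2 _ j,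
        ← mul_assoc 2 _ (i * j), e, e, e, e, e1, e2, e3, e4, hx]
      push_cast
      noncomm_ring

/-- The norm relation makes 3 divide the trace coordinates at j and ij, and traces against w and iw
give the parity conditions; together they leave only the maximal order. -/
theorem isOrderThreeForm {i j w : R} (hp : IsQuaternionPair 3 i j) (hw : 2 * w = 1 + j) :
    IsOrderThreeForm R := by
  refine ⟨i, j, w, hp, hw, fun x => ?_⟩
  have h1 := h.expand three_pos hp x
  have h2 := h.four_mul_nrm three_pos hp x
  have hw' : j = ((2 : ℤ) : R) * w - 1 := by rw [Int.cast_ofNat, hw]; abel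
  have h3 : h.tr (x * j) = 2 * h.tr (x * w) - h.tr x := by
    rw [hw', mul_sub, h.tr_sub, h.tr_mul_intCast_mul, mul_one]
  have h4 : h.tr (x * (i * j)) = 2 * h.tr (x * (i * w)) - h.tr (x * i) := by
    rw [hw', mul_sub, mul_sub, h.tr_sub, mul_one, ← mul_assoc i, ← Int.cast_comm, mul_assoc,
      h.tr_mul_intCast_mul]
  generalize h.tr x = A at *
  generalize h.tr (x * i) = B at *
  generalize h.tr (x * j) = C at *
  generalize h.tr (x * (i * j)) = D at *
  obtain ⟨⟨C, rfl⟩, ⟨D, rfl⟩⟩ := three_dvd_of_sq_add_sq (c := C) (d := D)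
    (n := 4 * h.nrm x - A ^ 2 - B ^ 2) (by linarith)
  -- Now x = (A - Bi - Cj - D ij)/2, and j = 2w - 1 is substituted. The halves are exact because
  -- `h3` and `h4` give A ≡ C and B ≡ D modulo 2.
  refine ⟨(A + C) / 2, (D - B) / 2, -C, -D, h.intCast_mul_cancel (n := 2 * 3) (by norm_num) ?_⟩
  have e1 : 2 * ((A + C) / 2) = A + C := by omega
  have e2 : 2 * ((D - B) / 2) = D - B := by omega
  have e : ∀ (n : ℤ) (y : R), ((2 * 3 : ℤ) : R) * (n * y) = ((3 * (2 * n) : ℤ) : R) * y :=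
    fun n y => by rw [← mul_assoc, ← Int.cast_mul]; congr 2; ring
  have e0 : ∀ n : ℤ, ((2 * 3 : ℤ) : R) * n = ((3 * (2 * n) : ℤ) : R) :=
    fun n => by rw [← Int.cast_mul]; congr 1; ring
  have e5 : ∀ (n : ℤ) (y : R), ((3 * (2 * n) : ℤ) : R) * y = ((3 * n : ℤ) : R) * (2 * y) :=
    fun n y => by
      push_cast
      rw [(Commute.ofNat_left 2 (n : R)).eq]
      simp only [mul_assoc]
  have e6 : 2 * (i * w) = i + i * j := by
    rw [← mul_assoc, two_mul, ← mul_two, mul_assoc, hw, mul_add, mul_one]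
  rw [h1, mul_add, mul_add, mul_add, e, e, e, e0, e1, e2, e5, e5, hw, e6]
  push_cast
  noncomm_ring

section Commuting

variable {q : ℤ} {j : R} (hq : 0 < q) (hj : j * j = -(q : R)) (hcomm : ∀ x, j * x = x * j)
include hq hj hcomm

/-- The difference of the two sides has trace zero against 1 and j, hence anticommutes with j; as j
is central, its product with j vanishes. -/
theorem expand_of_commuting (x : R) :
    ((2 * q : ℤ) : R) * x = (q * h.tr x : ℤ) - (h.tr (x * j) : ℤ) * j := by
  have tj := h.tr_eq_zero_of_sq hq hj
  have tjj : h.tr (j * j) = -2 * q := by rw [hj, h.tr_neg, h.tr_intCast]; ring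
  refine sub_eq_zero.1 ?_
  set y := ((2 * q : ℤ) : R) * x - ((q * h.tr x : ℤ) - (h.tr (x * j) : ℤ) * j) with hy
  have h0 : h.tr y = 0 := by
    simp only [hy, h.tr_sub, h.tr_intCast_mul, h.tr_intCast, tj]; ring
  have h1 : h.tr (y * j) = 0 := by
    simp only [hy, sub_mul, mul_assoc (Int.cast _), h.tr_sub, h.tr_intCast_mul, tj, tjj]; ring
  have h2 := h.anticomm_of_tr h0 tj h1
  rw [hcomm] at h2
  have h3 : y * j = 0 := h.two_mul_cancel (by
    rw [mul_zero, two_mul]; nth_rewrite 1 [h2]; exact neg_add_cancel _)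
  refine (h.mul_eq_zero_imp h3).resolve_right fun hj0 => ?_
  rw [hj0, zero_mul, eq_comm, neg_eq_zero] at hj
  exact hq.ne' (h.intCast_injective (by rw [hj, Int.cast_zero]))

theorem four_mul_nrm_of_commuting (x : R) :
    4 * q * h.nrm x = q * h.tr x ^ 2 + h.tr (x * j) ^ 2 := by
  have tj := h.conj_eq_neg (h.tr_eq_zero_of_sq hq hj)
  have h1 := congrArg h.conj (h.expand_of_commuting hq hj hcomm x)
  rw [h.conj_sub, h.conj_intCast, h.conj_intCast_mul, h.conj_intCast_mul, tj] at h1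
  have h2 := congrArg (fun y => h.tr (x * y)) h1
  simp only [mul_sub, mul_neg, h.tr_sub, h.tr_neg, h.tr_mul_intCast_mul, h.mul_conj,
    ← Int.cast_comm, h.tr_intCast_mul, h.tr_intCast] at h2
  linarith

end Commuting

theorem exists_eq_of_sq_eq_neg_one {i : R} (hi : i * i = -1) (hcomm : ∀ x, i * x = x * i) (x : R) :
    ∃ a b : ℤ, x = a + b * i := by
  have hi' : i * i = -((1 : ℤ) : R) := by rw [hi, Int.cast_one]
  have h1 := h.expand_of_commuting one_pos hi' hcomm x
  have h2 := h.four_mul_nrm_of_commuting one_pos hi' hcomm x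
  generalize h.tr x = A at *
  generalize h.tr (x * i) = B at *
  have hA : A % 2 = 0 ∧ B % 2 = 0 := by
    rcases Int.even_or_odd' A with ⟨a, rfl | rfl⟩ <;> rcases Int.even_or_odd' B with ⟨b, rfl | rfl⟩ <;>
    ring_nf at h2 <;> omega
  obtain ⟨A, rfl⟩ : ∃ a', A = 2 * a' := ⟨A / 2, by omega⟩
  obtain ⟨B, rfl⟩ : ∃ a', B = 2 * a' := ⟨B / 2, by omega⟩
  refine ⟨A, -B, h.two_mul_cancel ?_⟩
  rw [mul_one, Int.cast_ofNat] at h1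
  rw [h1]
  push_cast
  noncomm_ring

theorem exists_eq_of_sq_eq_neg_three {j w : R} (hj : j * j = -3) (hw : 2 * w = 1 + j)
    (hcomm : ∀ x, j * x = x * j) (x : R) : ∃ a b : ℤ, x = a + b * w := by
  have hj' : j * j = -((3 : ℤ) : R) := by rw [hj, Int.cast_ofNat]
  have h1 := h.expand_of_commuting three_pos hj' hcomm x
  have h2 := h.four_mul_nrm_of_commuting three_pos hj' hcomm x
  have hw' : j = ((2 : ℤ) : R) * w - 1 := by rw [Int.cast_ofNat, hw]; abel
  have h3 : h.tr (x * j) = 2 * h.tr (x * w) - h.tr x := by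
    rw [hw', mul_sub, h.tr_sub, h.tr_mul_intCast_mul, mul_one]
  generalize h.tr x = A at *
  generalize h.tr (x * j) = C at *
  obtain ⟨⟨C, rfl⟩, -⟩ := three_dvd_of_sq_add_sq (c := C) (d := 0)
    (n := 4 * h.nrm x - A ^ 2) (by linarith)
  refine ⟨(A + C) / 2, -C, h.intCast_mul_cancel (n := 2 * 3) (by norm_num) ?_⟩
  have e1 : 2 * ((A + C) / 2) = A + C := by omega
  have e0 : ∀ n : ℤ, ((2 * 3 : ℤ) : R) * n = ((3 * (2 * n) : ℤ) : R) :=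
    fun n => by rw [← Int.cast_mul]; congr 1; ring
  have e5 : ∀ (n : ℤ) (y : R), ((2 * 3 : ℤ) : R) * (n * y) = ((3 * n : ℤ) : R) * (2 * y) :=
    fun n y => by
      rw [← mul_assoc, ← mul_assoc, ← Int.cast_ofNat (R := R) 2, ← Int.cast_mul, ← Int.cast_mul]
      congr 2; ring
  rw [h1, mul_add, e0, e1, e5, hw]
  push_cast
  noncomm_ring

end IsDefinite

end

/-! ### Classification by traces of units. -/

section

open scoped Quaternion

namespace IsDefinite

variable {R : Type*} [Ring R] {φ : R →+* ℍ[ℝ]} (h : IsDefinite φ)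

include h

/-- The norms of u - 1 and u + 1 are 2 - tr u and 2 + tr u, and both are positive. -/
theorem tr_eq_of_isUnit {u : R} (hu : IsUnit u) (h1 : u ≠ 1) (h2 : u ≠ -1) :
    h.tr u = -1 ∨ h.tr u = 0 ∨ h.tr u = 1 := by
  have hn := h.isUnit_iff.1 hu
  have e1 := h.nrm_sub u 1
  have e2 := h.nrm_sub u (-1)
  rw [h.conj_neg, h.conj_one, mul_neg, mul_one, h.tr_neg, h.nrm_neg, h.nrm_one, hn] at e2
  rw [h.conj_one, mul_one, h.nrm_one, hn] at e1
  have p1 : h.nrm (u - 1) ≠ 0 := fun hz => h1 (sub_eq_zero.1 (h.nrm_eq_zero.1 hz))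
  have p2 : h.nrm (u - -1) ≠ 0 := fun hz => h2 (sub_eq_zero.1 (h.nrm_eq_zero.1 hz))
  have := h.nrm_nonneg (u - 1)
  have := h.nrm_nonneg (u - -1)
  omega

theorem tr_eq_of_isUnit_of_ne {u v : R} (hu : IsUnit u) (huv : u * v ≠ v * u) :
    h.tr u = -1 ∨ h.tr u = 0 ∨ h.tr u = 1 :=
  h.tr_eq_of_isUnit hu (fun hh => huv (by simp [hh])) (fun hh => huv (by simp [hh]))

theorem mul_self_of_isUnit {u : R} (hu : IsUnit u) : u * u = h.tr u * u - 1 := by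
  rw [h.sq_eq, h.isUnit_iff.1 hu, Int.cast_one]

theorem mul_self_of_tr_eq_zero {u : R} (hu : IsUnit u) (ht : h.tr u = 0) : u * u = -1 := by
  rw [h.mul_self_of_isUnit hu, ht, Int.cast_zero, zero_mul, zero_sub]

theorem exists_sqrt_neg_three {w : R} (hw : IsUnit w) (ht : h.tr w = 1) :
    (2 * w - 1) * (2 * w - 1) = -3 ∧ h.tr (2 * w - 1) = 0 := by
  constructor
  · have h1 := h.mul_self_of_isUnit hw
    rw [ht, Int.cast_one, one_mul] at h1
    have : (2 * w - 1) * (2 * w - 1) = 4 * (w * w) - 4 * w + 1 := by noncomm_ring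
    rw [this, h1, mul_sub, mul_one, sub_right_comm, sub_self, zero_sub]
    norm_num
  · have := h.tr_intCast_mul 2 w
    rw [Int.cast_ofNat] at this
    rw [h.tr_sub, this, ht, h.tr_one]; rfl

theorem isQuaternionPair_one {i j : R} (hi : IsUnit i) (hj : IsUnit j) (ti : h.tr i = 0)
    (tj : h.tr j = 0) (tij : h.tr (i * j) = 0) : IsQuaternionPair 1 i j where
  i_mul_i := h.mul_self_of_tr_eq_zero hi ti
  j_mul_j := by rw [h.mul_self_of_tr_eq_zero hj tj, Int.cast_one]
  j_mul_i := h.anticomm_of_tr ti tj tij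

theorem isOrderThreeForm_of_tr {i w : R} (hi : IsUnit i) (hw : IsUnit w) (ti : h.tr i = 0)
    (tw : h.tr w = 1) (tiw : h.tr (i * w) = 0) : IsOrderThreeForm R := by
  obtain ⟨e1, e2⟩ := h.exists_sqrt_neg_three hw tw
  refine h.isOrderThreeForm (i := i) (j := 2 * w - 1) (w := w)
    ⟨h.mul_self_of_tr_eq_zero hi ti, by rw [e1, Int.cast_ofNat], h.anticomm_of_tr ti e2 ?_⟩ (by abel)
  have := h.tr_mul_intCast_mul 2 i w
  rw [Int.cast_ofNat] at this
  rw [mul_sub, mul_one, h.tr_sub, this, tiw, ti]; rfl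

/-- If tr(ab) = 0, then b and 2a - 1 form a pair of type 3. If tr(ab) = -1, then b and its conjugate
a b a⁻¹ anticommute, a pair of type 1. The remaining case follows by replacing b with -b. -/
theorem form_of_tr_one_zero {a b : R} (ha : IsUnit a) (hb : IsUnit b) (hab : a * b ≠ b * a)
    (ta : h.tr a = 1) (tb : h.tr b = 0) :
    IsLipschitzForm R ∨ IsHurwitzForm R ∨ IsOrderThreeForm R := by
  have key : ∀ b : R, IsUnit b → h.tr b = 0 → h.tr (a * b) = -1 →
      IsLipschitzForm R ∨ IsHurwitzForm R := by
    intro b hb tb tab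
    have hJ : IsUnit (a * b * h.conj a) := (ha.mul hb).mul (h.isUnit_conj ha)
    have tJ : h.tr (a * b * h.conj a) = 0 := by
      rw [h.tr_mul_comm, ← mul_assoc, h.conj_mul_of_isUnit ha, one_mul, tb]
    refine h.isLipschitzForm_or_isHurwitzForm (h.isQuaternionPair_one hb hJ tb tJ ?_)
    have h1 := h.unit_mul_mul_unit hb a
    rw [h.tr_mul_comm, tab, ta, sub_eq_iff_eq_add] at h1
    have h2 : h.tr (b * h.conj a) = 1 := by
      rw [conj, mul_sub, h.tr_sub, ta, Int.cast_one, mul_one, tb, h.tr_mul_comm, tab]; rfl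
    rw [← mul_assoc, ← mul_assoc, h1]
    simp only [add_mul, sub_mul, h.tr_add, h.tr_sub, mul_assoc (Int.cast _), h.tr_intCast_mul, h2,
      h.tr_conj, ta, h.mul_conj, h.isUnit_iff.1 ha, h.tr_intCast]
    norm_num
  have hne : a * b * b ≠ b * (a * b) := fun hh => hab (hb.mul_right_cancel (by rw [hh, mul_assoc]))
  rcases h.tr_eq_of_isUnit_of_ne (ha.mul hb) hne with t | t | t
  · rcases key b hb tb t with hf | hf
    · exact .inl hf
    · exact .inr (.inl hf)
  · exact .inr (.inr (h.isOrderThreeForm_of_tr hb ha tb ta (by rw [h.tr_mul_comm, t])))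
  · rcases key (-b) hb.neg (by rw [h.tr_neg, tb, neg_zero]) (by rw [mul_neg, h.tr_neg, t]) with hf | hf
    · exact .inl hf
    · exact .inr (.inl hf)

/-- Since tr(ab) + tr(a conj(b)) = 1 and both traces lie in {-1, 0, 1}, one of them is 0; a together
with that product falls under the previous case. -/
theorem form_of_tr_one_one {a b : R} (ha : IsUnit a) (hb : IsUnit b) (hab : a * b ≠ b * a)
    (ta : h.tr a = 1) (tb : h.tr b = 1) :
    IsLipschitzForm R ∨ IsHurwitzForm R ∨ IsOrderThreeForm R := by
  have key : ∀ b : R, IsUnit b → a * b ≠ b * a → h.tr (a * b) = 0 →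
      IsLipschitzForm R ∨ IsHurwitzForm R ∨ IsOrderThreeForm R := by
    intro b hb hab tab
    refine h.form_of_tr_one_zero ha (ha.mul hb) (fun hh => hab ?_) ta tab
    exact ha.mul_left_cancel (by rw [hh, mul_assoc])
  have hab' : a * h.conj b ≠ h.conj b * a := by
    intro hh
    rw [conj, mul_sub, sub_mul, Int.cast_comm] at hh
    exact hab (sub_right_injective hh)
  have tab' : h.tr (a * h.conj b) = 1 - h.tr (a * b) := by
    rw [conj, mul_sub, h.tr_sub, tb, Int.cast_one, mul_one, ta]
  have hne : a * b * b ≠ b * (a * b) := fun hh => hab (hb.mul_right_cancel (by rw [hh, mul_assoc]))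
  have hb' := h.isUnit_conj hb
  have hne' : a * h.conj b * h.conj b ≠ h.conj b * (a * h.conj b) :=
    fun hh => hab' (hb'.mul_right_cancel (by rw [hh, mul_assoc]))
  rcases h.tr_eq_of_isUnit_of_ne (ha.mul hb) hne with t | t | t
  · have := h.tr_eq_of_isUnit_of_ne (ha.mul hb') hne'
    omega
  · exact key b hb hab t
  · exact key _ hb' hab' (by omega)

theorem form_of_noncommuting {a b : R} (ha : IsUnit a) (hb : IsUnit b) (hab : a * b ≠ b * a) :
    IsLipschitzForm R ∨ IsHurwitzForm R ∨ IsOrderThreeForm R := by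
  have hneg : ∀ u : R, h.tr u = -1 → h.tr (-u) = 1 := fun u hu => by rw [h.tr_neg, hu]; rfl
  rcases h.tr_eq_of_isUnit_of_ne ha hab with s | s | s <;>
  rcases h.tr_eq_of_isUnit_of_ne hb hab.symm with t | t | t
  · exact h.form_of_tr_one_one ha.neg hb.neg (by simpa using hab) (hneg _ s) (hneg _ t)
  · exact h.form_of_tr_one_zero ha.neg hb (by simpa using hab) (hneg _ s) t
  · exact h.form_of_tr_one_one ha.neg hb (by simpa using hab) (hneg _ s) t
  · exact h.form_of_tr_one_zero hb.neg ha (by simpa using hab.symm) (hneg _ t) s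
  -- When both traces are 0, tr(a · ab) = -tr b = 0. So if tr(ab) = ±1, then a and ±ab are a trace 0
  -- unit and a trace 1 unit with traceless product.
  · have e : a * (a * b) = -b := by
      rw [← mul_assoc, h.mul_self_of_tr_eq_zero ha s, neg_one_mul]
    have hne : a * b * b ≠ b * (a * b) :=
      fun hh => hab (hb.mul_right_cancel (by rw [hh, mul_assoc]))
    rcases h.tr_eq_of_isUnit_of_ne (ha.mul hb) hne with p | p | p
    · refine .inr (.inr (h.isOrderThreeForm_of_tr ha (ha.mul hb).neg s (hneg _ p) ?_))
      rw [mul_neg, e, neg_neg, t]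
    · rcases h.isLipschitzForm_or_isHurwitzForm (h.isQuaternionPair_one ha hb s t p) with hf | hf
      · exact .inl hf
      · exact .inr (.inl hf)
    · refine .inr (.inr (h.isOrderThreeForm_of_tr ha (ha.mul hb) s p ?_))
      rw [e, h.tr_neg, t, neg_zero]
  · exact h.form_of_tr_one_zero hb ha hab.symm t s
  · exact h.form_of_tr_one_one ha hb.neg (by simpa using hab) s (hneg _ t)
  · exact h.form_of_tr_one_zero ha hb hab s t
  · exact h.form_of_tr_one_one ha hb hab s t

/-- Such an x equals its conjugate, so 2x = tr x and (tr x)² = 4 N(x), which makes the trace even.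
-/
theorem exists_intCast_of_zsmul {x : R} {n m : ℤ} (hn : n ≠ 0) (hx : (n : R) * x = m) :
    ∃ a : ℤ, x = a := by
  have h1 := congrArg h.conj hx
  rw [h.conj_intCast_mul, h.conj_intCast, ← hx] at h1
  have h2 := h.add_conj x
  rw [h.intCast_mul_cancel hn h1, ← two_mul] at h2
  have h3 := congrArg h.nrm h2
  have h4 := h.mul_conj x
  rw [h.intCast_mul_cancel hn h1] at h4
  have h5 : (4 * h.nrm x : ℤ) = h.tr x * h.tr x := by
    apply h.intCast_injective
    rw [Int.cast_mul, Int.cast_mul, ← h4, ← h2, Int.cast_ofNat]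
    noncomm_ring
  have h6 : h.tr x % 2 = 0 := by
    rcases Int.even_or_odd' (h.tr x) with ⟨a, ha | ha⟩
    · omega
    · rw [ha] at h5; ring_nf at h5; omega
  refine ⟨h.tr x / 2, h.two_mul_cancel ?_⟩
  have h7 : h.tr x = 2 * (h.tr x / 2) := by omega
  rw [h2, ← Int.cast_ofNat (R := R) 2, ← Int.cast_mul]
  exact congrArg Int.cast h7

theorem commute_of_unitSaturation_eq_top (htop : unitSaturation R = ⊤) {u : R}
    (hu : ∀ v : R, IsUnit v → u * v = v * u) (x : R) : u * x = x * u := by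
  obtain ⟨n, hn, hx⟩ : x ∈ unitSaturation R := htop ▸ trivial
  have key : ∀ y ∈ unitSpan R, u * y = y * u := by
    intro y hy
    induction hy using Submodule.span_induction with
    | mem y hy => exact hu y hy
    | zero => simp
    | add y z _ _ hy hz => rw [mul_add, add_mul, hy, hz]
    | smul m y _ hy => rw [mul_smul_comm, smul_mul_assoc, hy]
  have := key _ hx
  rw [zsmul_eq_mul, mul_assoc, ← mul_assoc u, ← Int.cast_comm, mul_assoc] at this
  exact h.intCast_mul_cancel hn this

theorem form_of_commuting (htop : unitSaturation R = ⊤)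
    (hcomm : ∀ x y : R, IsUnit x → IsUnit y → x * y = y * x) :
    (∀ x : R, ∃ a : ℤ, x = a) ∨ IsGaussForm R ∨ IsEisensteinForm R := by
  by_cases hU : ∀ u : R, IsUnit u → u = 1 ∨ u = -1
  · refine .inl fun x => ?_
    obtain ⟨n, hn, hx⟩ : x ∈ unitSaturation R := htop ▸ trivial
    have key : ∀ y ∈ unitSpan R, ∃ a : ℤ, y = a := by
      intro y hy
      induction hy using Submodule.span_induction with
      | mem y hy =>
        rcases hU y hy with rfl | rfl
        · exact ⟨1, by simp⟩
        · exact ⟨-1, by simp⟩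
      | zero => exact ⟨0, by simp⟩
      | add y z _ _ hy hz =>
        obtain ⟨a, rfl⟩ := hy
        obtain ⟨b, rfl⟩ := hz
        exact ⟨a + b, by simp⟩
      | smul m y _ hy =>
        obtain ⟨a, rfl⟩ := hy
        exact ⟨m * a, by simp⟩
    obtain ⟨a, ha⟩ := key _ hx
    exact h.exists_intCast_of_zsmul hn ((zsmul_eq_mul _ _).symm.trans ha)
  · push Not at hU
    obtain ⟨u, hu, h1, h2⟩ := hU
    right
    have hc : ∀ w : R, IsUnit w → ∀ x, w * x = x * w := fun w hw =>
      h.commute_of_unitSaturation_eq_top htop fun v hv => hcomm w v hw hv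
    have heis : ∀ w : R, IsUnit w → h.tr w = 1 → IsEisensteinForm R := fun w hw tw => by
      have hj := (h.exists_sqrt_neg_three hw tw).1
      have hw2 : 2 * w = 1 + (2 * w - 1) := by abel
      refine ⟨2 * w - 1, w, hj, hw2, h.exists_eq_of_sq_eq_neg_three hj hw2 fun x => ?_⟩
      rw [sub_mul, mul_sub, one_mul, mul_one, mul_assoc, hc w hw, ← mul_assoc,
        (Commute.ofNat_left 2 x).eq, mul_assoc]
    rcases h.tr_eq_of_isUnit hu h1 h2 with t | t | t
    · exact .inr (heis (-u) hu.neg (by rw [h.tr_neg, t]; rfl))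
    · exact .inl ⟨u, h.mul_self_of_tr_eq_zero hu t,
        h.exists_eq_of_sq_eq_neg_one (h.mul_self_of_tr_eq_zero hu t) (hc u hu)⟩
    · exact .inr (heis u hu t)

end IsDefinite

end

/-! ### Bases consisting of units. -/

section

open scoped Quaternion
open OrderElem

theorem exists_isZBasis_of_fin {R : Type*} [Ring R] {n : ℕ} {v : Fin n → R}
    (hv : LinearIndependent ℤ v) (hspan : ∀ x, x ∈ Submodule.span ℤ (Set.range v))
    (hunit : ∀ k, IsUnit (v k)) : ∃ B : Set R, IsZBasis B ∧ B ⊆ {x : R | IsUnit x} := by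
  refine ⟨Set.range v, ⟨hv.linearIndepOn_id, eq_top_iff.2 fun x _ => hspan x⟩, ?_⟩
  rintro _ ⟨k, rfl⟩
  exact hunit k

theorem isUnit_of_sq_eq_neg_one {R : Type*} [Ring R] {i : R} (hi : i * i = -1) : IsUnit i :=
  ⟨⟨i, -i, by rw [mul_neg, hi, neg_neg], by rw [neg_mul, hi, neg_neg]⟩, rfl⟩

namespace IsDefinite

section Basis

variable {R : Type*} [Ring R] {φ : R →+* ℍ[ℝ]} (h : IsDefinite φ)

include h

theorem isUnit_of_sqrt_neg_three {j w : R} (hj : j * j = -3) (hw : 2 * w = 1 + j) : IsUnit w := by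
  have h1 : w - w * w = 1 := by
    refine h.intCast_mul_cancel (n := 4) (by norm_num) ?_
    have : (4 : R) * (w - w * w) = 2 * (2 * w) - (2 * w) * (2 * w) := by noncomm_ring
    rw [Int.cast_ofNat, this, hw, mul_one]
    have : 2 * (1 + j) - (1 + j) * (1 + j) = 1 - j * j := by noncomm_ring
    rw [this, hj]
    norm_num
  exact ⟨⟨w, 1 - w, by rw [mul_sub, mul_one, h1], by rw [sub_mul, one_mul, h1]⟩, rfl⟩

theorem exists_basis_of_forall_intCast (hx : ∀ x : R, ∃ a : ℤ, x = a) :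
    ∃ B : Set R, IsZBasis B ∧ B ⊆ {x : R | IsUnit x} := by
  refine exists_isZBasis_of_fin (v := ![(1 : R)]) ?_ ?_ ?_
  · rw [Fintype.linearIndependent_iff]
    intro g hg k
    rw [Fin.sum_univ_one] at hg
    simp only [Matrix.cons_val_zero, zsmul_one] at hg
    fin_cases k
    exact h.intCast_injective (by rw [Int.cast_zero]; exact hg)
  · intro x
    obtain ⟨a, rfl⟩ := hx x
    rw [← zsmul_one]
    exact Submodule.smul_mem _ _ (Submodule.subset_span ⟨0, rfl⟩)
  · intro k
    fin_cases k
    exact isUnit_one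

/-- The relation mw = r + nj covers both quadratic cases: (m, r, n) = (1, 0, 1) for Gauss and (2, 1,
1) for Eisenstein. -/
theorem exists_basis_of_pair {q : ℤ} {j w : R} (hq : 0 < q) (hj : j * j = -(q : R))
    {m n : ℤ} (hn : n ≠ 0) (hm : m ≠ 0) {r : ℤ} (hw : (m : R) * w = r + n * j) (hu : IsUnit w)
    (hx : ∀ x : R, ∃ a b : ℤ, x = a + b * w) :
    ∃ B : Set R, IsZBasis B ∧ B ⊆ {x : R | IsUnit x} := by
  refine exists_isZBasis_of_fin (v := ![1, w]) ?_ ?_ ?_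
  · rw [Fintype.linearIndependent_iff]
    intro g hg
    rw [Fin.sum_univ_two] at hg
    simp only [Matrix.cons_val_zero, Matrix.cons_val_one, zsmul_eq_mul, mul_one] at hg
    have tj := h.tr_eq_zero_of_sq hq hj
    have h1 : ((m * g 0 + g 1 * r : ℤ) : R) + ((g 1 * n : ℤ) : R) * j = 0 := by
      have : (m : R) * (g 0 + g 1 * w) = m * g 0 + g 1 * (m * w) := by
        rw [mul_add, ← mul_assoc, Int.cast_comm m (g 1 : R), mul_assoc]
      rw [hg, mul_zero, hw] at this
      rw [this]
      push_cast
      noncomm_ring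
    have h2 := congrArg h.tr h1
    have t0 : h.tr 0 = 0 := by simpa using h.tr_intCast 0
    rw [h.tr_add, h.tr_intCast, h.tr_intCast_mul, tj, t0] at h2
    have h3 : m * g 0 + g 1 * r = 0 := by linarith
    rw [h3, Int.cast_zero, zero_add] at h1
    have h4 : g 1 = 0 := by
      rcases h.mul_eq_zero_imp h1 with h4 | h4
      · have h5 : g 1 * n = 0 := h.intCast_injective (by rw [h4, Int.cast_zero])
        exact (mul_eq_zero.1 h5).resolve_right hn
      · rw [h4, zero_mul, eq_comm, neg_eq_zero] at hj
        exact absurd (h.intCast_injective (by rw [hj, Int.cast_zero])) hq.ne'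
    rw [h4, zero_mul, add_zero] at h3
    intro k
    fin_cases k
    · exact (mul_eq_zero.1 h3).resolve_left hm
    · exact h4
  · intro x
    obtain ⟨a, b, rfl⟩ := hx x
    rw [← zsmul_one, ← zsmul_eq_mul]
    exact add_mem (Submodule.smul_mem _ _ (Submodule.subset_span ⟨0, rfl⟩))
      (Submodule.smul_mem _ _ (Submodule.subset_span ⟨1, rfl⟩))
  · intro k
    fin_cases k
    · exact isUnit_one
    · exact hu

omit h in
theorem exists_basis_of_quadruple {v : Fin 4 → R}
    (hv : ∀ a b c d : ℤ, a * v 0 + b * v 1 + c * v 2 + d * v 3 = 0 →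
      a = 0 ∧ b = 0 ∧ c = 0 ∧ d = 0) (hu : ∀ k, IsUnit (v k))
    (hx : ∀ x : R, ∃ a b c d : ℤ, x = a * v 0 + b * v 1 + c * v 2 + d * v 3) :
    ∃ B : Set R, IsZBasis B ∧ B ⊆ {x : R | IsUnit x} := by
  refine exists_isZBasis_of_fin (v := v) ?_ ?_ hu
  · rw [Fintype.linearIndependent_iff]
    intro g hg
    rw [Fin.sum_univ_four] at hg
    simp only [zsmul_eq_mul] at hg
    obtain ⟨h0, h1, h2, h3⟩ := hv _ _ _ _ hg
    intro k
    fin_cases k <;> assumption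
  · intro x
    obtain ⟨a, b, c, d, rfl⟩ := hx x
    simp only [← zsmul_eq_mul]
    exact add_mem (add_mem (add_mem (Submodule.smul_mem _ _ (Submodule.subset_span ⟨0, rfl⟩))
      (Submodule.smul_mem _ _ (Submodule.subset_span ⟨1, rfl⟩)))
      (Submodule.smul_mem _ _ (Submodule.subset_span ⟨2, rfl⟩)))
      (Submodule.smul_mem _ _ (Submodule.subset_span ⟨3, rfl⟩))

-- With this square root of -3, (1 + i + j + ij)/2 is a unit for the same reason as the Eisenstein
-- generator.
omit h in
theorem sq_i_add_j_add_k {i j : R} (hp : IsQuaternionPair 1 i j) :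
    (i + j + i * j) * (i + j + i * j) = -3 := by
  have e1 : i * j * i = j := by
    rw [mul_assoc, hp.j_mul_i, mul_neg, ← mul_assoc, hp.i_mul_i, neg_one_mul, neg_neg]
  have e2 : i * (i * j) = -j := by rw [← mul_assoc, hp.i_mul_i, neg_one_mul]
  have e3 : i * j * j = -i := by rw [mul_assoc, hp.j_mul_j, Int.cast_one, mul_neg_one]
  have e4 : j * (i * j) = i := by rw [← mul_assoc, hp.j_mul_i, neg_mul, e3, neg_neg]
  have e5 : j * j = -1 := by rw [hp.j_mul_j, Int.cast_one]
  have e6 : i * j * (i * j) = -1 := by rw [hp.k_mul_k, Int.cast_one]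
  simp only [add_mul, mul_add, hp.i_mul_i, hp.j_mul_i, e1, e2, e3, e4, e5, e6]
  have : (-3 : R) = -1 - 1 - 1 := by norm_num
  rw [this]
  abel

theorem exists_unit_basis (hR : (∀ x : R, ∃ a : ℤ, x = a) ∨ IsGaussForm R ∨ IsEisensteinForm R ∨
    IsLipschitzForm R ∨ IsHurwitzForm R ∨ IsOrderThreeForm R) :
    ∃ B : Set R, IsZBasis B ∧ B ⊆ {x : R | IsUnit x} := by
  have e2 : ∀ (d : ℤ) (y : R), 2 * ((d : R) * y) = d * (2 * y) := fun d y => by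
    rw [← mul_assoc, ← mul_assoc, (Commute.ofNat_left 2 (d : R)).eq]
  have e2' : ∀ (d : ℤ), 2 * (d : R) = ((2 * d : ℤ) : R) := fun d => by push_cast; rfl
  rcases hR with hx | ⟨i, hi, hx⟩ | ⟨j, w, hj, hw, hx⟩ | ⟨i, j, hp, hx⟩ | ⟨i, j, w, hp, hw, hx⟩ |
    ⟨i, j, w, hp, hw, hx⟩
  · exact h.exists_basis_of_forall_intCast hx
  · exact h.exists_basis_of_pair one_pos (by rw [hi, Int.cast_one]) (n := 1) (m := 1) one_ne_zero
      one_ne_zero (r := 0) (by simp) (isUnit_of_sq_eq_neg_one hi) hx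
  · exact h.exists_basis_of_pair three_pos (by rw [hj, Int.cast_ofNat]) (n := 1) (m := 2)
      one_ne_zero two_ne_zero (r := 1) (by simpa using hw) (h.isUnit_of_sqrt_neg_three hj hw) hx
  · refine exists_basis_of_quadruple (v := ![1, i, j, i * j]) ?_ ?_ ?_
    · intro a b c d h0
      exact h.coeff_eq_zero one_pos hp (by simpa using h0)
    · have hi := isUnit_of_sq_eq_neg_one hp.i_mul_i
      have hj := isUnit_of_sq_eq_neg_one (i := j) (by rw [hp.j_mul_j, Int.cast_one])
      intro k
      fin_cases k
      exacts [isUnit_one, hi, hj, hi.mul hj]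
    · simpa using hx
  · refine exists_basis_of_quadruple (v := ![1, i, j, w]) ?_ ?_ ?_
    · intro a b c d h0
      have h1 : (((2 * a + d : ℤ) : R) + ((2 * b + d : ℤ) : R) * i + ((2 * c + d : ℤ) : R) * j +
          (d : R) * (i * j)) = 0 := by
        have h2 : (2 : R) * (a + b * i + c * j + d * w) = 0 := by
          rw [← mul_zero (2 : R)]; congr 1; simpa using h0
        rw [mul_add, mul_add, mul_add, e2, e2, e2, hw] at h2
        rw [← h2]
        push_cast
        noncomm_ring
      obtain ⟨h2, h3, h4, h5⟩ := h.coeff_eq_zero one_pos hp h1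
      omega
    · have hi := isUnit_of_sq_eq_neg_one hp.i_mul_i
      have hj := isUnit_of_sq_eq_neg_one (i := j) (by rw [hp.j_mul_j, Int.cast_one])
      have hw' := h.isUnit_of_sqrt_neg_three (sq_i_add_j_add_k hp) (w := w) (by rw [hw]; abel)
      intro k
      fin_cases k
      exacts [isUnit_one, hi, hj, hw']
    · simpa using hx
  · refine exists_basis_of_quadruple (v := ![1, i, w, i * w]) ?_ ?_ ?_
    · intro a b c d h0
      have h1 : (((2 * a + c : ℤ) : R) + ((2 * b + d : ℤ) : R) * i + (c : R) * j +
          (d : R) * (i * j)) = 0 := by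
        have h2 : (2 : R) * (a + b * i + c * w + d * (i * w)) = 0 := by
          rw [← mul_zero (2 : R)]; congr 1; simpa using h0
        have h3 : 2 * (i * w) = i + i * j := by
          rw [← mul_assoc, (Commute.ofNat_left 2 i).eq, mul_assoc, hw, mul_add, mul_one]
        rw [mul_add, mul_add, mul_add, e2, e2, e2, hw, h3] at h2
        rw [← h2]
        push_cast
        noncomm_ring
      obtain ⟨h2, h3, h4, h5⟩ := h.coeff_eq_zero three_pos hp h1
      omega
    · have hi := isUnit_of_sq_eq_neg_one hp.i_mul_i
      have hw' := h.isUnit_of_sqrt_neg_three (j := j) (w := w)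
        (by rw [hp.j_mul_j, Int.cast_ofNat]) hw
      intro k
      fin_cases k
      exacts [isUnit_one, hi, hw', hi.mul hw']
    · simpa using hx

end Basis

end IsDefinite

end

/-! ### Isomorphisms with the standard quaternion orders, compared inside Hamilton's quaternions. -/

section

open scoped Quaternion
open OrderElem

/-- Two rings embedded with the same image are isomorphic. -/
theorem nonempty_ringEquiv_of_range {A B C : Type*} [Ring A] [Ring B] [Ring C] {f : A →+* C}
    {g : B →+* C} (hf : Function.Injective f) (hg : Function.Injective g)
    (hfg : ∀ x, ∃ y, g y = f x) (hgf : ∀ y, ∃ x, f x = g y) : Nonempty (A ≃+* B) := by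
  have hr : f.range = g.range := by
    ext z
    constructor
    · rintro ⟨x, rfl⟩; exact hfg x
    · rintro ⟨x, rfl⟩; exact hgf x
  let e₁ : A ≃+* f.range := RingEquiv.ofBijective f.rangeRestrict
    ⟨fun x y hxy => hf (congrArg Subtype.val hxy), f.rangeRestrict_surjective⟩
  let e₂ : B ≃+* g.range := RingEquiv.ofBijective g.rangeRestrict
    ⟨fun x y hxy => hg (congrArg Subtype.val hxy), g.rangeRestrict_surjective⟩
  exact ⟨(e₁.trans (RingEquiv.subringCongr hr)).trans e₂.symm⟩

section QuaternionModel

variable {q : ℚ}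

/-- The embedding of a rational quaternion algebra given by a pair of quaternions. -/
noncomputable def quaternionModel {I J : ℍ[ℝ]} (hI : I * I = -1) (hJ : J * J = q • (1 : ℍ[ℝ]))
    (hJI : J * I = -(I * J)) : RatQuaternion (-1) q →ₐ[ℚ] ℍ[ℝ] :=
  QuaternionAlgebra.Basis.liftHom
    { i := I
      j := J
      k := I * J
      i_mul_i := by rw [hI]; simp
      j_mul_j := hJ
      i_mul_j := rfl
      j_mul_i := by rw [hJI]; simp }

variable {I J : ℍ[ℝ]} (hI : I * I = -1) (hJ : J * J = q • (1 : ℍ[ℝ])) (hJI : J * I = -(I * J))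

theorem quaternionModel_mk (a b c d : ℚ) : quaternionModel hI hJ hJI ⟨a, b, c, d⟩ =
    a • 1 + b • I + c • J + d • (I * J) := by
  simp [quaternionModel, QuaternionAlgebra.Basis.lift]

/-- For q < 0 the norm form is positive definite, and an element of the kernel has norm zero. -/
theorem quaternionModel_injective (hq : q < 0) :
    Function.Injective (quaternionModel hI hJ hJI) := by
  rw [injective_iff_map_eq_zero]
  rintro ⟨a, b, c, d⟩ hz
  have h1 : (⟨a, b, c, d⟩ : RatQuaternion (-1) q) * ⟨a, -b, -c, -d⟩ =
      ⟨a ^ 2 + b ^ 2 - q * c ^ 2 - q * d ^ 2, 0, 0, 0⟩ := by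
    ext <;> simp <;> ring
  have h2 := congrArg (quaternionModel hI hJ hJI) h1
  rw [map_mul, hz, zero_mul, quaternionModel_mk, zero_smul, zero_smul, zero_smul, add_zero,
    add_zero, add_zero, eq_comm, smul_eq_zero_iff_left one_ne_zero] at h2
  have hc := mul_nonneg (neg_nonneg.2 hq.le) (sq_nonneg c)
  have hd := mul_nonneg (neg_nonneg.2 hq.le) (sq_nonneg d)
  have ha0 : a = 0 := pow_eq_zero_iff (two_ne_zero) |>.1 (by nlinarith [sq_nonneg a, sq_nonneg b])
  have hb0 : b = 0 := pow_eq_zero_iff (two_ne_zero) |>.1 (by nlinarith [sq_nonneg a, sq_nonneg b])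
  have hc0 : -q * c ^ 2 = 0 := by nlinarith [sq_nonneg a, sq_nonneg b]
  have hd0 : -q * d ^ 2 = 0 := by nlinarith [sq_nonneg a, sq_nonneg b]
  have hq' : -q ≠ 0 := neg_ne_zero.2 hq.ne
  have hc1 := pow_eq_zero_iff (two_ne_zero) |>.1 ((mul_eq_zero.1 hc0).resolve_left hq')
  have hd1 := pow_eq_zero_iff (two_ne_zero) |>.1 ((mul_eq_zero.1 hd0).resolve_left hq')
  subst ha0 hb0 hc1 hd1
  rfl

end QuaternionModel

namespace IsDefinite

variable {R : Type*} [Ring R] {φ : R →+* ℍ[ℝ]} (h : IsDefinite φ)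

theorem map_pair {q : ℤ} {i j : R} (hp : IsQuaternionPair q i j) (φ : R →+* ℍ[ℝ]) :
    φ i * φ i = -1 ∧ φ j * φ j = (-q : ℚ) • (1 : ℍ[ℝ]) ∧ φ j * φ i = -(φ i * φ j) := by
  refine ⟨?_, ?_, ?_⟩
  · rw [← map_mul, hp.i_mul_i, map_neg, map_one]
  · rw [← map_mul, hp.j_mul_j, map_neg, map_intCast, neg_smul]
    simp [Rat.smul_def]
  · rw [← map_mul, hp.j_mul_i, map_neg, map_mul]

include h

theorem nonempty_ringEquiv_int (hx : ∀ x : R, ∃ a : ℤ, x = a) : Nonempty (R ≃+* ℤ) :=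
  ⟨(RingEquiv.ofBijective (Int.castRingHom R)
    ⟨h.intCast_injective, fun x => (hx x).imp fun _ ha => ha.symm⟩).symm⟩

theorem nonempty_ringEquiv_lipschitz (hR : IsLipschitzForm R) : Nonempty (R ≃+* lipschitz) := by
  obtain ⟨i, j, hp, hx⟩ := hR
  obtain ⟨hI, hJ, hJI⟩ := map_pair hp φ
  norm_num at hJ
  have hJ' : φ j * φ j = (-1 : ℚ) • (1 : ℍ[ℝ]) := by rw [hJ]; simp
  have hval : ∀ a b c d : ℤ, quaternionModel hI hJ' hJI (a • (⟨1, 0, 0, 0⟩ : RatQuaternion (-1) (-1))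
      + b • (⟨0, 1, 0, 0⟩ : RatQuaternion (-1) (-1)) + c • (⟨0, 0, 1, 0⟩ : RatQuaternion (-1) (-1))
      + d • (⟨0, 0, 0, 1⟩ : RatQuaternion (-1) (-1))) = φ (a + b * i + c * j + d * (i * j)) := by
    intro a b c d
    rw [map_add, map_add, map_add, map_zsmul, map_zsmul, map_zsmul, map_zsmul]
    simp only [quaternionModel_mk]
    simp
  refine nonempty_ringEquiv_of_range (g := (quaternionModel hI hJ' hJI).toRingHom.comp
    lipschitz.subtype) h.injective ?_ ?_ ?_
  · exact (quaternionModel_injective hI hJ' hJI (by norm_num)).comp Subtype.val_injective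
  · intro x
    obtain ⟨a, b, c, d, rfl⟩ := hx x
    exact ⟨⟨_, a, b, c, d, rfl⟩, hval a b c d⟩
  · rintro ⟨_, a, b, c, d, rfl⟩
    exact ⟨_, (hval a b c d).symm⟩

theorem nonempty_ringEquiv_hurwitz (hR : IsHurwitzForm R) : Nonempty (R ≃+* hurwitz) := by
  obtain ⟨i, j, w, hp, hw, hx⟩ := hR
  obtain ⟨hI, hJ, hJI⟩ := map_pair hp φ
  norm_num at hJ
  have hJ' : φ j * φ j = (-1 : ℚ) • (1 : ℍ[ℝ]) := by rw [hJ]; simp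
  have hW : φ w = (1 / 2 : ℚ) • 1 + (1 / 2 : ℚ) • φ i + (1 / 2 : ℚ) • φ j +
      (1 / 2 : ℚ) • (φ i * φ j) := by
    have h2 := congrArg (fun y => (1 / 2 : ℚ) • φ y) hw
    simp only [two_mul, map_add, map_mul, map_one, smul_add] at h2
    rw [← h2]
    module
  have hval : ∀ a b c d : ℤ, quaternionModel hI hJ' hJI (a • (⟨1, 0, 0, 0⟩ : RatQuaternion (-1) (-1))
      + b • (⟨0, 1, 0, 0⟩ : RatQuaternion (-1) (-1)) + c • (⟨0, 0, 1, 0⟩ : RatQuaternion (-1) (-1))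
      + d • (⟨1 / 2, 1 / 2, 1 / 2, 1 / 2⟩ : RatQuaternion (-1) (-1))) =
      φ (a + b * i + c * j + d * w) := by
    intro a b c d
    rw [map_add, map_add, map_add, map_zsmul, map_zsmul, map_zsmul, map_zsmul]
    simp only [quaternionModel_mk, ← hW]
    simp
  refine nonempty_ringEquiv_of_range (g := (quaternionModel hI hJ' hJI).toRingHom.comp
    hurwitz.subtype) h.injective ?_ ?_ ?_
  · exact (quaternionModel_injective hI hJ' hJI (by norm_num)).comp Subtype.val_injective
  · intro x
    obtain ⟨a, b, c, d, rfl⟩ := hx x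
    exact ⟨⟨_, a, b, c, d, rfl⟩, hval a b c d⟩
  · rintro ⟨_, a, b, c, d, rfl⟩
    exact ⟨_, (hval a b c d).symm⟩

theorem nonempty_ringEquiv_orderThree (hR : IsOrderThreeForm R) :
    Nonempty (R ≃+* orderThree) := by
  obtain ⟨i, j, w, hp, hw, hx⟩ := hR
  obtain ⟨hI, hJ, hJI⟩ := map_pair hp φ
  have hJ' : φ j * φ j = (-3 : ℚ) • (1 : ℍ[ℝ]) := by rw [hJ]; norm_num
  have hW : φ w = (1 / 2 : ℚ) • 1 + (1 / 2 : ℚ) • φ j := by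
    have h2 := congrArg (fun y => (1 / 2 : ℚ) • φ y) hw
    simp only [two_mul, map_add, map_one, smul_add] at h2
    rw [← h2]
    module
  have hIW : φ i * φ w = (1 / 2 : ℚ) • φ i + (1 / 2 : ℚ) • (φ i * φ j) := by
    rw [hW, mul_add, mul_smul_comm, mul_smul_comm, mul_one]
  have hval : ∀ a b c d : ℤ, quaternionModel hI hJ' hJI (a • (⟨1, 0, 0, 0⟩ : RatQuaternion (-1) (-3))
      + b • (⟨0, 1, 0, 0⟩ : RatQuaternion (-1) (-3))
      + c • (⟨1 / 2, 0, 1 / 2, 0⟩ : RatQuaternion (-1) (-3))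
      + d • (⟨0, 1 / 2, 0, 1 / 2⟩ : RatQuaternion (-1) (-3))) =
      φ (a + b * i + c * w + d * (i * w)) := by
    intro a b c d
    rw [map_add, map_add, map_add, map_zsmul, map_zsmul, map_zsmul, map_zsmul]
    simp only [quaternionModel_mk, zero_smul, add_zero, zero_add, ← hW, ← hIW]
    simp
  refine nonempty_ringEquiv_of_range (g := (quaternionModel hI hJ' hJI).toRingHom.comp
    orderThree.subtype) h.injective ?_ ?_ ?_
  · exact (quaternionModel_injective hI hJ' hJI (by norm_num)).comp Subtype.val_injective
  · intro x
    obtain ⟨a, b, c, d, rfl⟩ := hx x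
    exact ⟨⟨_, a, b, c, d, rfl⟩, hval a b c d⟩
  · rintro ⟨_, a, b, c, d, rfl⟩
    exact ⟨_, (hval a b c d).symm⟩

end IsDefinite

end

/-! ### Imaginary quadratic integers of discriminant -4 and -3. -/

section

open scoped Quaternion QuadraticAlgebra
open OrderElem

section QuadraticModel

variable {d : ℕ}

/-- The embedding of an imaginary quadratic algebra given by a quaternion. -/
noncomputable def quadraticModel {J : ℍ[ℝ]} (hJ : J * J = -(d : ℍ[ℝ])) :
    QuadraticAlgebra ℚ (-(d : ℚ)) 0 →ₐ[ℚ] ℍ[ℝ] :=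
  QuadraticAlgebra.lift ⟨J, by rw [hJ]; simp [Rat.smul_def]⟩

variable {J : ℍ[ℝ]} (hJ : J * J = -(d : ℍ[ℝ]))

theorem quadraticModel_mk (a b : ℚ) :
    quadraticModel hJ ⟨a, b⟩ = a • (1 : ℍ[ℝ]) + b • J := by
  simp [quadraticModel]

theorem quadraticModel_injective (hd : 0 < d) : Function.Injective (quadraticModel hJ) := by
  rw [injective_iff_map_eq_zero]
  rintro ⟨a, b⟩ hz
  have h1 : (⟨a, b⟩ : QuadraticAlgebra ℚ (-(d : ℚ)) 0) * ⟨a, -b⟩ = ⟨a ^ 2 + d * b ^ 2, 0⟩ := by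
    ext <;> simp <;> ring
  have h2 := congrArg (quadraticModel hJ) h1
  rw [map_mul, hz, zero_mul, quadraticModel_mk, zero_smul, add_zero, eq_comm,
    smul_eq_zero_iff_left one_ne_zero] at h2
  have hd' : (0 : ℚ) < d := by exact_mod_cast hd
  have hb := mul_nonneg hd'.le (sq_nonneg b)
  have ha0 : a = 0 := pow_eq_zero_iff (two_ne_zero) |>.1 (by nlinarith [sq_nonneg a])
  have hb0 : (d : ℚ) * b ^ 2 = 0 := by nlinarith [sq_nonneg a]
  have hb1 := pow_eq_zero_iff (two_ne_zero) |>.1 ((mul_eq_zero.1 hb0).resolve_left hd'.ne')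
  subst ha0 hb1
  rfl

theorem exists_int_of_isIntegral_algebraMap {A : Type*} [Ring A] [Nontrivial A] [Algebra ℚ A]
    {r : ℚ} (hr : IsIntegral ℤ (algebraMap ℚ A r)) : ∃ n : ℤ, (n : ℚ) = r :=
  IsIntegrallyClosed.isIntegral_iff.1
    ((isIntegral_algHom_iff ((Algebra.ofId ℚ A).restrictScalars ℤ)
      (algebraMap ℚ A).injective).1 hr)

theorem isIntegral_star {z : QuadraticAlgebra ℚ (-(d : ℚ)) 0} (hz : IsIntegral ℤ z) :
    IsIntegral ℤ (star z) :=
  hz.map (starRingEnd (QuadraticAlgebra ℚ (-(d : ℚ)) 0)).toIntAlgHom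

/-- Makes the ring of integers itself definite, so that its integral basis comes from the coordinate
lemmas for a central square root. -/
theorem isDefinite_quadraticModel (hd : 0 < d) (hJs : star J = -J) :
    IsDefinite ((quadraticModel hJ).toRingHom.comp
      (integralClosure ℤ (QuadraticAlgebra ℚ (-(d : ℚ)) 0)).toSubring.subtype) := by
  have hstar : ∀ z, quadraticModel hJ (star z) = star (quadraticModel hJ z) := by
    rintro ⟨a, b⟩
    rw [QuadraticAlgebra.star_mk, quadraticModel_mk, quadraticModel_mk]
    simp [hJs]
  have hcast : ∀ n : ℤ, quadraticModel hJ (algebraMap ℚ _ (n : ℚ)) = n := by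
    intro n
    rw [AlgHom.commutes, map_intCast]
  refine ⟨(quadraticModel_injective hJ hd).comp Subtype.val_injective, ?_, ?_⟩
  · rintro ⟨z, hz⟩
    have h1 : IsIntegral ℤ (z + star z) := IsIntegral.add hz (isIntegral_star hz)
    rw [← QuadraticAlgebra.algebraMap_trace_eq_add_star] at h1
    obtain ⟨n, hn⟩ := exists_int_of_isIntegral_algebraMap h1
    refine ⟨n, ?_⟩
    change quadraticModel hJ z + star (quadraticModel hJ z) = n
    rw [← hstar, ← map_add, ← QuadraticAlgebra.algebraMap_trace_eq_add_star, ← hn, hcast]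
  · rintro ⟨z, hz⟩
    have h1 : IsIntegral ℤ (z * star z) := IsIntegral.mul hz (isIntegral_star hz)
    rw [← QuadraticAlgebra.algebraMap_norm_eq_mul_star] at h1
    obtain ⟨n, hn⟩ := exists_int_of_isIntegral_algebraMap h1
    refine ⟨n, ?_⟩
    change quadraticModel hJ z * star (quadraticModel hJ z) = n
    rw [← hstar, ← map_mul, ← QuadraticAlgebra.algebraMap_norm_eq_mul_star, ← hn, hcast]

theorem exists_quaternion_mul_self (d : ℕ) : ∃ J : ℍ[ℝ], J * J = -(d : ℍ[ℝ]) ∧ star J = -J := by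
  have hJ : (⟨0, √d, 0, 0⟩ : ℍ[ℝ]) * ⟨0, √d, 0, 0⟩ = -(d : ℍ[ℝ]) := by
    ext <;> simp
  exact ⟨_, hJ, Quaternion.star_eq_neg.2 rfl⟩

/-- The coordinates of i are part of the conclusion so that the generators obtained for different x
can be identified. -/
theorem gaussInteger_exists_eq (x : imagQuadIntegers 1) :
    ∃ i : imagQuadIntegers 1, (i : QuadraticAlgebra ℚ (-((1 : ℕ) : ℚ)) 0) = ⟨0, 1⟩ ∧ i * i = -1 ∧
      ∃ a b : ℤ, x = a + b * i := by
  obtain ⟨J, hJ, hJs⟩ := exists_quaternion_mul_self 1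
  have hω : (⟨0, 1⟩ : QuadraticAlgebra ℚ (-((1 : ℕ) : ℚ)) 0) * ⟨0, 1⟩ = -1 := by
    ext <;> simp
  have hi : IsIntegral ℤ (⟨0, 1⟩ : QuadraticAlgebra ℚ (-((1 : ℕ) : ℚ)) 0) := by
    refine IsIntegral.of_pow two_pos ?_
    rw [sq, hω]
    exact isIntegral_one.neg
  have hi' : (⟨_, hi⟩ : imagQuadIntegers 1) * ⟨_, hi⟩ = -1 := Subtype.ext hω
  refine ⟨⟨_, hi⟩, rfl, hi', ?_⟩
  exact (isDefinite_quadraticModel hJ one_pos hJs).exists_eq_of_sq_eq_neg_one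
    (i := (⟨_, hi⟩ : imagQuadIntegers 1)) hi' (fun y => mul_comm _ y) x

theorem eisensteinInteger_exists_eq (x : imagQuadIntegers 3) :
    ∃ w : imagQuadIntegers 3, (w : QuadraticAlgebra ℚ (-((3 : ℕ) : ℚ)) 0) = ⟨1 / 2, 1 / 2⟩ ∧
      IsUnit w ∧ ∃ a b : ℤ, x = a + b * w := by
  obtain ⟨J, hJ, hJs⟩ := exists_quaternion_mul_self 3
  have hj : (⟨0, 1⟩ : QuadraticAlgebra ℚ (-((3 : ℕ) : ℚ)) 0) * ⟨0, 1⟩ = -3 := by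
    ext <;> simp
  have hw2 : (⟨1 / 2, 1 / 2⟩ : QuadraticAlgebra ℚ (-((3 : ℕ) : ℚ)) 0) ^ 3 = -1 := by
    ext <;> simp [pow_succ] <;> norm_num
  have hw : IsIntegral ℤ (⟨1 / 2, 1 / 2⟩ : QuadraticAlgebra ℚ (-((3 : ℕ) : ℚ)) 0) := by
    refine IsIntegral.of_pow three_pos ?_
    rw [hw2]
    exact isIntegral_one.neg
  have hjw : 2 * (⟨1 / 2, 1 / 2⟩ : QuadraticAlgebra ℚ (-((3 : ℕ) : ℚ)) 0) = 1 + ⟨0, 1⟩ := by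
    ext <;> simp
  set w : imagQuadIntegers 3 := ⟨_, hw⟩ with hwdef
  have hj' : (2 * w - 1) * (2 * w - 1) = -3 := by
    refine Subtype.ext ?_
    change (2 * (⟨1 / 2, 1 / 2⟩ : QuadraticAlgebra ℚ (-((3 : ℕ) : ℚ)) 0) - 1) *
      (2 * ⟨1 / 2, 1 / 2⟩ - 1) = -3
    rw [hjw, add_sub_cancel_left, hj]
  have hdef := isDefinite_quadraticModel hJ three_pos hJs
  refine ⟨w, rfl, hdef.isUnit_of_sqrt_neg_three (j := 2 * w - 1) (w := w) hj' (by ring), ?_⟩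
  exact hdef.exists_eq_of_sq_eq_neg_three (j := 2 * w - 1) (w := w) hj' (by ring)
    (fun y => mul_comm _ y) x

end QuadraticModel

namespace IsDefinite

variable {R : Type*} [Ring R] {φ : R →+* ℍ[ℝ]} (h : IsDefinite φ)
include h

theorem nonempty_ringEquiv_gauss (hR : IsGaussForm R) : Nonempty (R ≃+* imagQuadIntegers 1) := by
  obtain ⟨i, hi, hx⟩ := hR
  have hJ : φ i * φ i = -((1 : ℕ) : ℍ[ℝ]) := by rw [← map_mul, hi]; simp
  obtain ⟨i₀, hi₀, -⟩ := gaussInteger_exists_eq 0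
  let g := (quadraticModel hJ).toRingHom.comp
    (integralClosure ℤ (QuadraticAlgebra ℚ (-((1 : ℕ) : ℚ)) 0)).toSubring.subtype
  have hval : ∀ a b : ℤ, g ((a : imagQuadIntegers 1) + b * i₀ : imagQuadIntegers 1) =
      φ (a + b * i) := by
    have hgi : g i₀ = φ i := by
      change quadraticModel hJ i₀ = _
      rw [hi₀, quadraticModel_mk]
      simp
    intro a b
    rw [map_add, map_mul, hgi, map_add, map_mul]
    simp only [map_intCast]
  refine nonempty_ringEquiv_of_range (g := g) h.injective ?_ ?_ ?_
  · exact (quadraticModel_injective hJ one_pos).comp Subtype.val_injective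
  · intro x
    obtain ⟨a, b, rfl⟩ := hx x
    exact ⟨_, hval a b⟩
  · intro y
    obtain ⟨i₁, hi₁, -, a, b, rfl⟩ := gaussInteger_exists_eq y
    obtain rfl : i₁ = i₀ := Subtype.ext (hi₁.trans hi₀.symm)
    exact ⟨_, (hval a b).symm⟩

theorem nonempty_ringEquiv_eisenstein (hR : IsEisensteinForm R) :
    Nonempty (R ≃+* imagQuadIntegers 3) := by
  obtain ⟨j, w, hj, hw, hx⟩ := hR
  have hJ : φ j * φ j = -((3 : ℕ) : ℍ[ℝ]) := by rw [← map_mul, hj, map_neg, map_ofNat]; rfl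
  have hW : φ w = (1 / 2 : ℚ) • 1 + (1 / 2 : ℚ) • φ j := by
    have h2 := congrArg (fun y => (1 / 2 : ℚ) • φ y) hw
    simp only [two_mul, map_add, map_one, smul_add] at h2
    rw [← h2]
    module
  obtain ⟨w₀, hw₀, -⟩ := eisensteinInteger_exists_eq 0
  let g := (quadraticModel hJ).toRingHom.comp
    (integralClosure ℤ (QuadraticAlgebra ℚ (-((3 : ℕ) : ℚ)) 0)).toSubring.subtype
  have hval : ∀ a b : ℤ, g ((a : imagQuadIntegers 3) + b * w₀ : imagQuadIntegers 3) =
      φ (a + b * w) := by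
    have hgi : g w₀ = φ w := by
      change quadraticModel hJ w₀ = _
      rw [hw₀, quadraticModel_mk, hW]
    intro a b
    rw [map_add, map_mul, hgi, map_add, map_mul]
    simp only [map_intCast]
  refine nonempty_ringEquiv_of_range (g := g) h.injective ?_ ?_ ?_
  · exact (quadraticModel_injective hJ three_pos).comp Subtype.val_injective
  · intro x
    obtain ⟨a, b, rfl⟩ := hx x
    exact ⟨_, hval a b⟩
  · intro y
    obtain ⟨w₁, hw₁, -, a, b, rfl⟩ := eisensteinInteger_exists_eq y
    obtain rfl : w₁ = w₀ := Subtype.ext (hw₁.trans hw₀.symm)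
    exact ⟨_, (hval a b).symm⟩

end IsDefinite

end

/-! ### The rings of the list are spanned by their units. -/

section

open OrderElem

theorem unitSpan_eq_top_of_ringEquiv {R S : Type*} [Ring R] [Ring S] (e : R ≃+* S)
    (hS : ∀ x : S, x ∈ unitSpan S) (x : R) : x ∈ unitSpan R := by
  have key : ∀ y ∈ unitSpan S, e.symm y ∈ unitSpan R := by
    intro y hy
    induction hy using Submodule.span_induction with
    | mem y hy => exact (IsUnit.map e.symm hy).mem_unitSpan
    | zero => rw [map_zero]; exact zero_mem _
    | add y z _ _ hy hz => rw [map_add]; exact add_mem hy hz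
    | smul m y _ hy => rw [map_zsmul]; exact zsmul_mem hy m
  simpa using key _ (hS (e x))

theorem int_mem_unitSpan (x : ℤ) : x ∈ unitSpan ℤ := intCast_mem _ x

theorem imagQuadIntegers_one_mem_unitSpan (x : imagQuadIntegers 1) : x ∈ unitSpan _ := by
  obtain ⟨i, -, hi, a, b, rfl⟩ := gaussInteger_exists_eq x
  exact add_mem (intCast_mem _ _) (mul_mem (intCast_mem _ _)
    (isUnit_of_sq_eq_neg_one hi).mem_unitSpan)

theorem imagQuadIntegers_three_mem_unitSpan (x : imagQuadIntegers 3) : x ∈ unitSpan _ := by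
  obtain ⟨w, -, hw, a, b, rfl⟩ := eisensteinInteger_exists_eq x
  exact add_mem (intCast_mem _ _) (mul_mem (intCast_mem _ _) hw.mem_unitSpan)

theorem mem_unitSpan_of_four {A : Type*} [Ring A] {S : Subring A} {v : Fin 4 → A}
    (hv : ∀ k, ∃ u : S, (u : A) = v k ∧ IsUnit u)
    (hS : ∀ x ∈ S, ∃ a b c d : ℤ, x = a • v 0 + b • v 1 + c • v 2 + d • v 3) (x : S) :
    x ∈ unitSpan S := by
  choose u hu hunit using hv
  obtain ⟨a, b, c, d, hx⟩ := hS x x.2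
  have : x = a • u 0 + b • u 1 + c • u 2 + d • u 3 := by
    refine Subtype.ext ?_
    rw [hx, ← hu, ← hu, ← hu, ← hu]
    rfl
  rw [this]
  exact add_mem (add_mem (add_mem (zsmul_mem (hunit 0).mem_unitSpan _)
    (zsmul_mem (hunit 1).mem_unitSpan _)) (zsmul_mem (hunit 2).mem_unitSpan _))
    (zsmul_mem (hunit 3).mem_unitSpan _)

theorem exists_unit_of_mul_eq_one {A : Type*} [Ring A] {S : Subring A} {x y : A} (hx : x ∈ S)
    (hy : y ∈ S) (hxy : x * y = 1) (hyx : y * x = 1) : ∃ u : S, (u : A) = x ∧ IsUnit u :=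
  ⟨⟨x, hx⟩, rfl, ⟨⟨⟨x, hx⟩, ⟨y, hy⟩, Subtype.ext hxy, Subtype.ext hyx⟩, rfl⟩⟩

theorem exists_unit_of_sq_eq_neg_one {A : Type*} [Ring A] {S : Subring A} {x : A} (hx : x ∈ S)
    (hsq : x * x = -1) : ∃ u : S, (u : A) = x ∧ IsUnit u :=
  exists_unit_of_mul_eq_one hx (neg_mem hx) (by rw [mul_neg, hsq, neg_neg])
    (by rw [neg_mul, hsq, neg_neg])

theorem exists_unit_of_sq_eq_sub_one {A : Type*} [Ring A] {S : Subring A} {x : A} (hx : x ∈ S)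
    (hsq : x * x = x - 1) : ∃ u : S, (u : A) = x ∧ IsUnit u :=
  exists_unit_of_mul_eq_one hx (sub_mem (one_mem S) hx) (by rw [mul_sub, hsq]; noncomm_ring)
    (by rw [sub_mul, hsq]; noncomm_ring)

theorem lipschitz_mem_unitSpan (x : lipschitz) : x ∈ unitSpan lipschitz := by
  refine mem_unitSpan_of_four (v := ![⟨1, 0, 0, 0⟩, ⟨0, 1, 0, 0⟩, ⟨0, 0, 1, 0⟩, ⟨0, 0, 0, 1⟩]) ?_
    (fun x hx => hx) x
  intro k
  fin_cases k
  · exact ⟨1, rfl, isUnit_one⟩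
  · exact exists_unit_of_sq_eq_neg_one (S := lipschitz)
      (x := (⟨0, 1, 0, 0⟩ : RatQuaternion (-1) (-1))) ⟨0, 1, 0, 0, by simp⟩ (by ext <;> simp)
  · exact exists_unit_of_sq_eq_neg_one (S := lipschitz)
      (x := (⟨0, 0, 1, 0⟩ : RatQuaternion (-1) (-1))) ⟨0, 0, 1, 0, by simp⟩ (by ext <;> simp)
  · exact exists_unit_of_sq_eq_neg_one (S := lipschitz)
      (x := (⟨0, 0, 0, 1⟩ : RatQuaternion (-1) (-1))) ⟨0, 0, 0, 1, by simp⟩ (by ext <;> simp)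

theorem hurwitz_mem_unitSpan (x : hurwitz) : x ∈ unitSpan hurwitz := by
  refine mem_unitSpan_of_four
    (v := ![⟨1, 0, 0, 0⟩, ⟨0, 1, 0, 0⟩, ⟨0, 0, 1, 0⟩, ⟨1 / 2, 1 / 2, 1 / 2, 1 / 2⟩]) ?_
    (fun x hx => hx) x
  intro k
  fin_cases k
  · exact ⟨1, rfl, isUnit_one⟩
  · exact exists_unit_of_sq_eq_neg_one (S := hurwitz)
      (x := (⟨0, 1, 0, 0⟩ : RatQuaternion (-1) (-1))) ⟨0, 1, 0, 0, by simp⟩ (by ext <;> simp)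
  · exact exists_unit_of_sq_eq_neg_one (S := hurwitz)
      (x := (⟨0, 0, 1, 0⟩ : RatQuaternion (-1) (-1))) ⟨0, 0, 1, 0, by simp⟩ (by ext <;> simp)
  · exact exists_unit_of_sq_eq_sub_one (S := hurwitz)
      (x := (⟨1 / 2, 1 / 2, 1 / 2, 1 / 2⟩ : RatQuaternion (-1) (-1))) ⟨0, 0, 0, 1, by simp⟩
      (by ext <;> simp <;> norm_num)

theorem orderThree_mem_unitSpan (x : orderThree) : x ∈ unitSpan orderThree := by
  refine mem_unitSpan_of_four
    (v := ![⟨1, 0, 0, 0⟩, ⟨0, 1, 0, 0⟩, ⟨1 / 2, 0, 1 / 2, 0⟩, ⟨0, 1 / 2, 0, 1 / 2⟩]) ?_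
    (fun x hx => hx) x
  intro k
  fin_cases k
  · exact ⟨1, rfl, isUnit_one⟩
  · exact exists_unit_of_sq_eq_neg_one (S := orderThree)
      (x := (⟨0, 1, 0, 0⟩ : RatQuaternion (-1) (-3))) ⟨0, 1, 0, 0, by simp⟩ (by ext <;> simp)
  · exact exists_unit_of_sq_eq_sub_one (S := orderThree)
      (x := (⟨1 / 2, 0, 1 / 2, 0⟩ : RatQuaternion (-1) (-3))) ⟨0, 0, 1, 0, by simp⟩
      (by ext <;> simp <;> norm_num)
  · exact exists_unit_of_sq_eq_neg_one (S := orderThree)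
      (x := (⟨0, 1 / 2, 0, 1 / 2⟩ : RatQuaternion (-1) (-3))) ⟨0, 0, 0, 1, by simp⟩
      (by ext <;> simp <;> norm_num)

end

/-! ### Finiteness of the unit group and Dirichlet's theorem. -/

section

open Polynomial OrderElem
open scoped NumberField

section Lattice

variable {A : Type*} [Ring A] [Algebra ℚ A] {O : Subring A}

theorem OrderElem.IsZOrder.exists_zsmul_mem (hO : IsZOrder O) (y : A) :
    ∃ n : ℤ, n ≠ 0 ∧ n • y ∈ O := by
  obtain ⟨B, hB, -, hspan⟩ := hO.contains_basis
  have hy : y ∈ Submodule.span ℚ B := hspan ▸ trivial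
  induction hy using Submodule.span_induction with
  | mem y hy => exact ⟨1, one_ne_zero, by rw [one_smul]; exact hB hy⟩
  | zero => exact ⟨1, one_ne_zero, by rw [smul_zero]; exact zero_mem O⟩
  | add y z _ _ hy hz =>
    obtain ⟨n, hn, hy⟩ := hy
    obtain ⟨m, hm, hz⟩ := hz
    refine ⟨n * m, mul_ne_zero hn hm, ?_⟩
    have : (n * m) • (y + z) = m • n • y + n • m • z := by module
    rw [this]
    exact add_mem (zsmul_mem hy _) (zsmul_mem hz _)
  | smul r y _ hy =>
    obtain ⟨n, hn, hy⟩ := hy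
    refine ⟨r.den * n, mul_ne_zero (by exact_mod_cast r.den_ne_zero) hn, ?_⟩
    have : ((r.den : ℤ) * n) • r • y = r.num • n • y := by
      have hr : ((r.den : ℤ) : ℚ) * r = r.num := by rw [mul_comm]; exact_mod_cast r.mul_den_eq_num
      rw [← Int.cast_smul_eq_zsmul ℚ, smul_smul, Int.cast_mul, mul_right_comm, hr, mul_smul,
        Int.cast_smul_eq_zsmul, Int.cast_smul_eq_zsmul]
    rw [this]
    exact zsmul_mem hy _

theorem OrderElem.IsZOrder.exists_zsmul_map_mem (hO : IsZOrder O) {M : Type*} [AddCommGroup M]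
    [Module.Finite ℤ M] (f : M →+ A) : ∃ n : ℤ, n ≠ 0 ∧ ∀ m, n • f m ∈ O := by
  have key : ∀ N : Submodule ℤ M, N.FG → ∃ n : ℤ, n ≠ 0 ∧ ∀ m ∈ N, n • f m ∈ O := by
    intro N hN
    induction N, hN using Submodule.fg_induction with
    | singleton x =>
      obtain ⟨n, hn, hx⟩ := hO.exists_zsmul_mem (f x)
      refine ⟨n, hn, fun m hm => ?_⟩
      obtain ⟨c, rfl⟩ := Submodule.mem_span_singleton.1 hm
      rw [map_zsmul, smul_comm]
      exact zsmul_mem hx c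
    | sup N₁ N₂ _ _ h₁ h₂ =>
      obtain ⟨n₁, hn₁, h₁⟩ := h₁
      obtain ⟨n₂, hn₂, h₂⟩ := h₂
      refine ⟨n₁ * n₂, mul_ne_zero hn₁ hn₂, fun m hm => ?_⟩
      obtain ⟨y, hy, z, hz, rfl⟩ := Submodule.mem_sup.1 hm
      have : (n₁ * n₂) • f (y + z) = n₂ • n₁ • f y + n₁ • n₂ • f z := by rw [map_add]; module
      rw [this]
      exact add_mem (zsmul_mem (h₁ y hy) _) (zsmul_mem (h₂ z hz) _)
  obtain ⟨n, hn, h⟩ := key ⊤ Module.Finite.fg_top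
  exact ⟨n, hn, fun m => h m trivial⟩

end Lattice

theorem exists_pow_sub_one_mem_span {K : Type*} [Field K] [NumberField K] {n : ℤ} (hn : n ≠ 0)
    (u : (𝓞 K)ˣ) : ∃ k : ℕ, 0 < k ∧ (n : 𝓞 K) ∣ (u : 𝓞 K) ^ k - 1 := by
  have hI : Ideal.span {(n : 𝓞 K)} ≠ ⊥ := by
    rw [Ne, Ideal.span_singleton_eq_bot]
    exact_mod_cast hn
  have : Finite (𝓞 K ⧸ Ideal.span {(n : 𝓞 K)}) := Ideal.finiteQuotientOfFreeOfNeBot _ hI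
  have hfin := isOfFinOrder_of_finite (Units.map (Ideal.Quotient.mk (Ideal.span {(n : 𝓞 K)})).toMonoidHom u)
  obtain ⟨k, hk, h1⟩ := isOfFinOrder_iff_pow_eq_one.1 hfin
  refine ⟨k, hk, ?_⟩
  rw [← Ideal.mem_span_singleton, ← Ideal.Quotient.eq_zero_iff_mem, map_sub, map_pow, map_one,
    sub_eq_zero]
  exact congrArg Units.val h1

section DivisionRing

variable {D : Type*} [DivisionRing D] [Algebra ℚ D] {O : Subring D}

/-- Some n ≠ 0 satisfies n·g(𝓞 K) ⊆ O. A power of u is 1 modulo n, and so is its inverse; both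
therefore land in O and give an element of the finite group of units. -/
theorem OrderElem.IsZOrder.exists_pow_eq_one (hO : IsZOrder O) (hU : Finite Oˣ) {K : Type*} [Field K]
    [NumberField K] (f : K →+* D) (u : (𝓞 K)ˣ) : ∃ k : ℕ, 0 < k ∧ u ^ k = 1 := by
  let g : 𝓞 K →+* D := f.comp (algebraMap (𝓞 K) K)
  have hg : Function.Injective g :=
    f.injective.comp (FaithfulSMul.algebraMap_injective (𝓞 K) K)
  obtain ⟨n, hn, hmem⟩ := hO.exists_zsmul_map_mem g.toAddMonoidHom
  have hpow : ∀ v : (𝓞 K)ˣ, ∀ y : 𝓞 K, (v : 𝓞 K) - 1 = n * y → g v ∈ O := by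
    intro v y hy
    rw [sub_eq_iff_eq_add] at hy
    rw [hy, map_add, map_one, map_mul, map_intCast, ← zsmul_eq_mul]
    exact add_mem (hmem y) (one_mem O)
  obtain ⟨k, hk, y, hy⟩ := exists_pow_sub_one_mem_span hn u
  have h1 : g ((u ^ k : (𝓞 K)ˣ) : 𝓞 K) ∈ O := hpow (u ^ k) y (by rw [Units.val_pow_eq_pow_val, hy])
  have h2 : g (((u ^ k)⁻¹ : (𝓞 K)ˣ) : 𝓞 K) ∈ O := by
    refine hpow (u ^ k)⁻¹ (-(((u ^ k)⁻¹ : (𝓞 K)ˣ) : 𝓞 K) * y) ?_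
    have h3 : (n : 𝓞 K) * (-(((u ^ k)⁻¹ : (𝓞 K)ˣ) : 𝓞 K) * y) =
      -(((u ^ k)⁻¹ : (𝓞 K)ˣ) : 𝓞 K) * (n * y) := by ring
    rw [h3, ← hy, ← Units.val_pow_eq_pow_val, mul_sub, neg_mul, Units.inv_mul]
    ring
  let v : Oˣ := ⟨⟨_, h1⟩, ⟨_, h2⟩, Subtype.ext (by
    change g _ * g _ = 1
    rw [← map_mul, Units.mul_inv, map_one]), Subtype.ext (by
    change g _ * g _ = 1
    rw [← map_mul, Units.inv_mul, map_one])⟩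
  obtain ⟨m, hm, hv⟩ := isOfFinOrder_iff_pow_eq_one.1 (isOfFinOrder_of_finite v)
  refine ⟨k * m, Nat.mul_pos hk hm, Units.ext (hg ?_)⟩
  have h4 := congrArg (fun w : Oˣ => ((w : O) : D)) hv
  rw [pow_mul, Units.val_pow_eq_pow_val, map_pow]
  simpa [v] using h4

theorem NumberField.card_infinitePlace_le_one {K : Type*} [Field K] [NumberField K]
    (hK : ∀ u : (𝓞 K)ˣ, ∃ k : ℕ, 0 < k ∧ u ^ k = 1) :
    Fintype.card (NumberField.InfinitePlace K) ≤ 1 := by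
  have h1 := NumberField.Units.finrank_eq K
  have h2 : Module.finrank ℤ (Additive (𝓞 K)ˣ) = 0 := by
    rw [Module.finrank, rank_eq_zero_iff.2, map_zero]
    intro x
    obtain ⟨k, hk, hx⟩ := hK x.toMul
    refine ⟨k, by exact_mod_cast hk.ne', ?_⟩
    rw [natCast_zsmul]
    exact hx
  rw [h2, NumberField.Units.rank] at h1
  omega

/-- The field ℚ(x) has a single infinite place, hence degree at most 2. In degree 2 that place is
complex; a nonnegative discriminant would give a real root of the minimal polynomial and so a real
place. -/
theorem OrderElem.IsZOrder.quadratic [FiniteDimensional ℚ D] (hO : IsZOrder O) (hU : Finite Oˣ)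
    (x : D) : x ∈ (algebraMap ℚ D).range ∨
      ∃ t n : ℚ, minpoly ℚ x = X ^ 2 - C t * X + C n ∧ t ^ 2 < 4 * n := by
  have hx : IsIntegral ℚ x := Algebra.IsIntegral.isIntegral x
  have hirr := minpoly.irreducible hx
  have : Fact (Irreducible (minpoly ℚ x)) := ⟨hirr⟩
  have : FiniteDimensional ℚ (AdjoinRoot (minpoly ℚ x)) :=
    (AdjoinRoot.powerBasis hirr.ne_zero).finite
  have : NumberField (AdjoinRoot (minpoly ℚ x)) := ⟨⟩
  let f : AdjoinRoot (minpoly ℚ x) →+* D :=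
    Ideal.Quotient.lift _ (aeval x : ℚ[X] →ₐ[ℚ] D).toRingHom (by
      intro p hp
      obtain ⟨r, rfl⟩ := Ideal.mem_span_singleton.1 hp
      change aeval x (minpoly ℚ x * r) = 0
      rw [map_mul, minpoly.aeval, zero_mul])
  have hcard := NumberField.card_infinitePlace_le_one (hO.exists_pow_eq_one hU f)
  have hsum := NumberField.InfinitePlace.card_add_two_mul_card_eq_rank (AdjoinRoot (minpoly ℚ x))
  rw [NumberField.InfinitePlace.card_eq_nrRealPlaces_add_nrComplexPlaces] at hcard
  rw [(AdjoinRoot.powerBasis hirr.ne_zero).finrank, AdjoinRoot.powerBasis_dim] at hsum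
  have hpos := minpoly.natDegree_pos hx
  have hmonic := minpoly.monic hx
  by_cases hdeg : (minpoly ℚ x).natDegree = 1
  · exact .inl (minpoly.natDegree_eq_one_iff.1 hdeg)
  · right
    have hdeg2 : (minpoly ℚ x).natDegree = 2 := by omega
    have hreal : NumberField.InfinitePlace.nrRealPlaces (AdjoinRoot (minpoly ℚ x)) = 0 := by omega
    have hform : minpoly ℚ x = X ^ 2 - C (-(minpoly ℚ x).coeff 1) * X + C ((minpoly ℚ x).coeff 0) := by
      conv_lhs => rw [hmonic.as_sum, hdeg2]
      simp [Finset.sum_range_succ]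
      ring
    refine ⟨_, _, hform, ?_⟩
    by_contra! hdisc
    set b := (minpoly ℚ x).coeff 1
    set c := (minpoly ℚ x).coeff 0
    have hdisc' : (0 : ℝ) ≤ b ^ 2 - 4 * c := by
      have : (0 : ℚ) ≤ b ^ 2 - 4 * c := by linarith
      exact_mod_cast this
    have hroot : (minpoly ℚ x).eval₂ (algebraMap ℚ ℝ) ((-b + √(b ^ 2 - 4 * c)) / 2) = 0 := by
      rw [hform]
      simp only [eval₂_add, eval₂_sub, eval₂_pow, eval₂_mul, eval₂_X, eval₂_C, eq_ratCast,
        Rat.cast_neg]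
      have := Real.sq_sqrt hdisc'
      linear_combination (1 / 4 : ℝ) * this
    let ψ : AdjoinRoot (minpoly ℚ x) →+* ℝ := AdjoinRoot.lift (algebraMap ℚ ℝ) _ hroot
    have hψ : NumberField.ComplexEmbedding.IsReal (Complex.ofRealHom.comp ψ) := by
      refine RingHom.ext fun y => ?_
      rw [NumberField.ComplexEmbedding.conjugate_coe_eq]
      exact Complex.conj_ofReal _
    have := NumberField.InfinitePlace.isReal_mk_iff.2 hψ
    have hne : 0 < NumberField.InfinitePlace.nrRealPlaces (AdjoinRoot (minpoly ℚ x)) := by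
      classical
      unfold NumberField.InfinitePlace.nrRealPlaces
      exact @Fintype.card_pos _ _ ⟨⟨_, this⟩⟩
    omega

end DivisionRing

end

/-! ### Pure elements form a rational subspace. -/

section

open Polynomial OrderElem
open scoped Quaternion

section Frobenius

variable {D : Type*} [DivisionRing D] [Algebra ℚ D]

/-- The element has a nonpositive rational square. -/
def IsPure (x : D) : Prop := ∃ r : ℚ, 0 ≤ r ∧ x * x = -(r • (1 : D))

theorem smul_one_injective : Function.Injective fun r : ℚ => r • (1 : D) :=
  smul_left_injective ℚ one_ne_zero

theorem isPure_zero : IsPure (0 : D) := ⟨0, le_rfl, by simp⟩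

theorem IsPure.smul {x : D} (hx : IsPure x) (a : ℚ) : IsPure (a • x) := by
  obtain ⟨r, hr, hx⟩ := hx
  refine ⟨a ^ 2 * r, by positivity, ?_⟩
  rw [smul_mul_smul_comm, hx]
  module

theorem IsPure.eq_zero {r : ℚ} (hx : IsPure (r • (1 : D))) : r = 0 := by
  obtain ⟨s, hs, hx⟩ := hx
  have : (r * r) • (1 : D) = (-s) • (1 : D) := by
    rw [neg_smul, ← hx, smul_mul_smul_comm, one_mul]
  have := smul_one_injective this
  nlinarith

theorem IsPure.exists_pos {x : D} (hx : IsPure x) (h0 : x ≠ 0) :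
    ∃ r : ℚ, 0 < r ∧ x * x = -(r • (1 : D)) := by
  obtain ⟨r, hr, hx⟩ := hx
  refine ⟨r, lt_of_le_of_ne hr ?_, hx⟩
  rintro rfl
  rw [zero_smul, neg_zero, mul_self_eq_zero] at hx
  exact h0 hx

/-- A pure element with a nontrivial rational multiple which is rational vanishes. -/
theorem IsPure.eq_zero_or {x : D} (hx : IsPure x) {a m : ℚ} (h : a • x = m • (1 : D)) :
    a = 0 ∨ x = 0 := by
  by_contra! hax
  have h1 : x = (a⁻¹ * m) • (1 : D) := by
    rw [mul_smul, ← h, smul_smul, inv_mul_cancel₀ hax.1, one_smul]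
  rw [h1] at hx
  exact hax.2 (by rw [h1, hx.eq_zero, zero_smul])

/-- The dependent case: y = u + vx with u, v rational. Scalarity of y² makes 2uvx scalar, so u = 0,
v = 0 or x = 0. -/
theorem exists_smul_eq_of_dependent {x y : D} (hx : IsPure x) (hy : IsPure y) {a b m : ℚ}
    (hb : b ≠ 0) (hxy : a • x + b • y = m • (1 : D)) : ∃ s : ℚ, x * y + y * x = s • (1 : D) := by
  obtain ⟨r, hr, hxx⟩ := hx
  have hx : IsPure x := ⟨r, hr, hxx⟩
  obtain ⟨r', hr', hyy⟩ := hy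
  have hy' : y = (b⁻¹ * m) • (1 : D) + (-(b⁻¹ * a)) • x := by
    have : y = b⁻¹ • (b • y) := by rw [smul_smul, inv_mul_cancel₀ hb, one_smul]
    rw [this, eq_sub_of_add_eq' hxy]
    module
  generalize b⁻¹ * m = u at hy'
  generalize -(b⁻¹ * a) = v at hy'
  subst hy'
  have h1 : (2 * u * v) • x = (-r' - u ^ 2 + v ^ 2 * r) • (1 : D) := by
    have h2 : (u • (1 : D) + v • x) * (u • (1 : D) + v • x) =
        u ^ 2 • (1 : D) + (2 * u * v) • x + v ^ 2 • (x * x) := by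
      simp only [mul_add, add_mul, smul_mul_smul_comm, one_mul, mul_one]
      module
    rw [h2, hxx] at hyy
    linear_combination (norm := module) hyy
  rcases hx.eq_zero_or h1 with h0 | rfl
  · rcases mul_eq_zero.1 h0 with h0 | rfl
    · have hu : u = 0 := by linarith
      subst hu
      refine ⟨-2 * v * r, ?_⟩
      simp only [zero_smul, zero_add, mul_smul_comm, smul_mul_assoc, hxx]
      module
    · have : IsPure (u • (1 : D)) := ⟨r', hr', by simpa using hyy⟩
      rw [this.eq_zero]
      exact ⟨0, by simp⟩
  · exact ⟨0, by simp⟩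

variable (hD : ∀ x : D, ∃ t : ℚ, IsPure (x - t • (1 : D)))

include hD

/-- Adding the quadratic equations of x + y and x - y cancels xy + yx and leaves a linear relation
between x, y and 1. Either it is nontrivial, or p = q = 0 and the equation of x + y gives the claim.
-/
theorem IsPure.anticommutator {x y : D} (hx : IsPure x) (hy : IsPure y) :
    ∃ s : ℚ, x * y + y * x = s • (1 : D) := by
  obtain ⟨p, e, he, hp⟩ := hD (x + y)
  obtain ⟨q, f, hf, hq⟩ := hD (x - y)
  obtain ⟨r, hr, hxx⟩ := id hx
  obtain ⟨r', hr', hyy⟩ := id hy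
  have hp' : (x + y - p • (1 : D)) * (x + y - p • (1 : D)) =
      x * x + y * y + (x * y + y * x) - (2 * p) • (x + y) + p ^ 2 • (1 : D) := by
    simp only [mul_add, add_mul, mul_sub, sub_mul, smul_mul_assoc, mul_smul_comm, one_mul, mul_one]
    module
  have hq' : (x - y - q • (1 : D)) * (x - y - q • (1 : D)) =
      x * x + y * y - (x * y + y * x) - (2 * q) • (x - y) + q ^ 2 • (1 : D) := by
    simp only [mul_sub, sub_mul, smul_mul_assoc, mul_smul_comm, one_mul, mul_one]
    module
  rw [hp', hxx, hyy] at hp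
  rw [hq', hxx, hyy] at hq
  have hsum : (2 * (p + q)) • x + (2 * (p - q)) • y =
      (e + f - 2 * r - 2 * r' + p ^ 2 + q ^ 2) • (1 : D) := by
    linear_combination (norm := module) -hp - hq
  by_cases h1 : p - q = 0
  · by_cases h2 : p + q = 0
    · have hp0 : p = 0 := by linarith
      subst hp0
      refine ⟨r + r' - e, ?_⟩
      linear_combination (norm := module) hp
    · obtain ⟨s, hs⟩ := exists_smul_eq_of_dependent hy hx (b := 2 * (p + q)) (by simpa using h2)
        (by rw [add_comm]; exact hsum)
      exact ⟨s, by rw [add_comm, hs]⟩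
  · exact exists_smul_eq_of_dependent hx hy (by simpa using h1) hsum

/-- The square of x + y is scalar, so 2q(x + y - q) is scalar as well. Either q = 0, or x + y = q,
where purity of x and y again forces q = 0. -/
theorem IsPure.add {x y : D} (hx : IsPure x) (hy : IsPure y) : IsPure (x + y) := by
  obtain ⟨s, hs⟩ := hx.anticommutator hD hy
  obtain ⟨r, hr, hxx⟩ := id hx
  obtain ⟨r', hr', hyy⟩ := id hy
  obtain ⟨q, hz⟩ := hD (x + y)
  obtain ⟨e, he, hzz⟩ := id hz
  have h1 : (x + y) * (x + y) = (s - r - r') • (1 : D) := by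
    have : (x + y) * (x + y) = x * x + y * y + (x * y + y * x) := by noncomm_ring
    rw [this, hs, hxx, hyy]
    module
  have h2 : (2 * q) • (x + y - q • (1 : D)) = (s - r - r' - q ^ 2 + e) • (1 : D) := by
    have : (x + y - q • (1 : D)) * (x + y - q • (1 : D)) =
        (x + y) * (x + y) - (2 * q) • (x + y) + q ^ 2 • (1 : D) := by
      simp only [mul_sub, sub_mul, smul_mul_assoc, mul_smul_comm, one_mul, mul_one]
      module
    rw [this, h1] at hzz
    linear_combination (norm := module) -hzz
  rcases hz.eq_zero_or h2 with h0 | h0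
  · have hq0 : q = 0 := by linarith
    subst hq0
    simpa using hz
  · have hq0 : q = 0 := by
      have hy' : y = q • (1 : D) - x := by rw [eq_sub_iff_add_eq', ← sub_eq_zero, h0]
      have h3 : (2 * q) • x = (q ^ 2 - r + r') • (1 : D) := by
        rw [hy'] at hyy
        simp only [mul_sub, sub_mul, smul_mul_assoc, mul_smul_comm, one_mul, mul_one, hxx] at hyy
        linear_combination (norm := module) -hyy
      rcases hx.eq_zero_or h3 with h4 | rfl
      · linarith
      · rw [sub_zero] at hy'
        rw [hy'] at hy
        exact hy.eq_zero
    rw [sub_eq_zero.1 h0, hq0, zero_smul]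
    exact isPure_zero

end Frobenius

end

/-! ### Embedding into Hamilton's quaternions. -/

section

open Polynomial OrderElem
open scoped Quaternion QuadraticAlgebra

section Embedding

variable {D : Type*} [DivisionRing D] [Algebra ℚ D]

theorem exists_sqrt_quaternion_pair {A B : ℚ} (hA : 0 < A) (hB : 0 < B) :
    ∃ I J : ℍ[ℝ], I * I = (-A) • (1 : ℍ[ℝ]) ∧ J * J = (-B) • (1 : ℍ[ℝ]) ∧ J * I = -(I * J) := by
  have hsm : ∀ r : ℚ, r • (1 : ℍ[ℝ]) = ((r : ℝ) : ℍ[ℝ]) := fun r => by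
    rw [Rat.smul_def, mul_one]; exact (Quaternion.coe_ratCast r).symm
  have hA' : √(A : ℝ) * √(A : ℝ) = A := Real.mul_self_sqrt (by exact_mod_cast hA.le)
  have hB' : √(B : ℝ) * √(B : ℝ) = B := Real.mul_self_sqrt (by exact_mod_cast hB.le)
  have h1 : (⟨0, √A, 0, 0⟩ : ℍ[ℝ]) * ⟨0, √A, 0, 0⟩ = (-A) • (1 : ℍ[ℝ]) := by
    rw [hsm]
    ext <;> simp [hA']
  have h2 : (⟨0, 0, √B, 0⟩ : ℍ[ℝ]) * ⟨0, 0, √B, 0⟩ = (-B) • (1 : ℍ[ℝ]) := by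
    rw [hsm]
    ext <;> simp [hB']
  have h3 : (⟨0, 0, √B, 0⟩ : ℍ[ℝ]) * ⟨0, √A, 0, 0⟩ =
      -((⟨0, √A, 0, 0⟩ : ℍ[ℝ]) * ⟨0, 0, √B, 0⟩) := by
    ext <;> simp [mul_comm]
  exact ⟨_, _, h1, h2, h3⟩

/-- A quaternion basis from two anticommuting square roots. -/
def anticommutingBasis {S : Type*} [Ring S] [Algebra ℚ S] {A B : ℚ} {i j : S}
    (hi : i * i = (-A) • (1 : S)) (hj : j * j = (-B) • (1 : S)) (hji : j * i = -(i * j)) :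
    QuaternionAlgebra.Basis S (-A) 0 (-B) where
  i := i
  j := j
  k := i * j
  i_mul_i := by rw [hi, zero_smul, add_zero]
  j_mul_j := hj
  i_mul_j := rfl
  j_mul_i := by rw [hji, zero_smul, zero_sub]

theorem liftHom_anticommutingBasis_injective {A B : ℚ} (hA : 0 < A) (hB : 0 < B) {i j : D}
    (hi : i * i = (-A) • (1 : D)) (hj : j * j = (-B) • (1 : D)) (hji : j * i = -(i * j)) :
    Function.Injective (anticommutingBasis hi hj hji).liftHom := by
  rw [injective_iff_map_eq_zero]
  rintro ⟨a, b, c, d⟩ hz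
  have h1 : (⟨a, b, c, d⟩ : QuaternionAlgebra ℚ (-A) 0 (-B)) * ⟨a, -b, -c, -d⟩ =
      algebraMap ℚ _ (a ^ 2 + A * b ^ 2 + B * c ^ 2 + A * B * d ^ 2) := by
    rw [QuaternionAlgebra.algebraMap_eq]
    ext <;> simp <;> ring
  have h2 := congrArg (anticommutingBasis hi hj hji).liftHom h1
  rw [map_mul, hz, zero_mul, AlgHom.commutes, eq_comm, map_eq_zero] at h2
  have p1 := sq_nonneg a
  have p2 := mul_nonneg hA.le (sq_nonneg b)
  have p3 := mul_nonneg hB.le (sq_nonneg c)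
  have p4 := mul_nonneg (mul_pos hA hB).le (sq_nonneg d)
  have ha : a = 0 := pow_eq_zero_iff two_ne_zero |>.1 (by linarith)
  have hb : A * b ^ 2 = 0 := by linarith
  have hc : B * c ^ 2 = 0 := by linarith
  have hd : A * B * d ^ 2 = 0 := by linarith
  have hb := pow_eq_zero_iff two_ne_zero |>.1 ((mul_eq_zero.1 hb).resolve_left hA.ne')
  have hc := pow_eq_zero_iff two_ne_zero |>.1 ((mul_eq_zero.1 hc).resolve_left hB.ne')
  have hd := pow_eq_zero_iff two_ne_zero |>.1 ((mul_eq_zero.1 hd).resolve_left (mul_pos hA hB).ne')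
  subst ha hb hc hd
  rfl

theorem liftHom_anticommutingBasis_mk {S : Type*} [Ring S] [Algebra ℚ S] {A B : ℚ} {i j : S}
    (hi : i * i = (-A) • (1 : S)) (hj : j * j = (-B) • (1 : S)) (hji : j * i = -(i * j))
    (a b c d : ℚ) : (anticommutingBasis hi hj hji).liftHom ⟨a, b, c, d⟩ =
      a • 1 + b • i + c • j + d • (i * j) := by
  simp [anticommutingBasis, QuaternionAlgebra.Basis.lift, Algebra.algebraMap_eq_smul_one]

/-- Composing the inverse of a bijective homomorphism with another homomorphism. -/
theorem nonempty_ringHom_of_bijective {E F G : Type*} [Ring E] [Ring F] [Ring G] {f : E →+* F}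
    (hf : Function.Bijective f) (g : E →+* G) : Nonempty (F →+* G) :=
  ⟨g.comp (RingEquiv.ofBijective f hf).symm.toRingHom⟩

/-- A division algebra all of whose elements are rational or imaginary quadratic embeds into
Hamilton's quaternions. -/
theorem nonempty_ringHom_quaternion (hD : ∀ x : D, ∃ t : ℚ, IsPure (x - t • (1 : D))) :
    Nonempty (D →+* ℍ[ℝ]) := by
  by_cases h1 : ∀ x : D, IsPure x → x = 0
  · refine nonempty_ringHom_of_bijective (f := algebraMap ℚ D)
      ⟨(algebraMap ℚ D).injective, fun x => ?_⟩ (algebraMap ℚ ℍ[ℝ])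
    obtain ⟨t, ht⟩ := hD x
    exact ⟨t, by rw [Algebra.algebraMap_eq_smul_one, sub_eq_zero.1 (h1 _ ht)]⟩
  push Not at h1
  obtain ⟨i, hi, hi0⟩ := h1
  obtain ⟨A, hA, hii⟩ := hi.exists_pos hi0
  rw [← neg_smul] at hii
  by_cases h2 : ∀ x : D, IsPure x → ∃ b : ℚ, x = b • i
  · obtain ⟨I, J, hI, -, -⟩ := exists_sqrt_quaternion_pair hA hA
    refine nonempty_ringHom_of_bijective
      (f := (QuadraticAlgebra.lift (a := -A) (b := 0) ⟨i, by rw [hii]; simp⟩ :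
        QuadraticAlgebra ℚ (-A) 0 →ₐ[ℚ] D).toRingHom) ⟨?_, fun x => ?_⟩
      (QuadraticAlgebra.lift (a := -A) (b := 0) ⟨I, by rw [hI]; simp⟩ :
        QuadraticAlgebra ℚ (-A) 0 →ₐ[ℚ] ℍ[ℝ]).toRingHom
    · rw [injective_iff_map_eq_zero]
      rintro ⟨a, b⟩ hz
      replace hz : a • (1 : D) + b • i = 0 := by simpa using hz
      have hbi : b • i = (-a) • (1 : D) := by rw [neg_smul]; exact eq_neg_of_add_eq_zero_right hz
      have hb := (hi.eq_zero_or hbi).resolve_right hi0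
      subst hb
      rw [zero_smul, add_zero] at hz
      have ha : a = 0 := smul_one_injective (D := D) (by simpa using hz)
      subst ha
      rfl
    · obtain ⟨t, ht⟩ := hD x
      obtain ⟨b, hb⟩ := h2 _ ht
      refine ⟨⟨t, b⟩, ?_⟩
      have : t • (1 : D) + b • i = x := by rw [← hb]; abel
      simpa using this
  push Not at h2
  obtain ⟨y, hy, hyi⟩ := h2
  obtain ⟨s, hs⟩ := hi.anticommutator hD hy
  -- Gram–Schmidt: the component of y along i is removed, so that j anticommutes with i.
  set j := y + (s / (2 * A)) • i with hj
  have hjp : IsPure j := hy.add hD (hi.smul _)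
  have hj0 : j ≠ 0 := by
    intro h0
    refine hyi (-(s / (2 * A))) ?_
    rw [neg_smul]
    exact eq_neg_of_add_eq_zero_left h0
  obtain ⟨B, hB, hjj⟩ := hjp.exists_pos hj0
  rw [← neg_smul] at hjj
  have hA0 := hA.ne'
  have hB0 := hB.ne'
  have hji : j * i = -(i * j) := by
    rw [eq_neg_iff_add_eq_zero, hj, add_mul, mul_add, smul_mul_assoc, mul_smul_comm, hii]
    have : y * i + (s / (2 * A)) • (-A) • (1 : D) + (i * y + (s / (2 * A)) • (-A) • (1 : D)) =
        (i * y + y * i) + (2 * (s / (2 * A)) * (-A)) • (1 : D) := by module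
    rw [this, hs, ← add_smul]
    have : s + 2 * (s / (2 * A)) * (-A) = 0 := by field_simp; ring
    rw [this, zero_smul]
  have hiji : i * j * i = A • j := by
    rw [mul_assoc, hji, mul_neg, ← mul_assoc, hii, smul_one_mul, neg_smul, neg_neg]
  have hiij : i * (i * j) = -(A • j) := by
    rw [← mul_assoc, hii, smul_one_mul, neg_smul]
  have hijj : i * j * j = -(B • i) := by
    rw [mul_assoc, hjj, mul_smul_one, neg_smul]
  have hjij : j * (i * j) = B • i := by
    rw [← mul_assoc, hji, neg_mul, hijj, neg_neg]
  have hkk : i * j * (i * j) = -((A * B) • (1 : D)) := by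
    rw [← mul_assoc, hiji, smul_mul_assoc, hjj, smul_smul, mul_neg, neg_smul]
  have hk : IsPure (i * j) := ⟨A * B, (mul_pos hA hB).le, hkk⟩
  obtain ⟨I, J, hI, hJ, hJI⟩ := exists_sqrt_quaternion_pair hA hB
  refine nonempty_ringHom_of_bijective (f := (anticommutingBasis hii hjj hji).liftHom.toRingHom)
    ⟨liftHom_anticommutingBasis_injective hA hB hii hjj hji, fun x => ?_⟩
    (anticommutingBasis hI hJ hJI).liftHom.toRingHom
  obtain ⟨t, ht⟩ := hD x
  set z := x - t • (1 : D) with hz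
  obtain ⟨a, ha⟩ := hi.anticommutator hD ht
  obtain ⟨b, hb⟩ := hjp.anticommutator hD ht
  obtain ⟨c, hc⟩ := hk.anticommutator hD ht
  -- The components of z along i, j and ij are removed. The remainder anticommutes with all three,
  -- but anticommuting with i and j means commuting with ij; so w = 0 and x lies in the span.
  set w := z + (a / (2 * A)) • i + (b / (2 * B)) • j + (c / (2 * (A * B))) • (i * j) with hw
  have e1 : i * w + w * i = 0 := by
    have : i * w + w * i = (i * z + z * i) + (a / (2 * A)) • (i * i + i * i) := by
      simp only [hw, mul_add, add_mul, smul_mul_assoc, mul_smul_comm, hji, hiji, hiij]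
      module
    rw [this, ha, hii, ← add_smul, smul_smul, ← add_smul]
    have : a + a / (2 * A) * (-A + -A) = 0 := by field_simp; ring
    rw [this, zero_smul]
  have e2 : j * w + w * j = 0 := by
    have : j * w + w * j = (j * z + z * j) + (b / (2 * B)) • (j * j + j * j) := by
      simp only [hw, mul_add, add_mul, smul_mul_assoc, mul_smul_comm, hji, hijj, hjij]
      module
    rw [this, hb, hjj, ← add_smul, smul_smul, ← add_smul]
    have : b + b / (2 * B) * (-B + -B) = 0 := by field_simp; ring
    rw [this, zero_smul]
  have e3 : i * j * w + w * (i * j) = 0 := by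
    have : i * j * w + w * (i * j) =
        (i * j * z + z * (i * j)) + (c / (2 * (A * B))) • (i * j * (i * j) + i * j * (i * j)) := by
      simp only [hw, mul_add, add_mul, smul_mul_assoc, mul_smul_comm, hiji, hiij, hijj, hjij]
      module
    rw [this, hc, hkk, ← neg_smul, ← add_smul, smul_smul, ← add_smul]
    have : c + c / (2 * (A * B)) * (-(A * B) + -(A * B)) = 0 := by field_simp; ring
    rw [this, zero_smul]
  have e4 : i * j * w = w * (i * j) := by
    rw [mul_assoc, eq_neg_of_add_eq_zero_left e2, mul_neg, ← mul_assoc,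
      eq_neg_of_add_eq_zero_left e1, neg_mul, neg_neg, mul_assoc]
  have hw0 : w = 0 := by
    rw [e4, ← two_smul ℚ, smul_eq_zero_iff_right two_ne_zero] at e3
    refine (mul_eq_zero.1 e3).resolve_right (mul_ne_zero hi0 hj0)
  refine ⟨⟨t, -(a / (2 * A)), -(b / (2 * B)), -(c / (2 * (A * B)))⟩, ?_⟩
  refine (liftHom_anticommutingBasis_mk hii hjj hji _ _ _ _).trans ?_
  rw [hw0, hz] at hw
  linear_combination (norm := module) hw

/-- Subtracting the equation satisfied by every quaternion makes (t - 2 Re y)y real. If t ≠ 2 Re y,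
then y is a real root of a quadratic with negative discriminant. -/
theorem star_eq_and_normSq_eq {y : ℍ[ℝ]} {t n : ℝ} (hy : y * y = t • y - n • (1 : ℍ[ℝ]))
    (hdisc : t ^ 2 < 4 * n) : y + star y = (t : ℍ[ℝ]) ∧ y * star y = (n : ℍ[ℝ]) := by
  have hc : ∀ r : ℝ, (r : ℍ[ℝ]) = r • (1 : ℍ[ℝ]) := fun r => by
    rw [← Quaternion.coe_mul_eq_smul, mul_one]
  have h1 : y * y = (2 * y.re) • y - (Quaternion.normSq y) • (1 : ℍ[ℝ]) := by
    have h2 : star y = ((2 * y.re : ℝ) : ℍ[ℝ]) - y := by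
      rw [Quaternion.star_eq_two_re_sub]
    have h3 := Quaternion.self_mul_star (a := y)
    rw [h2, mul_sub, Quaternion.mul_coe_eq_smul] at h3
    rw [← hc, ← h3]
    abel
  have h2 : (t - 2 * y.re) • y = ((n - Quaternion.normSq y : ℝ) : ℍ[ℝ]) := by
    rw [hc]
    linear_combination (norm := module) h1 - hy
  have h3 : t = 2 * y.re := by
    by_contra hne
    have hne' : t - 2 * y.re ≠ 0 := sub_ne_zero.2 hne
    have h4 : y = (((t - 2 * y.re)⁻¹ * (n - Quaternion.normSq y) : ℝ) : ℍ[ℝ]) := by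
      rw [Quaternion.coe_mul, ← h2, Quaternion.coe_mul_eq_smul, smul_smul, inv_mul_cancel₀ hne',
        one_smul]
    obtain ⟨r, rfl⟩ : ∃ r : ℝ, y = (r : ℍ[ℝ]) := ⟨_, h4⟩
    have h5 := congrArg QuaternionAlgebra.re hy
    simp at h5
    nlinarith [sq_nonneg (2 * r - t)]
  have h4 : n = Quaternion.normSq y := by
    rw [← h3, sub_self, zero_smul, eq_comm, ← Quaternion.coe_zero, Quaternion.coe_inj] at h2
    linarith
  refine ⟨?_, ?_⟩
  · rw [Quaternion.self_add_star', h3]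
  · rw [Quaternion.self_mul_star, h4]

end Embedding

end

/-! ### Integrality of traces and norms. -/

section

open Polynomial OrderElem
open scoped Quaternion

section Integrality

variable {D : Type*} [DivisionRing D] [Algebra ℚ D] {O : Subring D}

/-- Gauss's lemma: a monic rational divisor of a monic integral polynomial is integral. -/
theorem exists_int_coeff_minpoly {x : D} (hx : IsIntegral ℤ x) (k : ℕ) :
    ∃ n : ℤ, (minpoly ℚ x).coeff k = n := by
  obtain ⟨p, hp, hpx⟩ := hx
  have hdvd : minpoly ℚ x ∣ p.map (algebraMap ℤ ℚ) := by
    refine minpoly.dvd ℚ x ?_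
    rw [aeval_map_algebraMap]
    exact hpx
  have hint : IsIntegral ℚ x := IsIntegral.tower_top (R := ℤ) ⟨p, hp, hpx⟩
  obtain ⟨g, hg⟩ := IsIntegrallyClosed.eq_map_mul_C_of_dvd ℚ hp hdvd
  rw [minpoly.monic hint, C_1, mul_one] at hg
  exact ⟨g.coeff k, by rw [← hg, coeff_map]; rfl⟩

theorem OrderElem.IsZOrder.isIntegral (hO : IsZOrder O) (x : O) : IsIntegral ℤ (x : D) := by
  have := hO.finite
  exact (Algebra.IsIntegral.isIntegral (R := ℤ) x).map O.subtype.toIntAlgHom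

theorem OrderElem.IsZOrder.isPure_sub [FiniteDimensional ℚ D] (hO : IsZOrder O)
    (hU : Finite Oˣ) (x : D) : ∃ t : ℚ, IsPure (x - t • (1 : D)) := by
  obtain ⟨r, hr⟩ | ⟨t, n, hx, hdisc⟩ := hO.quadratic hU x
  · refine ⟨r, 0, le_rfl, ?_⟩
    rw [← hr, Algebra.algebraMap_eq_smul_one]
    simp
  · have h1 := minpoly.aeval ℚ x
    rw [hx] at h1
    simp only [map_add, map_sub, map_mul, map_pow, aeval_X, aeval_C,
      Algebra.algebraMap_eq_smul_one, smul_one_mul] at h1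
    refine ⟨t / 2, n - t ^ 2 / 4, by linarith, ?_⟩
    have h2 : (x - (t / 2) • (1 : D)) * (x - (t / 2) • (1 : D)) =
        x ^ 2 - t • x + (t ^ 2 / 4) • (1 : D) := by
      simp only [mul_sub, sub_mul, smul_mul_assoc, mul_smul_comm, one_mul, mul_one, sq]
      module
    rw [h2]
    linear_combination (norm := module) h1

/-- An order with finitely many units is definite. -/
theorem OrderElem.IsZOrder.exists_isDefinite [FiniteDimensional ℚ D] (hO : IsZOrder O)
    (hU : Finite Oˣ) : ∃ φ : O →+* ℍ[ℝ], IsDefinite φ := by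
  obtain ⟨ψ⟩ := nonempty_ringHom_quaternion (hO.isPure_sub hU)
  have hψ : ∀ (r : ℚ) (x : D), ψ (r • x) = (r : ℝ) • ψ x := fun r x => by
    rw [Algebra.smul_def, map_mul, eq_ratCast, map_ratCast, ← Quaternion.coe_ratCast,
      Quaternion.coe_mul_eq_smul]
  have key : ∀ x : O, ∃ t n : ℤ, ψ x + star (ψ x) = t ∧ ψ x * star (ψ x) = n := by
    intro x
    obtain ⟨r, hr⟩ | ⟨t, n, hx, hdisc⟩ := hO.quadratic hU (x : D)
    · have h1 := hO.isIntegral x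
      rw [← hr] at h1
      obtain ⟨m, hm⟩ := exists_int_of_isIntegral_algebraMap h1
      have h2 : ψ x = (m : ℍ[ℝ]) := by rw [← hr, ← hm, eq_ratCast, map_ratCast, Rat.cast_intCast]
      refine ⟨2 * m, m * m, ?_, ?_⟩
      · rw [h2]; push_cast; rw [star_intCast]; rw [two_mul]
      · rw [h2]; push_cast; rw [star_intCast]
    · obtain ⟨a, ha⟩ := exists_int_coeff_minpoly (hO.isIntegral x) 1
      obtain ⟨b, hb⟩ := exists_int_coeff_minpoly (hO.isIntegral x) 0
      have ht : t = ((-a : ℤ) : ℚ) := by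
        rw [hx] at ha
        simp [coeff_C] at ha
        push_cast; linarith
      have hn : n = b := by
        rw [hx] at hb
        simpa using hb
      have h1 := minpoly.aeval ℚ (x : D)
      rw [hx] at h1
      simp only [map_add, map_sub, map_mul, map_pow, aeval_X, aeval_C,
        Algebra.algebraMap_eq_smul_one, smul_one_mul] at h1
      have h2 := congrArg ψ h1
      rw [map_add, map_sub, hψ, hψ, map_pow, map_one, map_zero] at h2
      have h3 : ψ x * ψ x = (t : ℝ) • ψ x - (n : ℝ) • (1 : ℍ[ℝ]) := by
        rw [← sq]
        linear_combination (norm := module) h2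
      obtain ⟨h4, h5⟩ := star_eq_and_normSq_eq h3 (by exact_mod_cast hdisc)
      refine ⟨-a, b, ?_, ?_⟩
      · rw [h4, ht, Rat.cast_intCast, Quaternion.coe_intCast]
      · rw [h5, hn, Rat.cast_intCast, Quaternion.coe_intCast]
  exact ⟨ψ.comp O.subtype, ψ.injective.comp Subtype.val_injective,
    fun x => ⟨_, (key x).choose_spec.choose_spec.1⟩,
    fun x => ⟨_, (key x).choose_spec.choose_spec.2⟩⟩

end Integrality

end

/-! ### Ranks and the equivalences. -/

section

open OrderElem ElementaryAbelianization
open scoped Quaternion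

section Saturation

variable (R : Type*) [Ring R]

/-- `unitSaturation` as a `ℤ`-submodule. -/
def unitSaturationSubmodule : Submodule ℤ R :=
  AddSubgroup.toIntSubmodule (unitSaturation R).toAddSubgroup

variable {R}

theorem isTorsionFree_int_of_forall {M : Type*} [AddCommGroup M]
    (hM : ∀ (n : ℤ) (x : M), n ≠ 0 → n • x = 0 → x = 0) : Module.IsTorsionFree ℤ M :=
  ⟨fun n hn => isSMulRegular_iff_right_eq_zero_of_smul.2 fun x hx => hM n x hn.ne_zero hx⟩

theorem isTorsionFree_quotient_unitSaturationSubmodule :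
    Module.IsTorsionFree ℤ (R ⧸ unitSaturationSubmodule R) := by
  refine isTorsionFree_int_of_forall fun n x hn hx => ?_
  obtain ⟨x, rfl⟩ := Submodule.Quotient.mk_surjective _ x
  rw [← Submodule.Quotient.mk_smul, Submodule.Quotient.mk_eq_zero] at hx
  rw [Submodule.Quotient.mk_eq_zero]
  exact mem_unitSaturation_of_zsmul_mem hn hx

theorem Submodule.rank_eq_of_forall_exists_smul_mem {A M : Type*} [CommRing A] [IsDomain A]
    [AddCommGroup M] [Module A M] {K S : Submodule A M} (hKS : K ≤ S)
    (hS : ∀ x ∈ S, ∃ a : A, a ≠ 0 ∧ a • x ∈ K) : Module.rank A K = Module.rank A S := by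
  suffices h0 : Module.rank A (S ⧸ K.submoduleOf S) = 0 by
    rw [← rank_quotient_add_rank_of_isDomain (K.submoduleOf S), h0, zero_add,
      (Submodule.submoduleOfEquivOfLe hKS).rank_eq]
  rw [rank_eq_zero_iff]
  intro x
  obtain ⟨⟨x, hx⟩, rfl⟩ := Submodule.Quotient.mk_surjective _ x
  obtain ⟨a, ha, hax⟩ := hS x hx
  refine ⟨a, ha, ?_⟩
  rw [← Submodule.Quotient.mk_smul, Submodule.Quotient.mk_eq_zero]
  exact hax

end Saturation

namespace IsDefinite

variable {R : Type*} [Ring R] {φ : R →+* ℍ[ℝ]} (h : IsDefinite φ)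

include h

theorem isTorsionFree : Module.IsTorsionFree ℤ R := by
  refine isTorsionFree_int_of_forall fun n x hn hx => ?_
  rw [zsmul_eq_mul] at hx
  refine (h.mul_eq_zero_imp hx).resolve_left fun h0 => hn (h.intCast_injective ?_)
  rw [h0, Int.cast_zero]

/-- The inclusion of the saturation identifies units. -/
theorem isUnit_unitSaturation_iff {x : unitSaturation R} : IsUnit x ↔ IsUnit (x : R) := by
  constructor
  · exact fun hx => hx.map (unitSaturation R).subtype
  · intro hx
    refine ⟨⟨x, ⟨h.conj x, (h.isUnit_conj hx).mem_unitSaturation⟩, Subtype.ext ?_,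
      Subtype.ext ?_⟩, rfl⟩
    · exact h.mul_conj_of_isUnit hx
    · exact h.conj_mul_of_isUnit hx

/-- Lets the classification be applied to the saturation as a ring in its own right; it has the same
units as R. -/
theorem unitSaturation_unitSaturation : unitSaturation (unitSaturation R) = ⊤ := by
  have key : ∀ y (hy : y ∈ unitSpan R),
      (⟨y, unitSpan_le_unitSaturation R hy⟩ : unitSaturation R) ∈ unitSpan (unitSaturation R) := by
    intro y hy
    have hy' : y ∈ Submodule.span ℤ {x : R | IsUnit x} := hy
    induction hy' using Submodule.span_induction with
    | mem y hu => exact ((h.isUnit_unitSaturation_iff (x := ⟨y, _⟩)).2 hu).mem_unitSpan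
    | zero => exact zero_mem _
    | add y z h1 h2 iy iz => exact add_mem (iy h1) (iz h2)
    | smul n y h1 iy => exact zsmul_mem (iy h1) n
  rw [eq_top_iff]
  rintro ⟨x, n, hn, hx⟩ -
  exact ⟨n, hn, key _ hx⟩

/-- A definite ring spanned up to finite index by its units is one of the standard ones. -/
theorem form_of_unitSaturation_eq_top (htop : unitSaturation R = ⊤) :
    (∀ x : R, ∃ a : ℤ, x = a) ∨ IsGaussForm R ∨ IsEisensteinForm R ∨ IsLipschitzForm R ∨
      IsHurwitzForm R ∨ IsOrderThreeForm R := by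
  by_cases hcomm : ∀ x y : R, IsUnit x → IsUnit y → x * y = y * x
  · have := h.form_of_commuting htop hcomm
    tauto
  · push Not at hcomm
    obtain ⟨a, b, ha, hb, hab⟩ := hcomm
    have := h.form_of_noncommuting ha hb hab
    tauto

/-- When two units do not commute, R has a basis of units and the saturation is everything; only the
commuting case needs peak reduction. -/
theorem ker_upperClass_le {x : R} (hx : upperClass R x = 0) : x ∈ unitSaturation R := by
  by_cases hcomm : ∀ x y : R, IsUnit x → IsUnit y → x * y = y * x
  · exact MarkedMatrix.mem_unitSaturation_of_abelianization h hcomm hx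
  · push Not at hcomm
    obtain ⟨a, b, ha, hb, hab⟩ := hcomm
    obtain ⟨B, hB, hBU⟩ := h.exists_unit_basis
      (by have := h.form_of_noncommuting ha hb hab; tauto)
    refine unitSpan_le_unitSaturation R (Submodule.span_mono hBU ?_)
    rw [hB.2]
    trivial

omit h in
theorem twelve_zsmul_upperClass_of_mem {x : R} (hx : x ∈ unitSpan R) :
    (12 : ℤ) • upperClass R x = 0 := by
  replace hx : x ∈ Submodule.span ℤ {x : R | IsUnit x} := hx
  induction hx using Submodule.span_induction with
  | mem x hu => exact twelve_zsmul_upperClass hu.unit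
  | zero => rw [map_zero, smul_zero]
  | add x y _ _ ix iy => rw [map_add, smul_add, ix, iy, add_zero]
  | smul n x _ ix => rw [map_zsmul, smul_comm, ix, smul_zero]

/-- The rank of the abelianization is the corank of the span of the units. -/
theorem rank_abelianization_add :
    Module.rank ℤ (Additive (Abelianization (elementaryGroup (Fin 2) R))) +
      Module.rank ℤ (unitSaturationSubmodule R) = Module.rank ℤ R := by
  let f := (upperClass R).toIntLinearMap
  rw [← (f.quotKerEquivOfSurjective upperClass_surjective).rank_eq,
    ← rank_quotient_add_rank_of_isDomain (LinearMap.ker f)]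
  congr 1
  symm
  refine Submodule.rank_eq_of_forall_exists_smul_mem
    (fun x hx => h.ker_upperClass_le (LinearMap.mem_ker.1 hx)) ?_
  rintro x ⟨n, hn, hx⟩
  refine ⟨12 * n, mul_ne_zero (by norm_num) hn, LinearMap.mem_ker.2 ?_⟩
  rw [mul_smul, map_zsmul]
  exact twelve_zsmul_upperClass_of_mem hx

variable [Module.Finite ℤ R]

/-- Units in a basis are independent inside the saturation, which bounds their number. The bound is
attained: the saturation has a basis of units by the classification, and its torsion-free quotient
is free. -/
theorem invNumber_eq_finrank :
    invNumber R = Module.finrank ℤ (unitSaturationSubmodule R) := by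
  have := h.isTorsionFree
  have : Module.Free ℤ R := Module.free_of_finite_type_torsion_free'
  have := isTorsionFree_quotient_unitSaturationSubmodule (R := R)
  have : Module.Free ℤ (R ⧸ unitSaturationSubmodule R) := Module.free_of_finite_type_torsion_free'
  have hg := isGreatest_invNumber R
  apply le_antisymm
  · obtain ⟨B, hB, hm⟩ := hg.1
    rw [hm]
    have hli : LinearIndependent ℤ (fun x : ↥(B ∩ {x | IsUnit x}) =>
        (⟨x, IsUnit.mem_unitSaturation x.2.2⟩ : unitSaturationSubmodule R)) :=
      LinearIndependent.of_comp (unitSaturationSubmodule R).subtype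
        (LinearIndepOn.mono hB.1 Set.inter_subset_left)
    have : Finite ↥(B ∩ {x | IsUnit x}) := hli.finite_of_isNoetherian
    have := Fintype.ofFinite ↥(B ∩ {x | IsUnit x})
    rw [← Nat.card_coe_set_eq, Nat.card_eq_fintype_card]
    exact hli.fintype_card_le_finrank
  · obtain ⟨B, hB, hBU⟩ := (h.restrict (unitSaturation R)).exists_unit_basis
      ((h.restrict _).form_of_unitSaturation_eq_top h.unitSaturation_unitSaturation)
    have hB1 : LinearIndependent ℤ (fun x : B => (x : unitSaturation R)) := hB.1
    let b : Module.Basis B ℤ (unitSaturation R) :=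
      Module.Basis.mk hB1 (by rw [Subtype.range_coe]; exact hB.2.ge)
    let e : unitSaturation R ≃ₗ[ℤ] unitSaturationSubmodule R :=
      AddEquiv.toIntLinearEquiv (AddEquiv.refl (unitSaturation R))
    let b' : Module.Basis B ℤ (unitSaturationSubmodule R) := b.map e
    -- The unit basis of the saturation is extended by lifts of a basis of the quotient.
    let c := b'.sumQuot (Module.Free.chooseBasis ℤ (R ⧸ unitSaturationSubmodule R))
    have hc : ∀ x : B, c (Sum.inl x) = ((x : unitSaturation R) : R) := by
      intro x
      rw [Module.Basis.sumQuot_inl]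
      simp [b', b, e]
      rfl
    have hcB : IsZBasis (Set.range c) := ⟨c.linearIndependent.linearIndepOn_id, c.span_eq⟩
    refine le_trans ?_ (hg.2 ⟨_, hcB, rfl⟩)
    have hfin : (Set.range c).Finite := LinearIndependent.setFinite hcB.1
    rw [Module.finrank_eq_nat_card_basis b', ← Set.ncard_univ,
      ← Set.ncard_image_of_injective Set.univ (c.injective.comp Sum.inl_injective)]
    refine Set.ncard_le_ncard ?_ (hfin.inter_of_left _)
    rintro _ ⟨x, -, rfl⟩
    refine ⟨⟨_, rfl⟩, ?_⟩
    change IsUnit (c (Sum.inl x))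
    rw [hc]
    exact h.isUnit_unitSaturation_iff.1 (hBU x.2)

theorem rank_abelianization_add_invNumber :
    Module.rank ℤ (Additive (Abelianization (elementaryGroup (Fin 2) R))) +
      (invNumber R : Cardinal) = Module.rank ℤ R := by
  rw [h.invNumber_eq_finrank, Module.finrank_eq_rank, h.rank_abelianization_add]

omit h in
theorem finite_abelianization_of_unitSpan_eq_top (htop : unitSpan R = ⊤) :
    Finite (Abelianization (elementaryGroup (Fin 2) R)) := by
  have : Module.Finite ℤ (Additive (Abelianization (elementaryGroup (Fin 2) R))) :=
    Module.Finite.of_surjective (upperClass R).toIntLinearMap upperClass_surjective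
  refine @Module.finite_of_fg_torsion
    (Additive (Abelianization (elementaryGroup (Fin 2) R))) _ _ this ?_
  intro x
  obtain ⟨y, rfl⟩ := upperClass_surjective x
  exact ⟨⟨12, mem_nonZeroDivisors_of_ne_zero (by norm_num)⟩,
    twelve_zsmul_upperClass_of_mem (htop ▸ Subring.mem_top y)⟩

omit [Module.Finite ℤ R] in
theorem unitSaturation_eq_top_of_finite
    (hfin : Finite (Abelianization (elementaryGroup (Fin 2) R))) : unitSaturation R = ⊤ := by
  rw [eq_top_iff]
  rintro x -
  have : Finite (Additive (Abelianization (elementaryGroup (Fin 2) R))) := hfin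
  obtain ⟨n, hn, hx⟩ := isOfFinAddOrder_iff_nsmul_eq_zero.1
    (isOfFinAddOrder_of_finite (upperClass R x))
  refine mem_unitSaturation_of_zsmul_mem (n := n) (by exact_mod_cast hn.ne')
    (h.ker_upperClass_le ?_)
  rw [natCast_zsmul, map_nsmul, hx]

end IsDefinite

theorem unitSpan_eq_top_of_isZBasis {R : Type*} [Ring R] {B : Set R} (hB : IsZBasis B)
    (hBU : B ⊆ {x | IsUnit x}) : unitSpan R = ⊤ :=
  eq_top_iff.2 fun x _ => Submodule.span_mono hBU (by rw [hB.2]; trivial)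

theorem unitSpan_eq_top_iff_closure {R : Type*} [Ring R] :
    unitSpan R = ⊤ ↔ Subring.closure {x : R | IsUnit x} = ⊤ := by
  have : unitSpan R = Subring.closure {x : R | IsUnit x} := by
    apply le_antisymm
    · intro x hx
      replace hx : x ∈ Submodule.span ℤ {x : R | IsUnit x} := hx
      induction hx using Submodule.span_induction with
      | mem x hu => exact Subring.subset_closure hu
      | zero => exact zero_mem _
      | add x y _ _ ix iy => exact add_mem ix iy
      | smul n x _ ix => exact zsmul_mem ix n
    · exact Subring.closure_le.2 fun x hx => IsUnit.mem_unitSpan hx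
  rw [this]

theorem unitSpan_eq_top_iff_span {R : Type*} [Ring R] :
    unitSpan R = ⊤ ↔ Submodule.span ℤ {x : R | IsUnit x} = ⊤ := by
  constructor
  · exact fun htop => eq_top_iff.2 fun x _ => (htop ▸ Subring.mem_top x : x ∈ unitSpan R)
  · exact fun htop => eq_top_iff.2 fun x _ =>
      (htop ▸ Submodule.mem_top : x ∈ Submodule.span ℤ {x : R | IsUnit x})

/-- A definite ring spanned up to finite index by its units is isomorphic to a ring on the list. -/
theorem IsDefinite.nonempty_ringEquiv_of_unitSaturation_eq_top {R : Type*} [Ring R] {φ : R →+* ℍ[ℝ]}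
    (h : IsDefinite φ) (htop : unitSaturation R = ⊤) :
    Nonempty (R ≃+* ℤ) ∨ Nonempty (R ≃+* imagQuadIntegers 1) ∨
      Nonempty (R ≃+* imagQuadIntegers 3) ∨ Nonempty (R ≃+* lipschitz) ∨
      Nonempty (R ≃+* hurwitz) ∨ Nonempty (R ≃+* orderThree) :=
  (h.form_of_unitSaturation_eq_top htop).imp h.nonempty_ringEquiv_int <|
    Or.imp h.nonempty_ringEquiv_gauss <| Or.imp h.nonempty_ringEquiv_eisenstein <|
    Or.imp h.nonempty_ringEquiv_lipschitz <| Or.imp h.nonempty_ringEquiv_hurwitz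
      h.nonempty_ringEquiv_orderThree

end

theorem mainTheorem6 {D : Type*} [DivisionRing D] [Algebra ℚ D] [FiniteDimensional ℚ D]
    (O : Subring D) (hO : OrderElem.IsZOrder O) (hU : Finite Oˣ) :
    Module.rank ℤ (Additive (Abelianization (OrderElem.elementaryGroup (Fin 2) O)))
        + (OrderElem.invNumber O : Cardinal) = Module.rank ℤ O ∧
    List.TFAE [
      Finite (Abelianization (OrderElem.elementaryGroup (Fin 2) O)),
      Nonempty (O ≃+* ℤ) ∨ Nonempty (O ≃+* OrderElem.imagQuadIntegers 1) ∨
        Nonempty (O ≃+* OrderElem.imagQuadIntegers 3) ∨ Nonempty (O ≃+* OrderElem.lipschitz) ∨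
        Nonempty (O ≃+* OrderElem.hurwitz) ∨ Nonempty (O ≃+* OrderElem.orderThree),
      (∃ B : Set O, OrderElem.IsZBasis B ∧ B ⊆ {x : O | IsUnit x}),
      Subring.closure {x : O | IsUnit x} = ⊤,
      Submodule.span ℤ {x : O | IsUnit x} = ⊤] := by
  obtain ⟨φ, h⟩ := hO.exists_isDefinite hU
  have := hO.finite
  refine ⟨h.rank_abelianization_add_invNumber, ?_⟩
  -- Products of units are units, so generation as a ring and generation as a module both become
  -- `unitSpan O = ⊤`.
  rw [← unitSpan_eq_top_iff_closure, ← unitSpan_eq_top_iff_span]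
  tfae_have 1 → 2 := fun hfin =>
    h.nonempty_ringEquiv_of_unitSaturation_eq_top (h.unitSaturation_eq_top_of_finite hfin)
  tfae_have 2 → 4 := by
    rintro (⟨⟨e⟩⟩ | ⟨⟨e⟩⟩ | ⟨⟨e⟩⟩ | ⟨⟨e⟩⟩ | ⟨⟨e⟩⟩ | ⟨⟨e⟩⟩)
    · exact eq_top_iff.2 fun x _ => unitSpan_eq_top_of_ringEquiv e int_mem_unitSpan x
    · exact eq_top_iff.2 fun x _ =>
        unitSpan_eq_top_of_ringEquiv e imagQuadIntegers_one_mem_unitSpan x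
    · exact eq_top_iff.2 fun x _ =>
        unitSpan_eq_top_of_ringEquiv e imagQuadIntegers_three_mem_unitSpan x
    · exact eq_top_iff.2 fun x _ => unitSpan_eq_top_of_ringEquiv e lipschitz_mem_unitSpan x
    · exact eq_top_iff.2 fun x _ => unitSpan_eq_top_of_ringEquiv e hurwitz_mem_unitSpan x
    · exact eq_top_iff.2 fun x _ => unitSpan_eq_top_of_ringEquiv e orderThree_mem_unitSpan x
  tfae_have 4 → 3 := fun htop => h.exists_unit_basis (h.form_of_unitSaturation_eq_top
    (eq_top_iff.2 (htop ▸ unitSpan_le_unitSaturation O)))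
  tfae_have 3 → 5 := fun ⟨_, hB, hBU⟩ => unitSpan_eq_top_of_isZBasis hB hBU
  tfae_have 5 → 4 := id
  tfae_have 4 → 5 := id
  tfae_have 5 → 1 := IsDefinite.finite_abelianization_of_unitSpan_eq_top
  tfae_finish
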